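/- Fix a dimension $d$. Let $A=(a_1,\dots,a_n)$ and $B=(b_1,\dots,b_n)$, $n\ge 1$, be two sequences of points in $\mathbb{R}^d$ with the Euclidean distance $\operatorname{dist}$. Let $G$ be the directed graph on the positions $(a_i,b_j)$, $1\le i,j\le n$, with the edges $(a_i,b_j)\to(a_{i+1},b_j)$, $(a_i,b_j)\to(a_i,b_{j+1})$ and $(a_i,b_j)\to(a_{i+1},b_{j+1})$. For reals $0\le s\le t$ call a position $(a_i,b_j)$ valid if $s\le \operatorname{dist}(a_i,b_j)\le t$. The range $[s,t]$ is feasible with one-sided shortcuts if $(a_1,b_1)$ and $(a_n,b_n)$ are valid and there is a path in $G$ from $(a_1,b_1)$ to $(a_n,b_n)$ that, for every $l$ with $1<l<n$, contains a valid position $(a_k,b_l)$ for some $k$. The discrete Fréchet gap with one-sided shortcuts $d^S_{FG}(A,B)$ is the smallest value of $t-s$, and the discrete Fréchet ratio with one-sided shortcuts $d^S_{FR}(A,B)$ is the smallest value of $t/s$, over all feasible ranges $[s,t]$; here $t/s:=+\infty$ if $s=0$. More generally, for a function $g:\mathbb{R}^2\to\mathbb{R}$ such that $g(a,b)\le g(c,e)$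 whenever $0\le c\le a\le b\le e$, the discrete Fréchet range with one-sided shortcuts with respect to $g$ is the smallest value of $g(s,t)$ over all feasible ranges $[s,t]$. The model of computation is the real RAM: exact real arithmetic $+,-,\times,\div,\sqrt{\ }$ and comparison of reals, together with integer words of $O(\log n)$ bits for counting and for addressing arrays, every operation taking one step. The input is $n$ and the coordinates of the points. Then these minima exist (in $\mathbb{R}\cup\{+\infty\}$ in the case of the ratio), and 1. $d^S_{FG}(A,B)$ can be computed in $O(n^2\log^2 n)$ time; 2. $d^S_{FR}(A,B)$ can be computed in $O(n^2\log^2 n)$ time; 3. there is a single algorithm that, for every function $g$ as above, given access to $g$ as an operation that takes one step, computes the discrete Fréchet range with one-sided shortcuts with respect to $g$ in $O(n^2\log^2 n)$ time, where the implied constant does not depend on $g$. The algorithms and the implied constants may depend on $d$. -/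

import Mathlib

open Filter Asymptotics

namespace DiscreteFrechet

/-! ## One-sided shortcuts

Sequences have `n = m + 1 ≥ 1` points; indices start at `0`, so that `a₁, aₙ` are
`A 0` and `A (Fin.last m)`. -/

/-- The directed edges of the graph `G` on the positions of the two frogs: the `A`-frog moves to its
next point, or the `B`-frog does, or both do. -/
def Move {m : ℕ} (u v : Fin (m + 1) × Fin (m + 1)) : Prop :=
  (v.1.val = u.1.val + 1 ∧ v.2 = u.2) ∨
  (v.1 = u.1 ∧ v.2.val = u.2.val + 1) ∨
  (v.1.val = u.1.val + 1 ∧ v.2.val = u.2.val + 1)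

/-- `P` is an s-path to `v` with respect to the indicator function `f`: a path in `G` from the first
position to `v` whose two ends are valid, and which meets a valid position `(a_k, b_l)` for every
`b_l` strictly between the first and the last point visited by the `B`-frog. -/
structure IsSPath {m : ℕ} (f : Fin (m + 1) × Fin (m + 1) → Prop) (v : Fin (m + 1) × Fin (m + 1))
    (P : List (Fin (m + 1) × Fin (m + 1))) : Prop where
  isChain : P.IsChain Move
  head : P.head? = some (0, 0)
  last : P.getLast? = some v
  valid_first : f (0, 0)
  valid_last : f v
  valid_between : ∀ l : Fin (m + 1), 0 < l → l < v.2 → ∃ k : Fin (m + 1), (k, l) ∈ P ∧ f (k, l)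

/-- `v` is an s-reachable position with respect to `f`. -/
def SReachable {m : ℕ} (f : Fin (m + 1) × Fin (m + 1) → Prop)
    (v : Fin (m + 1) × Fin (m + 1)) : Prop :=
  ∃ P : List (Fin (m + 1) × Fin (m + 1)), IsSPath f v P

/-- The range `[s, t]` is a feasible range with one-sided shortcuts. -/
def SFeasible {m d : ℕ} (A B : Fin (m + 1) → EuclideanSpace ℝ (Fin d)) (s t : ℝ) : Prop :=
  SReachable (fun p => s ≤ dist (A p.1) (B p.2) ∧ dist (A p.1) (B p.2) ≤ t)
    (Fin.last m, Fin.last m)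

/-- `δ` is the discrete Fréchet range with one-sided shortcuts with respect to `g`: the smallest
value `g s t` over the feasible ranges `[s, t]`, `0 ≤ s ≤ t`. The value `⊤` stands for `+∞`. -/
def IsSRange (g : ℝ → ℝ → WithTop ℝ) {m d : ℕ} (A B : Fin (m + 1) → EuclideanSpace ℝ (Fin d))
    (δ : WithTop ℝ) : Prop :=
  IsLeast {x : WithTop ℝ | ∃ s t : ℝ, 0 ≤ s ∧ s ≤ t ∧ SFeasible A B s t ∧ x = g s t} δ

/-- `δ` is the discrete Fréchet gap with one-sided shortcuts. -/
def IsSGap {m d : ℕ} (A B : Fin (m + 1) → EuclideanSpace ℝ (Fin d)) (δ : WithTop ℝ) : Prop :=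
  IsSRange (fun s t => ((t - s : ℝ) : WithTop ℝ)) A B δ

open Classical in
/-- `δ` is the discrete Fréchet ratio with one-sided shortcuts; a range `[0, t]` has ratio `+∞`. -/
noncomputable def IsSRatio {m d : ℕ} (A B : Fin (m + 1) → EuclideanSpace ℝ (Fin d))
    (δ : WithTop ℝ) : Prop :=
  IsSRange (fun s t => if s = 0 then ⊤ else ((t / s : ℝ) : WithTop ℝ)) A B δ

/-- The monotonicity required of the functions `g` of (smallest distance, largest distance). -/
def IsRangeMonotone (g : ℝ → ℝ → ℝ) : Prop :=
  ∀ c a b e : ℝ, 0 ≤ c → c ≤ a → a ≤ b → b ≤ e → g a b ≤ g c e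

/-! ## The real RAM

A program is a finite text. It works on integer variables, real variables, arrays of integers and
arrays of reals (variables and arrays are named by numbers in the text; only array entries are
addressed dynamically, by integers). Integers are words, that is, natural numbers below a bound `W`.
Reals are exact. There is no conversion between integers and reals. Every operation takes one step.
`K` indexes extra binary operations on reals that the machine can perform in one step; the plain
machine is the case `K = Empty`. -/

/-- Integer expressions: literals, variables, array entries, arithmetic. -/
inductive NExp where
  | lit (c : ℕ)
  | var (x : ℕ)
  | arr (a : ℕ) (i : NExp)
  | add (p q : NExp)
  | sub (p q : NExp)
  | mul (p q : NExp)
  | div (p q : NExp)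

/-- Real expressions: integer literals, variables, array entries, arithmetic, square root, and
calls of the extra operations. -/
inductive RExp (K : Type) where
  | lit (c : ℕ)
  | var (x : ℕ)
  | arr (a : ℕ) (i : NExp)
  | add (p q : RExp K)
  | sub (p q : RExp K)
  | mul (p q : RExp K)
  | div (p q : RExp K)
  | sqrt (p : RExp K)
  | call (k : K) (p q : RExp K)

/-- Tests. -/
inductive BExp (K : Type) where
  | natLe (p q : NExp)
  | realLe (p q : RExp K)
  | not (b : BExp K)
  | and (b c : BExp K)

/-- Programs. -/
inductive Cmd (K : Type) where
  | skip
  | setNat (x : ℕ) (e : NExp)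
  | setNatArr (a : ℕ) (i e : NExp)
  | setReal (x : ℕ) (e : RExp K)
  | setRealArr (a : ℕ) (i : NExp) (e : RExp K)
  | seq (P Q : Cmd K)
  | ite (b : BExp K) (P Q : Cmd K)
  | loop (b : BExp K) (P : Cmd K)

/-- The contents of the memory. -/
structure State where
  natVar : ℕ → ℕ
  realVar : ℕ → ℝ
  natArr : ℕ → ℕ → ℕ
  realArr : ℕ → ℕ → ℝ

/-- The value of an integer expression: word arithmetic modulo `W`, with truncated subtraction and
rounding-down division. -/
def NExp.eval (W : ℕ) (σ : State) : NExp → ℕ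
  | .lit c => c % W
  | .var x => σ.natVar x
  | .arr a i => σ.natArr a (i.eval W σ)
  | .add p q => (p.eval W σ + q.eval W σ) % W
  | .sub p q => p.eval W σ - q.eval W σ
  | .mul p q => (p.eval W σ * q.eval W σ) % W
  | .div p q => p.eval W σ / q.eval W σ

/-- The value of a real expression, where `ops` interprets the extra operations. -/
noncomputable def RExp.eval {K : Type} (W : ℕ) (ops : K → ℝ → ℝ → ℝ) (σ : State) : RExp K → ℝ
  | .lit c => c
  | .var x => σ.realVar x
  | .arr a i => σ.realArr a (i.eval W σ)
  | .add p q => p.eval W ops σ + q.eval W ops σ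
  | .sub p q => p.eval W ops σ - q.eval W ops σ
  | .mul p q => p.eval W ops σ * q.eval W ops σ
  | .div p q => p.eval W ops σ / q.eval W ops σ
  | .sqrt p => Real.sqrt (p.eval W ops σ)
  | .call k p q => ops k (p.eval W ops σ) (q.eval W ops σ)

/-- The truth of a test. -/
def BExp.holds {K : Type} (W : ℕ) (ops : K → ℝ → ℝ → ℝ) (σ : State) : BExp K → Prop
  | .natLe p q => p.eval W σ ≤ q.eval W σ
  | .realLe p q => p.eval W ops σ ≤ q.eval W ops σ
  | .not b => ¬ b.holds W ops σ
  | .and b c => b.holds W ops σ ∧ c.holds W ops σ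

/-- Number of steps to evaluate an integer expression: one per node. -/
def NExp.cost : NExp → ℕ
  | .lit _ => 1
  | .var _ => 1
  | .arr _ i => i.cost + 1
  | .add p q => p.cost + q.cost + 1
  | .sub p q => p.cost + q.cost + 1
  | .mul p q => p.cost + q.cost + 1
  | .div p q => p.cost + q.cost + 1

/-- Number of steps to evaluate a real expression: one per node. -/
def RExp.cost {K : Type} : RExp K → ℕ
  | .lit _ => 1
  | .var _ => 1
  | .arr _ i => i.cost + 1
  | .add p q => p.cost + q.cost + 1
  | .sub p q => p.cost + q.cost + 1
  | .mul p q => p.cost + q.cost + 1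
  | .div p q => p.cost + q.cost + 1
  | .sqrt p => p.cost + 1
  | .call _ p q => p.cost + q.cost + 1

/-- Number of steps to evaluate a test: one per node. -/
def BExp.cost {K : Type} : BExp K → ℕ
  | .natLe p q => p.cost + q.cost + 1
  | .realLe p q => p.cost + q.cost + 1
  | .not b => b.cost + 1
  | .and b c => b.cost + c.cost + 1

/-- Write an integer variable. -/
def State.putNat (σ : State) (x v : ℕ) : State :=
  { σ with natVar := Function.update σ.natVar x v }

/-- Write a real variable. -/
noncomputable def State.putReal (σ : State) (x : ℕ) (v : ℝ) : State :=
  { σ with realVar := Function.update σ.realVar x v }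

/-- Write entry `i` of the integer array `a`. -/
def State.putNatArr (σ : State) (a i v : ℕ) : State :=
  { σ with natArr := Function.update σ.natArr a (Function.update (σ.natArr a) i v) }

/-- Write entry `i` of the real array `a`. -/
noncomputable def State.putRealArr (σ : State) (a i : ℕ) (v : ℝ) : State :=
  { σ with realArr := Function.update σ.realArr a (Function.update (σ.realArr a) i v) }

/-- `Exec W ops P σ t τ`: started in memory `σ`, the program `P` halts after exactly `t` steps with
memory `τ`. -/
inductive Exec {K : Type} (W : ℕ) (ops : K → ℝ → ℝ → ℝ) : Cmd K → State → ℕ → State → Prop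
  | skip (σ : State) : Exec W ops .skip σ 1 σ
  | setNat (x : ℕ) (e : NExp) (σ : State) :
      Exec W ops (.setNat x e) σ (e.cost + 1) (σ.putNat x (e.eval W σ))
  | setNatArr (a : ℕ) (i e : NExp) (σ : State) :
      Exec W ops (.setNatArr a i e) σ (i.cost + e.cost + 1)
        (σ.putNatArr a (i.eval W σ) (e.eval W σ))
  | setReal (x : ℕ) (e : RExp K) (σ : State) :
      Exec W ops (.setReal x e) σ (e.cost + 1) (σ.putReal x (e.eval W ops σ))
  | setRealArr (a : ℕ) (i : NExp) (e : RExp K) (σ : State) :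
      Exec W ops (.setRealArr a i e) σ (i.cost + e.cost + 1)
        (σ.putRealArr a (i.eval W σ) (e.eval W ops σ))
  | seq {P Q : Cmd K} {σ τ υ : State} {t u : ℕ} :
      Exec W ops P σ t τ → Exec W ops Q τ u υ → Exec W ops (.seq P Q) σ (t + u) υ
  | iteTrue {b : BExp K} {P Q : Cmd K} {σ τ : State} {t : ℕ} :
      b.holds W ops σ → Exec W ops P σ t τ → Exec W ops (.ite b P Q) σ (b.cost + 1 + t) τ
  | iteFalse {b : BExp K} {P Q : Cmd K} {σ τ : State} {t : ℕ} :
      ¬ b.holds W ops σ → Exec W ops Q σ t τ → Exec W ops (.ite b P Q) σ (b.cost + 1 + t) τ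
  | loopDone {b : BExp K} {P : Cmd K} {σ : State} :
      ¬ b.holds W ops σ → Exec W ops (.loop b P) σ (b.cost + 1) σ
  | loopStep {b : BExp K} {P : Cmd K} {σ τ υ : State} {t u : ℕ} :
      b.holds W ops σ → Exec W ops P σ t τ → Exec W ops (.loop b P) τ u υ →
      Exec W ops (.loop b P) σ (b.cost + 1 + t + u) υ

/-- The coordinates of a point sequence, point after point, followed by zeros: coordinate `j` of
point `i` is at index `i * d + j`. -/
noncomputable def coords {n d : ℕ} (A : Fin n → EuclideanSpace ℝ (Fin d)) (i : ℕ) : ℝ :=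
  if h : i < n * d then A (Fin.divNat ⟨i, h⟩) (Fin.modNat ⟨i, h⟩) else 0

/-- The initial memory: `n` in integer variable `0`, the coordinates of the two sequences in the
real arrays `0` and `1`, and zeros everywhere else. -/
noncomputable def inputState {n d : ℕ} (A B : Fin n → EuclideanSpace ℝ (Fin d)) : State where
  natVar := fun x => if x = 0 then n else 0
  realVar := fun _ => 0
  natArr := fun _ _ => 0
  realArr := fun a i => if a = 0 then coords A i else if a = 1 then coords B i else 0

/-- The output: real variable `0`, or `+∞` if integer variable `0` is nonzero. -/
noncomputable def State.output (σ : State) : WithTop ℝ :=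
  if σ.natVar 0 = 0 then (σ.realVar 0 : WithTop ℝ) else ⊤

/-- On a machine with words of `O(log n)` bits (word bound `(n + 2) ^ k`), the program `P` halts on
the input `A, B` (of `n` points each) after at most `N` steps, with an output satisfying `Q`. -/
def ComputesWithin {K : Type} (ops : K → ℝ → ℝ → ℝ) (P : Cmd K) (k N : ℕ) {n d : ℕ}
    (A B : Fin n → EuclideanSpace ℝ (Fin d)) (Q : WithTop ℝ → Prop) : Prop :=
  ∃ (t : ℕ) (τ : State), Exec ((n + 2) ^ k) ops P (inputState A B) t τ ∧ t ≤ N ∧ Q τ.output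

end DiscreteFrechet

/-! Only the order of the n² distances matters. After sorting, each position has a rank, and a range
becomes a window [i, j) of ranks. A feasible range [s, t] can be shrunk to the window from the
smallest to the largest rank of its valid positions, and this does not increase a monotone value;
conversely the distances at the two ends of a feasible window form a feasible range
(`isSRange_of_windows`). So the minimum is taken over finitely many windows, and the algorithm that
finds it also proves that it exists. Feasibility is monotone in the window. Hence the best window is
found by two pointers: the left end moves when the window is feasible, otherwise the right end does,
for at most twice as many moves as there are ranks (`advance_spec`, `sweep_spec`).

A fixed window is decided greedily: at a valid position the B-frog moves, at an invalid one the
A-frog does. The greedy path never overtakes a monotone choice of valid positions, so it succeeds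
exactly when an s-path exists (`sReachable_iff_greedy`). Thus each position has two possible
successors, and the membership of its rank in the window selects one: a decision forest with n²
inner nodes (`gridVal_iff`, `level_of_grid`).

Walking through this forest after every move would be too slow. During the next w moves each end of
the window passes at most w ranks, so only nodes with ranks in [i, i + w) or [j, j + w) can change
their successor. All others can be contracted, which leaves at most 2w inner nodes
(`RebuildInv.contract`, `RebuildInv.keep`, `rebuild_spec`). The forest of scale w = 2^k is rebuilt
every w moves, from the forest of scale 2w and in O(w) steps; the forest of scale 1 answers each
query in two steps (`query_spec`). Each scale costs a constant per move on average
(`sum_range_dvd_pow`), and there are O(log n) scales. With merge sort of the same order, the total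
is O(n² log n), which lies within the claimed bound (`solveSteps_le`).

The same program serves all three claims; only the expression that evaluates a range changes. The
word bound is chosen so large that no index wraps around (`solve_computesWithin`). -/

namespace DiscreteFrechet

/-! ## Reasoning about programs -/

section Programs

variable {K : Type} {W : ℕ} {ops : K → ℝ → ℝ → ℝ}

/-- Started in `σ`, the program halts within `N` steps in a state satisfying `Q`. -/
def Run (W : ℕ) (ops : K → ℝ → ℝ → ℝ) (P : Cmd K) (N : ℕ) (σ : State) (Q : State → Prop) : Prop :=
  ∃ (t : ℕ) (τ : State), Exec W ops P σ t τ ∧ t ≤ N ∧ Q τ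

/-- The integer variables that a program may write. -/
def Cmd.natVars : Cmd K → List ℕ
  | .setNat x _ => [x]
  | .seq P Q => P.natVars ++ Q.natVars
  | .ite _ P Q => P.natVars ++ Q.natVars
  | .loop _ P => P.natVars
  | _ => []

/-- The real variables that a program may write. -/
def Cmd.realVars : Cmd K → List ℕ
  | .setReal x _ => [x]
  | .seq P Q => P.realVars ++ Q.realVars
  | .ite _ P Q => P.realVars ++ Q.realVars
  | .loop _ P => P.realVars
  | _ => []

/-- The integer arrays that a program may write. -/
def Cmd.natArrs : Cmd K → List ℕ
  | .setNatArr x _ _ => [x]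
  | .seq P Q => P.natArrs ++ Q.natArrs
  | .ite _ P Q => P.natArrs ++ Q.natArrs
  | .loop _ P => P.natArrs
  | _ => []

/-- The real arrays that a program may write. -/
def Cmd.realArrs : Cmd K → List ℕ
  | .setRealArr x _ _ => [x]
  | .seq P Q => P.realArrs ++ Q.realArrs
  | .ite _ P Q => P.realArrs ++ Q.realArrs
  | .loop _ P => P.realArrs
  | _ => []

/-- `τ` differs from `σ` at most in what `P` may write. -/
structure Cmd.Frame (P : Cmd K) (σ τ : State) : Prop where
  natVar : ∀ x, P.natVars.contains x = false → τ.natVar x = σ.natVar x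
  realVar : ∀ x, P.realVars.contains x = false → τ.realVar x = σ.realVar x
  natArr : ∀ x, P.natArrs.contains x = false → τ.natArr x = σ.natArr x
  realArr : ∀ x, P.realArrs.contains x = false → τ.realArr x = σ.realArr x

theorem Cmd.Frame.refl (P : Cmd K) (σ : State) : P.Frame σ σ :=
  ⟨fun _ _ => rfl, fun _ _ => rfl, fun _ _ => rfl, fun _ _ => rfl⟩

theorem Cmd.Frame.trans {P : Cmd K} {σ τ υ : State} (h : P.Frame σ τ) (h' : P.Frame τ υ) :
    P.Frame σ υ :=
  ⟨fun x hx => (h'.natVar x hx).trans (h.natVar x hx),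
   fun x hx => (h'.realVar x hx).trans (h.realVar x hx),
   fun x hx => (h'.natArr x hx).trans (h.natArr x hx),
   fun x hx => (h'.realArr x hx).trans (h.realArr x hx)⟩

theorem Cmd.Frame.mono {P P' : Cmd K} {σ τ : State} (h : P.Frame σ τ)
    (h₁ : P.natVars ⊆ P'.natVars) (h₂ : P.realVars ⊆ P'.realVars)
    (h₃ : P.natArrs ⊆ P'.natArrs) (h₄ : P.realArrs ⊆ P'.realArrs) : P'.Frame σ τ := by
  have key : ∀ {l l' : List ℕ} {x : ℕ}, l ⊆ l' → l'.contains x = false → l.contains x = false := by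
    intro l l' x hl hx
    simp only [List.contains_eq_mem, decide_eq_false_iff_not] at hx ⊢
    exact fun h => hx (hl h)
  exact ⟨fun x hx => h.natVar x (key h₁ hx), fun x hx => h.realVar x (key h₂ hx),
    fun x hx => h.natArr x (key h₃ hx), fun x hx => h.realArr x (key h₄ hx)⟩

/-- This removes the need to carry untouched memory through loop invariants. Membership in the lists
of written names is a Boolean, so for a concrete program the side conditions hold by `rfl`. -/
theorem Exec.frame {P : Cmd K} {σ τ : State} {t : ℕ} (h : Exec W ops P σ t τ) : P.Frame σ τ := by
  induction h with
  | skip σ => exact Cmd.Frame.refl _ _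
  | setNat x e σ =>
    refine ⟨fun y hy => ?_, fun _ _ => rfl, fun _ _ => rfl, fun _ _ => rfl⟩
    have : y ≠ x := by simpa [Cmd.natVars] using hy
    simp [State.putNat, this]
  | setNatArr a i e σ =>
    refine ⟨fun _ _ => rfl, fun _ _ => rfl, fun y hy => ?_, fun _ _ => rfl⟩
    have : y ≠ a := by simpa [Cmd.natArrs] using hy
    simp [State.putNatArr, this]
  | setReal x e σ =>
    refine ⟨fun _ _ => rfl, fun y hy => ?_, fun _ _ => rfl, fun _ _ => rfl⟩
    have : y ≠ x := by simpa [Cmd.realVars] using hy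
    simp [State.putReal, this]
  | setRealArr a i e σ =>
    refine ⟨fun _ _ => rfl, fun _ _ => rfl, fun _ _ => rfl, fun y hy => ?_⟩
    have : y ≠ a := by simpa [Cmd.realArrs] using hy
    simp [State.putRealArr, this]
  | seq _ _ ih₁ ih₂ =>
    exact (ih₁.mono (by simp [Cmd.natVars]) (by simp [Cmd.realVars]) (by simp [Cmd.natArrs])
      (by simp [Cmd.realArrs])).trans (ih₂.mono (by simp [Cmd.natVars]) (by simp [Cmd.realVars])
      (by simp [Cmd.natArrs]) (by simp [Cmd.realArrs]))
  | iteTrue _ _ ih =>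
    exact ih.mono (by simp [Cmd.natVars]) (by simp [Cmd.realVars]) (by simp [Cmd.natArrs])
      (by simp [Cmd.realArrs])
  | iteFalse _ _ ih =>
    exact ih.mono (by simp [Cmd.natVars]) (by simp [Cmd.realVars]) (by simp [Cmd.natArrs])
      (by simp [Cmd.realArrs])
  | loopDone _ => exact Cmd.Frame.refl _ _
  | loopStep _ _ _ ih₁ ih₂ => exact (ih₁.mono (P' := .loop _ _) (by simp [Cmd.natVars])
      (by simp [Cmd.realVars]) (by simp [Cmd.natArrs]) (by simp [Cmd.realArrs])).trans ih₂

theorem Run.mono {P : Cmd K} {N N' : ℕ} {σ : State} {Q Q' : State → Prop}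
    (h : Run W ops P N σ Q) (hN : N ≤ N') (hQ : ∀ τ, P.Frame σ τ → Q τ → Q' τ) :
    Run W ops P N' σ Q' := by
  obtain ⟨t, τ, h₁, h₂, h₃⟩ := h
  exact ⟨t, τ, h₁, h₂.trans hN, hQ τ h₁.frame h₃⟩

theorem Run.seq {P Q : Cmd K} {N N' : ℕ} {σ : State} {R S : State → Prop}
    (h : Run W ops P N σ R) (h' : ∀ τ, P.Frame σ τ → R τ → Run W ops Q N' τ S) :
    Run W ops (.seq P Q) (N + N') σ S := by
  obtain ⟨t, τ, h₁, h₂, h₃⟩ := h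
  obtain ⟨t', τ', h₁', h₂', h₃'⟩ := h' τ h₁.frame h₃
  exact ⟨t + t', τ', .seq h₁ h₁', Nat.add_le_add h₂ h₂', h₃'⟩

theorem Run.ite {b : BExp K} {P Q : Cmd K} {N : ℕ} {σ : State} {R : State → Prop}
    (h : b.holds W ops σ → Run W ops P N σ R) (h' : ¬ b.holds W ops σ → Run W ops Q N σ R) :
    Run W ops (.ite b P Q) (b.cost + 1 + N) σ R := by
  by_cases hb : b.holds W ops σ
  · obtain ⟨t, τ, h₁, h₂, h₃⟩ := h hb
    exact ⟨_, τ, .iteTrue hb h₁, by omega, h₃⟩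
  · obtain ⟨t, τ, h₁, h₂, h₃⟩ := h' hb
    exact ⟨_, τ, .iteFalse hb h₁, by omega, h₃⟩

/-- A loop of exactly `n` rounds, the `i`-th of which takes at most `c i` steps. -/
theorem Run.loop {b : BExp K} {P : Cmd K} {σ : State} (n : ℕ) (c : ℕ → ℕ) (I : ℕ → State → Prop)
    (h₀ : I 0 σ)
    (hstep : ∀ i < n, ∀ τ, P.Frame σ τ → I i τ →
      b.holds W ops τ ∧ Run W ops P (c i) τ (I (i + 1)))
    (hdone : ∀ τ, P.Frame σ τ → I n τ → ¬ b.holds W ops τ) :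
    Run W ops (.loop b P) (∑ i ∈ Finset.range n, (b.cost + 1 + c i) + (b.cost + 1)) σ (I n) := by
  have key : ∀ k i τ, k + i = n → P.Frame σ τ → I i τ →
      Run W ops (.loop b P) (∑ i ∈ Finset.Ico i n, (b.cost + 1 + c i) + (b.cost + 1)) τ (I n) := by
    intro k
    induction k with
    | zero =>
      intro i τ hi hf hI
      obtain rfl : i = n := by omega
      exact ⟨_, τ, .loopDone (hdone τ hf hI), by simp, hI⟩
    | succ k ih =>
      intro i τ hi hf hI
      obtain ⟨hb, t, υ, h₁, h₂, h₃⟩ := hstep i (by omega) τ hf hI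
      obtain ⟨t', υ', h₁', h₂', h₃'⟩ := ih (i + 1) υ (by omega) (hf.trans h₁.frame) h₃
      refine ⟨_, υ', .loopStep hb h₁ h₁', ?_, h₃'⟩
      rw [Finset.sum_eq_sum_Ico_succ_bot (by omega)]
      omega
  rw [Finset.range_eq_Ico]
  exact key n 0 σ (by omega) (Cmd.Frame.refl _ _) h₀

/-- A loop of exactly `n` rounds, each of which takes at most `c` steps. -/
theorem Run.loop_const {b : BExp K} {P : Cmd K} {σ : State} (n c : ℕ) (I : ℕ → State → Prop)
    (h₀ : I 0 σ)
    (hstep : ∀ i < n, ∀ τ, P.Frame σ τ → I i τ →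
      b.holds W ops τ ∧ Run W ops P c τ (I (i + 1)))
    (hdone : ∀ τ, P.Frame σ τ → I n τ → ¬ b.holds W ops τ) :
    Run W ops (.loop b P) ((n + 1) * (b.cost + 1 + c)) σ (I n) := by
  refine (Run.loop n (fun _ => c) I h₀ hstep hdone).mono ?_ fun _ _ h => h
  simp only [Finset.sum_const, Finset.card_range, smul_eq_mul]
  nlinarith

/-- Programs without loops. -/
def Cmd.loopFree : Cmd K → Bool
  | .seq P Q => P.loopFree && Q.loopFree
  | .ite _ P Q => P.loopFree && Q.loopFree
  | .loop _ _ => false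
  | _ => true

/-- A bound for the number of steps of a program without loops. -/
def Cmd.bound : Cmd K → ℕ
  | .skip => 1
  | .setNat _ e => e.cost + 1
  | .setNatArr _ i e => i.cost + e.cost + 1
  | .setReal _ e => e.cost + 1
  | .setRealArr _ i e => i.cost + e.cost + 1
  | .seq P Q => P.bound + Q.bound
  | .ite b P Q => b.cost + 1 + (P.bound + Q.bound)
  | .loop _ _ => 0

open Classical in
/-- The effect of a program without loops. -/
noncomputable def Cmd.run (W : ℕ) (ops : K → ℝ → ℝ → ℝ) : Cmd K → State → State
  | .skip, σ => σ
  | .setNat x e, σ => σ.putNat x (e.eval W σ)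
  | .setNatArr a i e, σ => σ.putNatArr a (i.eval W σ) (e.eval W σ)
  | .setReal x e, σ => σ.putReal x (e.eval W ops σ)
  | .setRealArr a i e, σ => σ.putRealArr a (i.eval W σ) (e.eval W ops σ)
  | .seq P Q, σ => Q.run W ops (P.run W ops σ)
  | .ite b P Q, σ => if b.holds W ops σ then P.run W ops σ else Q.run W ops σ
  | .loop _ _, σ => σ

theorem Cmd.run_seq (P Q : Cmd K) (σ : State) :
    Cmd.run W ops (.seq P Q) σ = Q.run W ops (P.run W ops σ) := rfl

theorem Cmd.run_ite_pos {b : BExp K} {P Q : Cmd K} {σ : State} (h : b.holds W ops σ) :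
    Cmd.run W ops (.ite b P Q) σ = P.run W ops σ := if_pos h

theorem Cmd.run_ite_neg {b : BExp K} {P Q : Cmd K} {σ : State} (h : ¬ b.holds W ops σ) :
    Cmd.run W ops (.ite b P Q) σ = Q.run W ops σ := if_neg h

/-- A loop-free program acts as a function on memory, with a step bound read off from its text.
Straight-line pieces are therefore verified by simplification instead of by building execution
derivations. -/
theorem Run.of_loopFree {P : Cmd K} {σ : State} {Q : State → Prop} (hP : P.loopFree = true)
    (h : Q (P.run W ops σ)) : Run W ops P P.bound σ Q := by
  suffices hex : ∃ t, Exec W ops P σ t (P.run W ops σ) ∧ t ≤ P.bound by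
    obtain ⟨t, h₁, h₂⟩ := hex
    exact ⟨t, _, h₁, h₂, h⟩
  clear h
  induction P generalizing σ with
  | skip => exact ⟨_, .skip σ, le_rfl⟩
  | setNat x e => exact ⟨_, .setNat x e σ, le_rfl⟩
  | setNatArr a i e => exact ⟨_, .setNatArr a i e σ, le_rfl⟩
  | setReal x e => exact ⟨_, .setReal x e σ, le_rfl⟩
  | setRealArr a i e => exact ⟨_, .setRealArr a i e σ, le_rfl⟩
  | seq P Q ihP ihQ =>
    simp only [Cmd.loopFree, Bool.and_eq_true] at hP
    obtain ⟨t, h₁, h₂⟩ := ihP (σ := σ) hP.1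
    obtain ⟨u, h₃, h₄⟩ := ihQ (σ := P.run W ops σ) hP.2
    exact ⟨_, .seq h₁ h₃, Nat.add_le_add h₂ h₄⟩
  | ite b P Q ihP ihQ =>
    simp only [Cmd.loopFree, Bool.and_eq_true] at hP
    by_cases hb : b.holds W ops σ
    · obtain ⟨t, h₁, h₂⟩ := ihP (σ := σ) hP.1
      refine ⟨b.cost + 1 + t, ?_, by simp only [Cmd.bound]; omega⟩
      simp only [Cmd.run, hb, if_true]
      exact .iteTrue hb h₁
    · obtain ⟨t, h₁, h₂⟩ := ihQ (σ := σ) hP.2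
      refine ⟨b.cost + 1 + t, ?_, by simp only [Cmd.bound]; omega⟩
      simp only [Cmd.run, hb, if_false]
      exact .iteFalse hb h₁
  | loop b P => simp [Cmd.loopFree] at hP

theorem Cmd.frame_run {P : Cmd K} (hP : P.loopFree = true) (σ : State) :
    P.Frame σ (P.run W ops σ) := by
  obtain ⟨t, τ, h, -, rfl⟩ := Run.of_loopFree (W := W) (ops := ops) (σ := σ)
    (Q := fun τ => τ = P.run W ops σ) hP rfl
  exact h.frame

end Programs

/-! ### Reading memory after a write -/

namespace State

variable (σ : State)

@[simp] theorem natVar_putNat (x v y : ℕ) :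
    (σ.putNat x v).natVar y = if y = x then v else σ.natVar y := by
  simp [putNat, Function.update_apply]

@[simp] theorem natVar_putNatArr (a i v y : ℕ) : (σ.putNatArr a i v).natVar y = σ.natVar y := rfl

@[simp] theorem natVar_putReal (x : ℕ) (v : ℝ) (y : ℕ) : (σ.putReal x v).natVar y = σ.natVar y := rfl

@[simp] theorem realVar_putNat (x v y : ℕ) : (σ.putNat x v).realVar y = σ.realVar y := rfl

@[simp] theorem realVar_putReal (x : ℕ) (v : ℝ) (y : ℕ) :
    (σ.putReal x v).realVar y = if y = x then v else σ.realVar y := by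
  simp [putReal, Function.update_apply]

@[simp] theorem natArr_putNat (x v b j : ℕ) : (σ.putNat x v).natArr b j = σ.natArr b j := rfl

@[simp] theorem natArr_putNatArr (a i v b j : ℕ) :
    (σ.putNatArr a i v).natArr b j = if b = a ∧ j = i then v else σ.natArr b j := by
  by_cases h : b = a
  · subst h; simp [putNatArr, Function.update_apply]
  · simp [putNatArr, h]

@[simp] theorem natArr_putReal (x : ℕ) (v : ℝ) (b j : ℕ) :
    (σ.putReal x v).natArr b j = σ.natArr b j := rfl

@[simp] theorem realArr_putNat (x v b j : ℕ) : (σ.putNat x v).realArr b j = σ.realArr b j := rfl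

@[simp] theorem realArr_putReal (x : ℕ) (v : ℝ) (b j : ℕ) :
    (σ.putReal x v).realArr b j = σ.realArr b j := rfl

@[simp] theorem realArr_putRealArr (a i : ℕ) (v : ℝ) (b j : ℕ) :
    (σ.putRealArr a i v).realArr b j = if b = a ∧ j = i then v else σ.realArr b j := by
  by_cases h : b = a
  · subst h; simp [putRealArr, Function.update_apply]
  · simp [putRealArr, h]

end State

attribute [simp] Cmd.run NExp.eval RExp.eval BExp.holds NExp.cost RExp.cost BExp.cost Cmd.bound

/-- Sequential composition. -/
infixr:50 " ;; " => Cmd.seq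

/-- The test `p < q` of integers. -/
def BExp.natLt {K : Type} (p q : NExp) : BExp K := .not (.natLe q p)

@[simp] theorem BExp.holds_natLt {K : Type} {W : ℕ} {ops : K → ℝ → ℝ → ℝ} {σ : State}
    {p q : NExp} : (BExp.natLt p q : BExp K).holds W ops σ ↔ p.eval W σ < q.eval W σ := by
  simp [BExp.natLt]

/-! ## Sorting -/

section Sorting

variable {K : Type} {W : ℕ} {ops : K → ℝ → ℝ → ℝ}

theorem two_mul_two_pow_le {a b : ℕ} (h : a < b) : 2 * 2 ^ a ≤ 2 ^ b := by
  rw [← pow_succ']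
  exact Nat.pow_le_pow_right (by norm_num) h

/-- `P` permutes the numbers below `M`. -/
structure IsPerm (M : ℕ) (P : ℕ → ℕ) : Prop where
  lt : ∀ u < M, P u < M
  inj : ∀ u < M, ∀ v < M, P u = P v → u = v

/-- The keys `D (P u)` increase on `[a, b)`. -/
def SortedOn (D : ℕ → ℝ) (P : ℕ → ℕ) (a b : ℕ) : Prop :=
  ∀ u v, a ≤ u → u ≤ v → v < b → D (P u) ≤ D (P v)

/-- The state of merging `P` on `[b, b + w)` and on `[b + w, b + 2 * w)` into `Q`, where
`z`, `x` and `y` are the current indices. -/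
structure MergeInv (D : ℕ → ℝ) (P : ℕ → ℕ) (w b z x y : ℕ) (Q : ℕ → ℕ) : Prop where
  sum : x + y = b + w + z
  le_x : b ≤ x
  x_le : x ≤ b + w
  le_y : b + w ≤ y
  y_le : y ≤ b + 2 * w
  src : ∀ u < z, ∃ v, Q u = P v ∧ (v < x ∨ b + w ≤ v ∧ v < y)
  inj : ∀ u < z, ∀ v < z, Q u = Q v → u = v
  sorted : SortedOn D Q b z
  le_left : ∀ u, b ≤ u → u < z → x < b + w → D (Q u) ≤ D (P x)
  le_right : ∀ u, b ≤ u → u < z → y < b + 2 * w → D (Q u) ≤ D (P y)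

/-- The moved entry is a smallest among those still waiting in the two blocks, so it is at least
everything already written and at most everything left. The clauses on sources and injectivity cover
all of [0, z), including the earlier blocks, because the output must be a permutation in the end. -/
theorem MergeInv.take {D : ℕ → ℝ} {P Q Q' : ℕ → ℕ} {M w b z x y x' y' s : ℕ}
    (h : MergeInv D P w b z x y Q) (hP : IsPerm M P) (hM : b + 2 * w ≤ M)
    (hx : SortedOn D P b (b + w)) (hy : SortedOn D P (b + w) (b + 2 * w))
    (hs : s = x ∧ x < b + w ∧ x' = x + 1 ∧ y' = y ∧ (y < b + 2 * w → D (P x) ≤ D (P y)) ∨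
      s = y ∧ y < b + 2 * w ∧ x' = x ∧ y' = y + 1 ∧ (x < b + w → D (P y) ≤ D (P x)))
    (hQ : ∀ u, Q' u = if u = z then P s else Q u) :
    MergeInv D P w b (z + 1) x' y' Q' := by
  obtain ⟨h1, h2, h3, h4, h5, hsrc, hinj, hsort, hl, hr⟩ := h
  have hQz : Q' z = P s := by rw [hQ, if_pos rfl]
  have hQo : ∀ u, u < z → Q' u = Q u := fun u hu => by rw [hQ, if_neg hu.ne]
  have hsz : ∀ u, b ≤ u → u < z → D (Q u) ≤ D (P s) := by
    rintro u hu hu'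
    rcases hs with ⟨rfl, a, -⟩ | ⟨rfl, a, -⟩
    · exact hl u hu hu' a
    · exact hr u hu hu' a
  have hnew : ∀ u < z, Q u ≠ P s := by
    intro u hu e
    obtain ⟨v, hv, hv'⟩ := hsrc u hu
    have := hP.inj v (by omega) s (by omega) (by rw [← hv, e])
    omega
  refine ⟨by omega, by omega, by omega, by omega, by omega, ?_, ?_, ?_, ?_, ?_⟩
  · intro u hu
    rcases Nat.lt_succ_iff_lt_or_eq.1 hu with hu | rfl
    · obtain ⟨v, hv, hv'⟩ := hsrc u hu
      exact ⟨v, by rw [hQo u hu, hv], by omega⟩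
    · exact ⟨s, hQz, by omega⟩
  · intro u hu v hv e
    rcases Nat.lt_succ_iff_lt_or_eq.1 hu with hu | rfl <;>
      rcases Nat.lt_succ_iff_lt_or_eq.1 hv with hv | rfl
    · rw [hQo u hu, hQo v hv] at e; exact hinj u hu v hv e
    · rw [hQo u hu, hQz] at e; exact absurd e (hnew u hu)
    · rw [hQo v hv, hQz] at e; exact absurd e.symm (hnew v hv)
    · rfl
  · intro u v hu huv hv
    rcases Nat.lt_succ_iff_lt_or_eq.1 hv with hv | rfl
    · rw [hQo u (by omega), hQo v hv]; exact hsort u v hu huv hv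
    · rcases huv.eq_or_lt with rfl | huv
      · exact le_rfl
      · rw [hQz, hQo u huv]; exact hsz u hu huv
  · have key : x' < b + w → D (P s) ≤ D (P x') := by
      intro hx'
      rcases hs with ⟨rfl, -, rfl, -⟩ | ⟨rfl, -, rfl, -, a⟩
      · exact hx _ _ h2 (by omega) hx'
      · exact a hx'
    intro u hu hu' hx'
    rcases Nat.lt_succ_iff_lt_or_eq.1 hu' with hu' | rfl
    · rw [hQo u hu']; exact (hsz u hu hu').trans (key hx')
    · rw [hQz]; exact key hx'
  · have key : y' < b + 2 * w → D (P s) ≤ D (P y') := by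
      intro hy'
      rcases hs with ⟨rfl, -, -, rfl, a⟩ | ⟨rfl, -, -, rfl, -⟩
      · exact a hy'
      · exact hy _ _ h4 (by omega) hy'
    intro u hu hu' hy'
    rcases Nat.lt_succ_iff_lt_or_eq.1 hu' with hu' | rfl
    · rw [hQo u hu']; exact (hsz u hu hu').trans (key hy')
    · rw [hQz]; exact key hy'

/-- Write the next entry of the merged block. -/
def mergeStep : Cmd K :=
  .ite (.and (.natLt (.var 5) (.var 14)) (.not (.and (.natLt (.var 6) (.var 15))
      (.not (.realLe (.arr 2 (.arr 0 (.var 5))) (.arr 2 (.arr 0 (.var 6))))))))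
    (.setNatArr 1 (.var 2) (.arr 0 (.var 5)) ;; .setNat 5 (.add (.var 5) (.lit 1)))
    (.setNatArr 1 (.var 2) (.arr 0 (.var 6)) ;; .setNat 6 (.add (.var 6) (.lit 1))) ;;
  .setNat 2 (.add (.var 2) (.lit 1))

theorem mergeStep_spec {D : ℕ → ℝ} {P Q : ℕ → ℕ} {M w b z x y : ℕ} {σ : State}
    (hW : 10 * M < W) (h : MergeInv D P w b z x y Q) (hP : IsPerm M P) (hM : b + 2 * w ≤ M)
    (hx : SortedOn D P b (b + w)) (hy : SortedOn D P (b + w) (b + 2 * w)) (hz : z < b + 2 * w)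
    (h2 : σ.natVar 2 = z) (h5 : σ.natVar 5 = x) (h6 : σ.natVar 6 = y)
    (h14 : σ.natVar 14 = b + w) (h15 : σ.natVar 15 = b + 2 * w)
    (hD : σ.realArr 2 = D) (hPσ : σ.natArr 0 = P) (hQ : σ.natArr 1 = Q) :
    Run W ops (mergeStep : Cmd K) 50 σ (fun τ => ∃ x' y',
      MergeInv D P w b (z + 1) x' y' (τ.natArr 1) ∧
      (∀ u < z, τ.natArr 1 u = Q u) ∧ τ.natVar 2 = z + 1 ∧ τ.natVar 5 = x' ∧
      τ.natVar 6 = y') := by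
  have s1 := h.sum
  have s2 := h.le_x
  have s3 := h.x_le
  have s4 := h.le_y
  have s5 := h.y_le
  have e1 : 1 % W = 1 := Nat.mod_eq_of_lt (by omega)
  have ex : (x + 1) % W = x + 1 := Nat.mod_eq_of_lt (by omega)
  have ey : (y + 1) % W = y + 1 := Nat.mod_eq_of_lt (by omega)
  have ez : (z + 1) % W = z + 1 := Nat.mod_eq_of_lt (by omega)
  have hb : (.and (.natLt (.var 5) (.var 14)) (.not (.and (.natLt (.var 6) (.var 15))
      (.not (.realLe (.arr 2 (.arr 0 (.var 5))) (.arr 2 (.arr 0 (.var 6))))))) : BExp K).holds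
      W ops σ ↔ x < b + w ∧ (y < b + 2 * w → D (P x) ≤ D (P y)) := by
    simp only [BExp.holds, NExp.eval, RExp.eval, BExp.holds_natLt, h5, h6, h14, h15, hD, hPσ]
    tauto
  refine (Run.of_loopFree rfl ?_).mono (by simp [mergeStep, BExp.natLt]) fun _ _ h => h
  rw [mergeStep, Cmd.run_seq]
  by_cases hc : x < b + w ∧ (y < b + 2 * w → D (P x) ≤ D (P y))
  · rw [Cmd.run_ite_pos (hb.2 hc)]
    refine ⟨x + 1, y, h.take hP hM hx hy (Or.inl ⟨rfl, hc.1, rfl, rfl, hc.2⟩) ?_, ?_, ?_, ?_, ?_⟩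
    all_goals simp +contextual [ne_of_lt, h2, h5, h6, e1, ex, ez, hPσ, hQ]
  · rw [Cmd.run_ite_neg (mt hb.1 hc)]
    refine ⟨x, y + 1, h.take hP hM hx hy (Or.inr ⟨rfl, ?_, rfl, rfl, ?_⟩) ?_, ?_, ?_, ?_, ?_⟩
    · by_contra hy'
      exact hc ⟨by omega, fun h => absurd h hy'⟩
    · intro hx'
      by_contra hlt
      exact hc ⟨hx', fun _ => (not_le.1 hlt).le⟩
    all_goals simp +contextual [ne_of_lt, h2, h5, h6, e1, ey, ez, hPσ, hQ]

/-- Merge two blocks of `w` entries, starting at index `b` (integer variables `3`, `4`). -/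
def mergeBlock : Cmd K :=
  (.setNat 14 (.add (.var 4) (.var 3)) ;; .setNat 15 (.add (.var 14) (.var 3)) ;;
    .setNat 5 (.var 4) ;; .setNat 6 (.var 14)) ;;
  .loop (.natLt (.var 2) (.var 15)) mergeStep ;;
  .setNat 4 (.var 15)

/-- The first `β` pairs of blocks of `P` have been merged into `Q`. -/
structure PassInv (D : ℕ → ℝ) (P : ℕ → ℕ) (w β : ℕ) (Q : ℕ → ℕ) : Prop where
  src : ∀ u < β * (2 * w), ∃ v < β * (2 * w), Q u = P v
  inj : ∀ u < β * (2 * w), ∀ v < β * (2 * w), Q u = Q v → u = v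
  sorted : ∀ β' < β, SortedOn D Q (β' * (2 * w)) (β' * (2 * w) + 2 * w)

theorem mergeBlock_spec {D : ℕ → ℝ} {P : ℕ → ℕ} {M w β : ℕ} {σ : State}
    (hW : 10 * M < W) (hP : IsPerm M P) (hM : β * (2 * w) + 2 * w ≤ M)
    (hs : ∀ β, β * w + w ≤ M → SortedOn D P (β * w) (β * w + w))
    (h2 : σ.natVar 2 = β * (2 * w)) (h3 : σ.natVar 3 = w) (h4 : σ.natVar 4 = β * (2 * w))
    (hD : σ.realArr 2 = D) (hPσ : σ.natArr 0 = P) (h : PassInv D P w β (σ.natArr 1)) :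
    Run W ops (mergeBlock : Cmd K) (100 * (2 * w) + 100) σ (fun τ =>
      PassInv D P w (β + 1) (τ.natArr 1) ∧ τ.natVar 2 = (β + 1) * (2 * w) ∧
      τ.natVar 4 = (β + 1) * (2 * w)) := by
  obtain ⟨b, hb⟩ : ∃ b, β * (2 * w) = b := ⟨_, rfl⟩
  have hb' : (β + 1) * (2 * w) = b + 2 * w := by rw [← hb]; ring
  -- The β-th pair consists of the blocks 2β and 2β + 1 of length w.
  have hx := hs (2 * β) (by rw [← hb] at *; linarith)
  have hy := hs (2 * β + 1) (by rw [← hb] at *; linarith)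
  rw [show 2 * β * w = b by rw [← hb]; ring] at hx
  rw [show (2 * β + 1) * w = b + w by rw [← hb]; ring, show b + w + w = b + 2 * w by ring] at hy
  obtain ⟨hsrc, hinj, hsort⟩ := h
  rw [hb] at h2 h4 hM hsrc hinj
  have eb : (b + w) % W = b + w := Nat.mod_eq_of_lt (by omega)
  have eb2 : (b + w + w) % W = b + 2 * w := by rw [Nat.mod_eq_of_lt (by omega)]; ring
  refine (Run.seq (N := 20) (N' := (2 * w + 1) * (((.natLt (.var 2) (.var 15)) : BExp K).cost + 1
      + 50) + 2)
    (R := fun τ => (∀ u, τ.natArr 1 u = σ.natArr 1 u) ∧ τ.natVar 2 = b ∧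
      τ.natVar 5 = b ∧ τ.natVar 6 = b + w ∧ τ.natVar 14 = b + w ∧ τ.natVar 15 = b + 2 * w)
    ((Run.of_loopFree rfl ?_).mono (by simp) fun _ _ h => h) ?_).mono ?_ fun _ _ h => h
  · simp [h2, h4, h3, eb, eb2]
  · intro τ hτ ⟨t1, t2, t5, t6, t14, t15⟩
    refine Run.seq (Run.loop_const (2 * w) 50 (fun q υ => ∃ x y, MergeInv D P w b (b + q) x y
      (υ.natArr 1) ∧ (∀ u < b, υ.natArr 1 u = σ.natArr 1 u) ∧ υ.natVar 2 = b + q ∧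
      υ.natVar 5 = x ∧ υ.natVar 6 = y)
      ⟨b, b + w, ⟨by omega, by omega, by omega, by omega, by omega, ?_, ?_, ?_, ?_, ?_⟩, ?_⟩
      ?_ ?_) ?_
    · intro u hu
      obtain ⟨v, hv, hv'⟩ := hsrc u hu
      exact ⟨v, by rw [t1, hv'], by omega⟩
    · intro u hu v hv e
      rw [t1, t1] at e
      exact hinj u hu v hv e
    · intro u v; omega
    · intro u; omega
    · intro u; omega
    · exact ⟨fun u _ => t1 u, t2, t5, t6⟩
    · rintro q hq υ hυ ⟨x, y, hm, ho, u2, u5, u6⟩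
      have u15 := (hυ.natVar 15 rfl).trans t15
      refine ⟨by simp [u2, u15]; omega, ?_⟩
      refine (mergeStep_spec hW hm hP hM hx hy (by omega) u2 u5 u6
        ((hυ.natVar 14 rfl).trans t14) u15 ((hυ.realArr 2 rfl).trans ((hτ.realArr 2 rfl).trans hD))
        ((hυ.natArr 0 rfl).trans ((hτ.natArr 0 rfl).trans hPσ)) rfl).mono le_rfl ?_
      rintro ψ - ⟨x', y', hm', hz', p2, p5, p6⟩
      exact ⟨x', y', hm', fun u hu => (hz' u (by omega)).trans (ho u hu), p2, p5, p6⟩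
    · rintro υ hυ ⟨x, y, hm, ho, u2, u5, u6⟩
      have u15 := (hυ.natVar 15 rfl).trans t15
      simp [u2, u15]
    · rintro υ hυ ⟨x, y, hm, ho, u2, u5, u6⟩
      have u15 := (hυ.natVar 15 rfl).trans t15
      refine ⟨_, _, .setNat _ _ _, by simp, ?_, ?_, ?_⟩
      · refine ⟨?_, ?_, ?_⟩
        · intro u hu
          rw [hb'] at hu ⊢
          obtain ⟨v, hv, hv'⟩ := hm.src u hu
          have := hm.x_le
          have := hm.y_le
          exact ⟨v, by omega, hv⟩
        · rw [hb']; exact hm.inj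
        · intro β' hβ'
          rcases Nat.lt_succ_iff_lt_or_eq.1 hβ' with hβ' | rfl
          · intro u v hu huv hv
            have : v < b := by
              have := Nat.mul_le_mul_right (2 * w) (show β' + 1 ≤ β by omega)
              rw [add_mul, one_mul] at this
              omega
            change D (υ.natArr 1 u) ≤ D (υ.natArr 1 v)
            rw [ho u (by omega), ho v this]
            exact hsort β' hβ' u v hu huv hv
          · rw [hb]; exact hm.sorted
      · simp [u2, hb']
      · simp [u15, hb']
  · simp [BExp.natLt]; omega

/-- Merge all pairs of blocks of `w` entries. -/
def mergePass : Cmd K :=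
  (.setNat 2 (.lit 0) ;; .setNat 4 (.lit 0)) ;;
  .loop (.natLt (.var 4) (.var 1)) mergeBlock ;;
  .setNat 2 (.lit 0) ;;
  .loop (.natLt (.var 2) (.var 1))
    (.setNatArr 0 (.var 2) (.arr 1 (.var 2)) ;; .setNat 2 (.add (.var 2) (.lit 1)))

theorem mergePass_spec {D : ℕ → ℝ} {P : ℕ → ℕ} {M w n : ℕ} {σ : State}
    (hW : 10 * M < W) (hP : IsPerm M P) (hw : 1 ≤ w) (hM : n * (2 * w) = M) (hM1 : 1 ≤ M)
    (hs : ∀ β, β * w + w ≤ M → SortedOn D P (β * w) (β * w + w))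
    (h1 : σ.natVar 1 = M) (h3 : σ.natVar 3 = w)
    (hD : σ.realArr 2 = D) (hPσ : σ.natArr 0 = P) :
    Run W ops (mergePass : Cmd K) (500 * M) σ (fun τ => IsPerm M (τ.natArr 0) ∧
      ∀ β, β * (2 * w) + 2 * w ≤ M →
        SortedOn D (τ.natArr 0) (β * (2 * w)) (β * (2 * w) + 2 * w)) := by
  have e1 : 1 % W = 1 := Nat.mod_eq_of_lt (by omega)
  refine (Run.seq (N := 4) (N' := (n + 1) * (((.natLt (.var 4) (.var 1)) : BExp K).cost + 1 +
    (100 * (2 * w) + 100)) + (2 + (M + 1) * (((.natLt (.var 2) (.var 1)) : BExp K).cost + 1 + 8)))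
    (R := fun τ => τ.natVar 2 = 0 ∧ τ.natVar 4 = 0)
    ((Run.of_loopFree rfl ?_).mono (by simp) fun _ _ h => h) ?_).mono ?_ fun _ _ h => h
  · simp
  · intro τ hτ ⟨t2, t4⟩
    refine Run.seq (Run.loop_const n _ (fun β υ => PassInv D P w β (υ.natArr 1) ∧
      υ.natVar 2 = β * (2 * w) ∧ υ.natVar 4 = β * (2 * w))
      ⟨⟨by simp, by simp, by simp⟩, by simpa using t2, by simpa using t4⟩ ?_ ?_) ?_
    · rintro β hβ υ hυ ⟨hp, u2, u4⟩
      have hle : β * (2 * w) + 2 * w ≤ M := by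
        have := Nat.mul_le_mul_right (2 * w) (show β + 1 ≤ n by omega)
        rw [add_mul, one_mul] at this
        omega
      have u1 := (hυ.natVar 1 rfl).trans ((hτ.natVar 1 rfl).trans h1)
      refine ⟨by simp [u4, u1]; omega, ?_⟩
      exact mergeBlock_spec hW hP hle hs u2 ((hυ.natVar 3 rfl).trans ((hτ.natVar 3 rfl).trans h3))
        u4 ((hυ.realArr 2 rfl).trans ((hτ.realArr 2 rfl).trans hD))
        ((hυ.natArr 0 rfl).trans ((hτ.natArr 0 rfl).trans hPσ)) hp
    · rintro υ hυ ⟨hp, u2, u4⟩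
      have u1 := (hυ.natVar 1 rfl).trans ((hτ.natVar 1 rfl).trans h1)
      simp [u4, u1, hM]
    · rintro υ hυ ⟨hp, u2, u4⟩
      have u1 := (hυ.natVar 1 rfl).trans ((hτ.natVar 1 rfl).trans h1)
      refine Run.seq (R := fun ψ => ψ.natVar 2 = 0) ⟨_, _, .setNat _ _ _, by simp, by simp⟩ ?_
      intro ψ hψ p2
      have p1 := (hψ.natVar 1 rfl).trans u1
      refine (Run.loop_const M 8 (fun q χ => χ.natVar 2 = q ∧
        ∀ u < q, χ.natArr 0 u = υ.natArr 1 u) ⟨p2, by simp⟩ ?_ ?_).mono le_rfl ?_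
      · rintro q hq χ hχ ⟨c2, cu⟩
        have eq1 : (q + 1) % W = q + 1 := Nat.mod_eq_of_lt (by omega)
        refine ⟨by simpa [c2, (hχ.natVar 1 rfl).trans p1] using hq,
          (Run.of_loopFree rfl ?_).mono (by simp) fun _ _ h => h⟩
        refine ⟨by simp [c2, e1, eq1], fun u hu => ?_⟩
        have ca : χ.natArr 1 = υ.natArr 1 := (hχ.natArr 1 rfl).trans (hψ.natArr 1 rfl)
        simp only [Cmd.run, NExp.eval, State.natArr_putNat, State.natArr_putNatArr, c2, ca,
          true_and]
        split_ifs with hu'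
        · rw [hu']
        · exact cu u (by omega)
      · rintro χ hχ ⟨c2, cu⟩
        simp [c2, (hχ.natVar 1 rfl).trans p1]
      · rintro χ - ⟨c2, cu⟩
        obtain ⟨hsrc, hinj, hsort⟩ := hp
        rw [hM] at hsrc hinj
        refine ⟨⟨fun u hu => ?_, fun u hu v hv e => ?_⟩, fun β hβ u v hu huv hv => ?_⟩
        · obtain ⟨v, hv, e⟩ := hsrc u hu
          rw [cu u hu, e]
          exact hP.lt v hv
        · rw [cu u hu, cu v hv] at e
          exact hinj u hu v hv e
        · rw [cu u (by omega), cu v (by omega)]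
          refine hsort β ?_ u v hu huv hv
          by_contra hn
          have := Nat.mul_le_mul_right (2 * w) (not_lt.1 hn)
          omega
  · have hn : n ≤ M := by
      rw [← hM]; exact Nat.le_mul_of_pos_right _ (by omega)
    -- There is at least one pair of blocks since M ≥ 1, so the constant overhead of the last loop
    -- test is absorbed by doubling.
    have hn' : (n + 1) * (2 * w) ≤ 2 * M := by
      have : 2 * w ≤ M := by
        rw [← hM]
        refine Nat.le_mul_of_pos_left _ (Nat.pos_of_ne_zero ?_)
        rintro rfl
        omega
      rw [add_mul, hM, one_mul]; omega
    simp only [BExp.natLt, BExp.cost, NExp.cost]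
    nlinarith

/-- Sort the indices in array `0` by their keys in the real array `2`. -/
def mergeSort : Cmd K :=
  .setNat 3 (.lit 1) ;;
  .loop (.natLt (.var 3) (.var 1)) (mergePass ;; .setNat 3 (.mul (.lit 2) (.var 3)))

/-- Bottom-up merging: after k passes all blocks of length 2^k are sorted. As the number of entries
is a power of two, every pass splits evenly into pairs of full blocks. -/
theorem mergeSort_spec {D : ℕ → ℝ} {L : ℕ} {σ : State} (hW : 10 * 2 ^ L < W)
    (hP : IsPerm (2 ^ L) (σ.natArr 0)) (h1 : σ.natVar 1 = 2 ^ L) (hD : σ.realArr 2 = D) :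
    Run W ops (mergeSort : Cmd K) (600 * (2 ^ L * (L + 1))) σ (fun τ =>
      IsPerm (2 ^ L) (τ.natArr 0) ∧ SortedOn D (τ.natArr 0) 0 (2 ^ L)) := by
  have hL := @Nat.one_le_two_pow L
  have e1 : 1 % W = 1 := Nat.mod_eq_of_lt (by omega)
  have e2 : 2 % W = 2 := Nat.mod_eq_of_lt (by omega)
  refine (Run.seq (N := 2) (N' := (L + 1) * (((.natLt (.var 3) (.var 1)) : BExp K).cost + 1 +
    (500 * 2 ^ L + 4))) (R := fun τ => τ.natVar 3 = 1 ∧ τ.natArr 0 = σ.natArr 0)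
    ⟨_, _, .setNat _ _ _, by simp, by simp [e1], rfl⟩ ?_).mono ?_ fun _ _ h => h
  · intro τ hτ ⟨t3, t0⟩
    refine (Run.loop_const L _ (fun k υ => IsPerm (2 ^ L) (υ.natArr 0) ∧ υ.natVar 3 = 2 ^ k ∧
      ∀ β, β * 2 ^ k + 2 ^ k ≤ 2 ^ L →
        SortedOn D (υ.natArr 0) (β * 2 ^ k) (β * 2 ^ k + 2 ^ k)) ⟨?_, ?_, ?_⟩ ?_ ?_).mono le_rfl ?_
    · rw [t0]; exact hP
    · simpa using t3
    · intro β _ u v hu huv hv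
      obtain rfl : u = v := by omega
      exact le_rfl
    · rintro k hk υ hυ ⟨hp, u3, us⟩
      have hkL := two_mul_two_pow_le hk
      have u1 := (hυ.natVar 1 rfl).trans ((hτ.natVar 1 rfl).trans h1)
      have ek : (2 * 2 ^ k) % W = 2 * 2 ^ k := Nat.mod_eq_of_lt (by omega)
      refine ⟨by simpa [u3, u1] using Nat.pow_lt_pow_right (by norm_num) hk, ?_⟩
      refine Run.seq (mergePass_spec (n := 2 ^ (L - (k + 1))) hW hp Nat.one_le_two_pow ?_ hL us u1
        u3 ((hυ.realArr 2 rfl).trans ((hτ.realArr 2 rfl).trans hD)) rfl) ?_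
      · rw [← pow_succ', ← pow_add]; congr 1; omega
      · rintro ψ hψ ⟨hq, qs⟩
        refine ⟨_, _, .setNat _ _ _, by simp, hq, ?_, ?_⟩
        · simp [hψ.natVar 3 rfl, u3, e2, ek, pow_succ']
        · rw [pow_succ']; exact qs
    · rintro υ hυ ⟨hp, u3, us⟩
      have u1 := (hυ.natVar 1 rfl).trans ((hτ.natVar 1 rfl).trans h1)
      simp [u1, u3]
    · rintro υ - ⟨hp, u3, us⟩
      exact ⟨hp, by simpa using us 0 (by simp)⟩
  · simp only [BExp.natLt, BExp.cost, NExp.cost]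
    nlinarith

end Sorting

/-! ## Contracted decision forests -/

section Levels

variable {K : Type} {W : ℕ} {ops : K → ℝ → ℝ → ℝ}

/-- The forest stored for the scale `w`. Its nodes are `0` (failure), `1` (success) and inner
nodes, each of which has a rank (array `3`), a successor for the case that this rank is in the
window (array `4`), and one for the case that it is not (array `5`). Following the successors from
the start node (array `6`) decides `F i' j'` for all windows `[i', j')` with
`i ≤ i' ≤ i + r` and `j ≤ j' ≤ j + r`. -/
structure Level (σ : State) (w : ℕ) (F : ℕ → ℕ → Prop) (i j r : ℕ) : Prop where
  two_le : 2 ≤ σ.natArr 7 w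
  size_le : σ.natArr 7 w ≤ 2 * w + 2
  start_lt : σ.natArr 6 w < σ.natArr 7 w
  inj : ∀ p q, 2 ≤ p → p < σ.natArr 7 w → 2 ≤ q → q < σ.natArr 7 w →
    σ.natArr 3 (8 * w + p) = σ.natArr 3 (8 * w + q) → p = q
  succ_lt : ∀ p, 2 ≤ p → p < σ.natArr 7 w →
    σ.natArr 4 (8 * w + p) < p ∧ σ.natArr 5 (8 * w + p) < p
  val : ∃ v : ℕ → ℕ → ℕ → Prop, ∀ i' j', i ≤ i' → i' ≤ i + r → j ≤ j' → j' ≤ j + r →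
    ¬ v 0 i' j' ∧ v 1 i' j' ∧
    (∀ p, 2 ≤ p → p < σ.natArr 7 w → (v p i' j' ↔
      if i' ≤ σ.natArr 3 (8 * w + p) ∧ σ.natArr 3 (8 * w + p) < j'
      then v (σ.natArr 4 (8 * w + p)) i' j' else v (σ.natArr 5 (8 * w + p)) i' j')) ∧
    (v (σ.natArr 6 w) i' j' ↔ F i' j')

/-- A stored forest stays correct while the window moves on; only its remaining range of validity
becomes smaller. -/
theorem Level.shrink {σ : State} {w i j r i₂ j₂ r₂ : ℕ} {F : ℕ → ℕ → Prop}
    (h : Level σ w F i j r) (hi : i ≤ i₂) (hi' : i₂ + r₂ ≤ i + r) (hj : j ≤ j₂)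
    (hj' : j₂ + r₂ ≤ j + r) : Level σ w F i₂ j₂ r₂ := by
  refine ⟨h.two_le, h.size_le, h.start_lt, h.inj, h.succ_lt, ?_⟩
  obtain ⟨v, hv⟩ := h.val
  exact ⟨v, fun i' j' h₁ h₂ h₃ h₄ =>
    hv i' j' (by omega) (by omega) (by omega) (by omega)⟩

/-- The forest of scale w has at most 2w + 2 ≤ 8w nodes, so it lives in [8w, 16w) of arrays 3 to 5
and in entry w of arrays 6 and 7. Blocks of different powers of two are disjoint, so that a rebuild
of one scale leaves the others intact. -/
theorem Level.congr {σ τ : State} {w i j r : ℕ} {F : ℕ → ℕ → Prop} (h : Level σ w F i j r)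
    (hw : 1 ≤ w)
    (h3 : ∀ p, 8 * w ≤ p → p < 16 * w → τ.natArr 3 p = σ.natArr 3 p)
    (h4 : ∀ p, 8 * w ≤ p → p < 16 * w → τ.natArr 4 p = σ.natArr 4 p)
    (h5 : ∀ p, 8 * w ≤ p → p < 16 * w → τ.natArr 5 p = σ.natArr 5 p)
    (h6 : τ.natArr 6 w = σ.natArr 6 w) (h7 : τ.natArr 7 w = σ.natArr 7 w) :
    Level τ w F i j r := by
  have hs := h.size_le
  have h3' : ∀ p < σ.natArr 7 w, τ.natArr 3 (8 * w + p) = σ.natArr 3 (8 * w + p) :=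
    fun p hp => h3 _ (by omega) (by omega)
  have h4' : ∀ p < σ.natArr 7 w, τ.natArr 4 (8 * w + p) = σ.natArr 4 (8 * w + p) :=
    fun p hp => h4 _ (by omega) (by omega)
  have h5' : ∀ p < σ.natArr 7 w, τ.natArr 5 (8 * w + p) = σ.natArr 5 (8 * w + p) :=
    fun p hp => h5 _ (by omega) (by omega)
  refine ⟨by rw [h7]; exact h.two_le, by rw [h7]; exact hs, by rw [h6, h7]; exact h.start_lt,
    ?_, ?_, ?_⟩
  · intro p q hp hp' hq hq' e
    rw [h7] at hp' hq'
    rw [h3' p hp', h3' q hq'] at e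
    exact h.inj p q hp hp' hq hq' e
  · intro p hp hp'
    rw [h7] at hp'
    rw [h4' p hp', h5' p hp']
    exact h.succ_lt p hp hp'
  · obtain ⟨v, hv⟩ := h.val
    refine ⟨v, fun i' j' a b c d => ?_⟩
    obtain ⟨v0, v1, vp, vS⟩ := hv i' j' a b c d
    refine ⟨v0, v1, fun p hp hp' => ?_, by rwa [h6]⟩
    rw [h7] at hp'
    rw [h3' p hp', h4' p hp', h5' p hp']
    exact vp p hp hp'

/-- An injective map of `[2, c)` into the union of two intervals of length `w`. -/
theorem le_of_injOn_window {f : ℕ → ℕ} {c i j w : ℕ}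
    (hinj : ∀ p q, 2 ≤ p → p < c → 2 ≤ q → q < c → f p = f q → p = q)
    (hf : ∀ p, 2 ≤ p → p < c → (i ≤ f p ∧ f p < i + w) ∨ (j ≤ f p ∧ f p < j + w)) :
    c ≤ 2 * w + 2 := by
  have h := Finset.card_le_card_of_injOn (s := Finset.Ico 2 c)
    (t := Finset.Ico i (i + w) ∪ Finset.Ico j (j + w)) f
    (by
      intro p hp
      have hp' := Finset.mem_Ico.1 (Finset.mem_coe.1 hp)
      have := hf p hp'.1 hp'.2
      simp only [Finset.coe_union, Finset.coe_Ico, Set.mem_union, Set.mem_Ico]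
      exact this)
    (by
      intro p hp q hq e
      have hp' := Finset.mem_Ico.1 (Finset.mem_coe.1 hp)
      have hq' := Finset.mem_Ico.1 (Finset.mem_coe.1 hq)
      exact hinj p q hp'.1 hp'.2 hq'.1 hq'.2 e)
  have h' := Finset.card_union_le (Finset.Ico i (i + w)) (Finset.Ico j (j + w))
  simp only [Nat.card_Ico] at h h'
  omega

/-- Initialization for `rebuild`. -/
def rebuildInit : Cmd K :=
  .setNat 14 (.mul (.lit 16) (.var 3)) ;;
  .setNat 15 (.mul (.lit 8) (.var 3)) ;;
  .setNatArr 8 (.lit 0) (.lit 0) ;;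
  .setNatArr 8 (.lit 1) (.lit 1) ;;
  .setNat 12 (.lit 2) ;;
  .setNat 11 (.lit 2)

/-- The test that the rank in integer variable `16` may enter or leave the window in the next `w`
steps. -/
def rebuildKeep : BExp K :=
  .not (.and
    (.not (.and (.natLe (.var 7) (.var 16)) (.natLt (.var 16) (.add (.var 7) (.var 3)))))
    (.not (.and (.natLe (.var 8) (.var 16)) (.natLt (.var 16) (.add (.var 8) (.var 3))))))

/-- The round of `rebuild` that copies or contracts the node in integer variable `11`. -/
def rebuildBody : Cmd K :=
  .setNat 16 (.arr 3 (.add (.var 14) (.var 11))) ;;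
  .ite rebuildKeep
    (.setNatArr 3 (.add (.var 15) (.var 12)) (.var 16) ;;
      .setNatArr 4 (.add (.var 15) (.var 12)) (.arr 8 (.arr 4 (.add (.var 14) (.var 11)))) ;;
      .setNatArr 5 (.add (.var 15) (.var 12)) (.arr 8 (.arr 5 (.add (.var 14) (.var 11)))) ;;
      .setNatArr 8 (.var 11) (.var 12) ;;
      .setNat 12 (.add (.var 12) (.lit 1)))
    (.ite (.and (.natLe (.var 7) (.var 16)) (.natLt (.var 16) (.var 8)))
      (.setNatArr 8 (.var 11) (.arr 8 (.arr 4 (.add (.var 14) (.var 11)))))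
      (.setNatArr 8 (.var 11) (.arr 8 (.arr 5 (.add (.var 14) (.var 11)))))) ;;
  .setNat 11 (.add (.var 11) (.lit 1))

/-- Build the forest for the scale `w` (integer variable `3`) and the current window (integer
variables `7`, `8`) from that for the scale `2 * w`. -/
def rebuild : Cmd K :=
  rebuildInit ;;
  .loop (.natLt (.var 11) (.arr 7 (.mul (.lit 2) (.var 3)))) rebuildBody ;;
  .setNatArr 7 (.var 3) (.var 12) ;;
  .setNatArr 6 (.var 3) (.arr 8 (.arr 6 (.mul (.lit 2) (.var 3))))

/-- The loop invariant of `rebuild`, after `q` rounds. -/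
structure RebuildInv (σ : State) (w i j : ℕ) (v : ℕ → ℕ → ℕ → Prop) (q : ℕ) (τ : State) :
    Prop where
  p_eq : τ.natVar 11 = q + 2
  two_le : 2 ≤ τ.natVar 12
  le_p : τ.natVar 12 ≤ q + 2
  map_lt : ∀ x < q + 2, τ.natArr 8 x < τ.natVar 12
  inj : ∀ x y, 2 ≤ x → x < τ.natVar 12 → 2 ≤ y → y < τ.natVar 12 →
    τ.natArr 3 (8 * w + x) = τ.natArr 3 (8 * w + y) → x = y
  window : ∀ x, 2 ≤ x → x < τ.natVar 12 →
    (i ≤ τ.natArr 3 (8 * w + x) ∧ τ.natArr 3 (8 * w + x) < i + w) ∨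
    (j ≤ τ.natArr 3 (8 * w + x) ∧ τ.natArr 3 (8 * w + x) < j + w)
  old : ∀ x, 2 ≤ x → x < τ.natVar 12 →
    ∃ y, 2 ≤ y ∧ y < q + 2 ∧ τ.natArr 3 (8 * w + x) = σ.natArr 3 (16 * w + y)
  succ_lt : ∀ x, 2 ≤ x → x < τ.natVar 12 →
    τ.natArr 4 (8 * w + x) < x ∧ τ.natArr 5 (8 * w + x) < x
  val : ∃ v' : ℕ → ℕ → ℕ → Prop, ∀ i' j', i ≤ i' → i' ≤ i + w → j ≤ j' → j' ≤ j + w →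
    ¬ v' 0 i' j' ∧ v' 1 i' j' ∧
    (∀ p, 2 ≤ p → p < τ.natVar 12 → (v' p i' j' ↔
      if i' ≤ τ.natArr 3 (8 * w + p) ∧ τ.natArr 3 (8 * w + p) < j'
      then v' (τ.natArr 4 (8 * w + p)) i' j' else v' (τ.natArr 5 (8 * w + p)) i' j')) ∧
    (∀ x < q + 2, (v' (τ.natArr 8 x) i' j' ↔ v x i' j'))
  out3 : ∀ x, x < 8 * w ∨ 16 * w ≤ x → τ.natArr 3 x = σ.natArr 3 x
  out4 : ∀ x, x < 8 * w ∨ 16 * w ≤ x → τ.natArr 4 x = σ.natArr 4 x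
  out5 : ∀ x, x < 8 * w ∨ 16 * w ≤ x → τ.natArr 5 x = σ.natArr 5 x

/-- What `rebuild` uses of the source level: `v` satisfies the recursion at its nodes. -/
def OldVal (σ : State) (w i j : ℕ) (v : ℕ → ℕ → ℕ → Prop) (p : ℕ) : Prop :=
  ∀ i' j', i ≤ i' → i' ≤ i + w → j ≤ j' → j' ≤ j + w → (v p i' j' ↔
    if i' ≤ σ.natArr 3 (16 * w + p) ∧ σ.natArr 3 (16 * w + p) < j'
    then v (σ.natArr 4 (16 * w + p)) i' j' else v (σ.natArr 5 (16 * w + p)) i' j')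

/-- A rank outside [i, i + w) and [j, j + w) is on the same side of both window ends for all windows
under consideration. The branch taken now is then taken in all of them, and the old node can be
identified with the image of that successor. -/
theorem RebuildInv.contract {σ τ τ' : State} {w i j q : ℕ} {v : ℕ → ℕ → ℕ → Prop}
    (hI : RebuildInv σ w i j v q τ) (hv : OldVal σ w i j v (q + 2))
    (hlt : σ.natArr 4 (16 * w + (q + 2)) < q + 2 ∧ σ.natArr 5 (16 * w + (q + 2)) < q + 2)
    (hk : ¬ ((i ≤ σ.natArr 3 (16 * w + (q + 2)) ∧ σ.natArr 3 (16 * w + (q + 2)) < i + w) ∨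
      (j ≤ σ.natArr 3 (16 * w + (q + 2)) ∧ σ.natArr 3 (16 * w + (q + 2)) < j + w)))
    (hp : τ'.natVar 11 = q + 3) (hc : τ'.natVar 12 = τ.natVar 12)
    (h3 : τ'.natArr 3 = τ.natArr 3) (h4 : τ'.natArr 4 = τ.natArr 4)
    (h5 : τ'.natArr 5 = τ.natArr 5)
    (h8 : ∀ x, τ'.natArr 8 x = if x = q + 2 then τ.natArr 8
      (if i ≤ σ.natArr 3 (16 * w + (q + 2)) ∧ σ.natArr 3 (16 * w + (q + 2)) < j then
        σ.natArr 4 (16 * w + (q + 2)) else σ.natArr 5 (16 * w + (q + 2))) else τ.natArr 8 x) :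
    RebuildInv σ w i j v (q + 1) τ' := by
  obtain ⟨hlt₁, hlt₂⟩ := hlt
  refine ⟨hp, hc ▸ hI.two_le, by have := hI.le_p; omega, ?_, ?_, ?_, ?_, ?_, ?_, ?_, ?_, ?_⟩
  · intro x hx
    rw [h8, hc]
    split_ifs
    · exact hI.map_lt _ hlt₁
    · exact hI.map_lt _ hlt₂
    · exact hI.map_lt _ (by omega)
  · rw [hc, h3]; exact hI.inj
  · rw [hc, h3]; exact hI.window
  · rw [hc, h3]
    intro x hx hx'
    obtain ⟨y, h1, h2, h3⟩ := hI.old x hx hx'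
    exact ⟨y, h1, by omega, h3⟩
  · rw [hc, h4, h5]; exact hI.succ_lt
  · obtain ⟨v', hv'⟩ := hI.val
    refine ⟨v', fun i' j' a b c d => ?_⟩
    obtain ⟨v0, v1, vp, vm⟩ := hv' i' j' a b c d
    rw [hc, h3, h4, h5]
    refine ⟨v0, v1, vp, fun x hx => ?_⟩
    rw [h8]
    by_cases hxq : x = q + 2
    · have e := hv i' j' a b c d
      rw [if_pos hxq, hxq, e]
      by_cases hw : i ≤ σ.natArr 3 (16 * w + (q + 2)) ∧ σ.natArr 3 (16 * w + (q + 2)) < j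
      · rw [if_pos hw, if_pos (by omega)]
        exact vm _ hlt₁
      · rw [if_neg hw, if_neg (by omega)]
        exact vm _ hlt₂
    · rw [if_neg hxq]
      exact vm x (by omega)
  · rw [h3]; exact hI.out3
  · rw [h4]; exact hI.out4
  · rw [h5]; exact hI.out5

/-- A node whose rank may enter or leave is copied, with its successors redirected to their images.
Those images exist already and have smaller numbers, because old successors precede their node. -/
theorem RebuildInv.keep {σ τ τ' : State} {w i j q c : ℕ} {v : ℕ → ℕ → ℕ → Prop}
    (hI : RebuildInv σ w i j v q τ) (hv : OldVal σ w i j v (q + 2))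
    (hlt : σ.natArr 4 (16 * w + (q + 2)) < q + 2 ∧ σ.natArr 5 (16 * w + (q + 2)) < q + 2)
    (hinj : ∀ y, 2 ≤ y → y < q + 2 →
      σ.natArr 3 (16 * w + y) ≠ σ.natArr 3 (16 * w + (q + 2)))
    (hk : (i ≤ σ.natArr 3 (16 * w + (q + 2)) ∧ σ.natArr 3 (16 * w + (q + 2)) < i + w) ∨
      (j ≤ σ.natArr 3 (16 * w + (q + 2)) ∧ σ.natArr 3 (16 * w + (q + 2)) < j + w))
    (hc : τ.natVar 12 = c) (hcw : c < 8 * w)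
    (hp : τ'.natVar 11 = q + 3) (hc' : τ'.natVar 12 = c + 1)
    (h3 : ∀ x, τ'.natArr 3 x =
      if x = 8 * w + c then σ.natArr 3 (16 * w + (q + 2)) else τ.natArr 3 x)
    (h4 : ∀ x, τ'.natArr 4 x =
      if x = 8 * w + c then τ.natArr 8 (σ.natArr 4 (16 * w + (q + 2))) else τ.natArr 4 x)
    (h5 : ∀ x, τ'.natArr 5 x =
      if x = 8 * w + c then τ.natArr 8 (σ.natArr 5 (16 * w + (q + 2))) else τ.natArr 5 x)
    (h8 : ∀ x, τ'.natArr 8 x = if x = q + 2 then c else τ.natArr 8 x) :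
    RebuildInv σ w i j v (q + 1) τ' := by
  obtain ⟨hlt₁, hlt₂⟩ := hlt
  have hc2 := hI.two_le
  have hcq := hI.le_p
  have hm := hI.map_lt
  have hwin := hI.window
  have hold := hI.old
  have hin := hI.inj
  have hsl := hI.succ_lt
  obtain ⟨v', hv'⟩ := hI.val
  simp only [hc] at hc2 hcq hm hwin hold hin hsl hv'
  have k3 : ∀ x, τ'.natArr 3 (8 * w + x) =
      if x = c then σ.natArr 3 (16 * w + (q + 2)) else τ.natArr 3 (8 * w + x) := by
    intro x; rw [h3]; simp
  have k4 : ∀ x, τ'.natArr 4 (8 * w + x) =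
      if x = c then τ.natArr 8 (σ.natArr 4 (16 * w + (q + 2))) else τ.natArr 4 (8 * w + x) := by
    intro x; rw [h4]; simp
  have k5 : ∀ x, τ'.natArr 5 (8 * w + x) =
      if x = c then τ.natArr 8 (σ.natArr 5 (16 * w + (q + 2))) else τ.natArr 5 (8 * w + x) := by
    intro x; rw [h5]; simp
  have hne : ∀ x, 2 ≤ x → x < c → τ.natArr 3 (8 * w + x) ≠ σ.natArr 3 (16 * w + (q + 2)) := by
    intro x hx hx' e
    obtain ⟨y, y2, yq, hy⟩ := hold x hx hx'
    exact hinj y y2 yq (hy ▸ e)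
  refine ⟨hp, by omega, by omega, ?_, ?_, ?_, ?_, ?_, ?_, ?_, ?_, ?_⟩
  · intro x hx
    rw [h8, hc']
    split_ifs
    · omega
    · have := hm x (by omega); omega
  · intro x y hx hx' hy hy' e
    rw [hc'] at hx' hy'
    rw [k3, k3] at e
    split_ifs at e with h1 h2 h2
    · omega
    · exact absurd e.symm (hne y hy (by omega))
    · exact absurd e (hne x hx (by omega))
    · exact hin x y hx (by omega) hy (by omega) e
  · intro x hx hx'
    rw [k3]
    split_ifs with h
    · exact hk
    · exact hwin x hx (by omega)
  · intro x hx hx'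
    rw [k3]
    split_ifs with h
    · exact ⟨q + 2, by omega, by omega, rfl⟩
    · obtain ⟨y, h1, h2, h3⟩ := hold x hx (by omega)
      exact ⟨y, h1, by omega, h3⟩
  · intro x hx hx'
    rw [k4, k5]
    split_ifs with h
    · have := hm _ hlt₁
      have := hm _ hlt₂
      omega
    · exact hsl x hx (by omega)
  -- The new node `c` inherits the value of the old node `q + 2`, of which it is a copy.
  · refine ⟨fun p => if p = c then v (q + 2) else v' p, fun i' j' a b c' d => ?_⟩
    obtain ⟨v0, v1, vp, vm⟩ := hv' i' j' a b c' d
    refine ⟨?_, ?_, ?_, ?_⟩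
    · simpa [show ¬ 0 = c by omega] using v0
    · simpa [show ¬ 1 = c by omega] using v1
    · intro p hp hp'
      rw [k3, k4, k5]
      by_cases h : p = c
      · have m1 := hm _ hlt₁
        have m2 := hm _ hlt₂
        simp only [if_pos h, if_neg m1.ne, if_neg m2.ne]
        rw [hv i' j' a b c' d, vm _ hlt₁, vm _ hlt₂]
      · have := hsl p hp (by omega)
        simp only [if_neg h]
        rw [if_neg (by omega : ¬ τ.natArr 4 (8 * w + p) = c),
          if_neg (by omega : ¬ τ.natArr 5 (8 * w + p) = c)]
        exact vp p hp (by omega)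
    · intro x hx
      dsimp only
      rw [h8]
      by_cases h : x = q + 2
      · rw [if_pos h, if_pos rfl, h]
      · have := hm x (by omega)
        rw [if_neg h, if_neg this.ne]
        exact vm x (by omega)
  · intro x hx
    rw [h3, if_neg (by omega)]
    exact hI.out3 x hx
  · intro x hx
    rw [h4, if_neg (by omega)]
    exact hI.out4 x hx
  · intro x hx
    rw [h5, if_neg (by omega)]
    exact hI.out5 x hx

theorem rebuildBody_spec {σ τ : State} {w i j q : ℕ} {F : ℕ → ℕ → Prop}
    {v : ℕ → ℕ → ℕ → Prop} (hσ : Level σ (2 * w) F i j w) (hw : 1 ≤ w)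
    (hW : 32 * w < W) (hW' : i + w < W) (hW'' : j + w < W) (hv : OldVal σ w i j v (q + 2))
    (hq : q + 2 < σ.natArr 7 (2 * w))
    (h3 : τ.natVar 3 = w) (h7 : τ.natVar 7 = i) (h8 : τ.natVar 8 = j)
    (h14 : τ.natVar 14 = 16 * w) (h15 : τ.natVar 15 = 8 * w)
    (hI : RebuildInv σ w i j v q τ) :
    Run W ops rebuildBody (rebuildBody : Cmd K).bound τ (RebuildInv σ w i j v (q + 1)) := by
  apply Run.of_loopFree rfl
  have hs := hσ.size_le
  have hp := hI.p_eq
  have hc2 := hI.two_le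
  have hcq := hI.le_p
  -- The nodes kept so far have distinct ranks in two intervals of length w, so there are at most 2w
  -- of them. Hence the next write stays in the block of scale w and does not touch the source
  -- block.
  have hcw := le_of_injOn_window hI.inj hI.window
  obtain ⟨c, hc⟩ : ∃ c, τ.natVar 12 = c := ⟨_, rfl⟩
  rw [hc] at hc2 hcq hcw
  have e1 : (16 * w + (q + 2)) % W = 16 * w + (q + 2) := Nat.mod_eq_of_lt (by omega)
  have e2 : (8 * w + c) % W = 8 * w + c := Nat.mod_eq_of_lt (by omega)
  have e3 : (i + w) % W = i + w := Nat.mod_eq_of_lt (by omega)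
  have e4 : (j + w) % W = j + w := Nat.mod_eq_of_lt (by omega)
  have e5 : (c + 1) % W = c + 1 := Nat.mod_eq_of_lt (by omega)
  have e6 : (q + 2 + 1) % W = q + 3 := Nat.mod_eq_of_lt (by omega)
  have e7 : 1 % W = 1 := Nat.mod_eq_of_lt (by omega)
  have e8 : 16 * w + (q + 2) ≠ 8 * w + c := by omega
  have o3 := hI.out3 (16 * w + (q + 2)) (by omega)
  have o4 := hI.out4 (16 * w + (q + 2)) (by omega)
  have o5 := hI.out5 (16 * w + (q + 2)) (by omega)
  have hlt := hσ.succ_lt (q + 2) (by omega) hq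
  have hinj := fun y h2 hy => hσ.inj y (q + 2) h2 hy (by omega) hq
  rw [show 8 * (2 * w) = 16 * w by ring] at hlt hinj
  obtain ⟨υ, hυ⟩ : ∃ υ, υ = τ.putNat 16 (σ.natArr 3 (16 * w + (q + 2))) := ⟨_, rfl⟩
  have hrun : Cmd.run W ops (.setNat 16 (.arr 3 (.add (.var 14) (.var 11)))) τ = υ := by
    simp [h14, hp, e1, o3, hυ]
  have hkeep : (rebuildKeep : BExp K).holds W ops υ ↔
      (i ≤ σ.natArr 3 (16 * w + (q + 2)) ∧ σ.natArr 3 (16 * w + (q + 2)) < i + w) ∨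
      (j ≤ σ.natArr 3 (16 * w + (q + 2)) ∧ σ.natArr 3 (16 * w + (q + 2)) < j + w) := by
    simp only [rebuildKeep, BExp.holds, NExp.eval, BExp.holds_natLt, hυ, State.natVar_putNat, h7,
      h3, h8, e3, e4, if_true, if_false, Nat.reduceEqDiff]
    tauto
  have hin : (BExp.and (.natLe (.var 7) (.var 16)) (.natLt (.var 16) (.var 8)) : BExp K).holds
      W ops υ ↔
      i ≤ σ.natArr 3 (16 * w + (q + 2)) ∧ σ.natArr 3 (16 * w + (q + 2)) < j := by
    simp [hυ, h7, h8]
  rw [rebuildBody, Cmd.run_seq, hrun, Cmd.run_seq]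
  by_cases hk : (rebuildKeep : BExp K).holds W ops υ
  · rw [Cmd.run_ite_pos hk]
    rw [hkeep] at hk
    apply hI.keep hv hlt (fun y h2 hy e => ?_) hk hc (by omega)
    rotate_left 6
    · have := hinj y h2 (by omega) e; omega
    all_goals
      simp [hυ, h14, hp, e1, o4, o5, h15, hc, e2, e5, e6, e7, e8]
  · rw [Cmd.run_ite_neg hk]
    rw [hkeep] at hk
    by_cases hk2 : i ≤ σ.natArr 3 (16 * w + (q + 2)) ∧ σ.natArr 3 (16 * w + (q + 2)) < j
    · rw [Cmd.run_ite_pos (hin.2 hk2)]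
      apply hI.contract hv hlt hk
      all_goals
        try rw [if_pos hk2]
        simp [hυ, h14, hp, e1, o4, e6, e7, funext_iff]
    · rw [Cmd.run_ite_neg (mt hin.1 hk2)]
      apply hI.contract hv hlt hk
      all_goals
        try rw [if_neg hk2]
        simp [hυ, h14, hp, e1, o5, e6, e7, funext_iff]

/-- The source has at most 4w + 2 nodes, each treated once in increasing order, so the cost is
linear in w. It has to be valid only for w further moves. -/
theorem rebuild_spec {σ : State} {w i j : ℕ} {F : ℕ → ℕ → Prop}
    (hσ : Level σ (2 * w) F i j w) (hw : 1 ≤ w) (hW : 32 * w < W) (hW' : i + w < W)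
    (hW'' : j + w < W) (h3 : σ.natVar 3 = w) (h7 : σ.natVar 7 = i) (h8 : σ.natVar 8 = j) :
    Run W ops (rebuild : Cmd K) (1000 * w) σ (fun τ => Level τ w F i j w ∧
      (∀ a x, (x < 8 * w ∨ 16 * w ≤ x) → (a = 3 ∨ a = 4 ∨ a = 5) →
        τ.natArr a x = σ.natArr a x) ∧
      (∀ a x, x ≠ w → (a = 6 ∨ a = 7) → τ.natArr a x = σ.natArr a x)) := by
  have hs := hσ.size_le
  have h2 := hσ.two_le
  have hst := hσ.start_lt
  obtain ⟨v, hv⟩ := hσ.val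
  have e16 : 16 % W = 16 := Nat.mod_eq_of_lt (by omega)
  have e8 : 8 % W = 8 := Nat.mod_eq_of_lt (by omega)
  have e2 : 2 % W = 2 := Nat.mod_eq_of_lt (by omega)
  have e1 : 1 % W = 1 := Nat.mod_eq_of_lt (by omega)
  have ew : (2 * w) % W = 2 * w := Nat.mod_eq_of_lt (by omega)
  have e8w : (8 * w) % W = 8 * w := Nat.mod_eq_of_lt (by omega)
  have e16w : (16 * w) % W = 16 * w := Nat.mod_eq_of_lt (by omega)
  have hold : ∀ p, 2 ≤ p → p < σ.natArr 7 (2 * w) → OldVal σ w i j v p := by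
    intro p hp hp' i' j' a b c d
    have := (hv i' j' a b c d).2.2.1 p hp hp'
    rwa [show 8 * (2 * w) = 16 * w by ring] at this
  have hrun : Run W ops (rebuild : Cmd K) ((rebuildInit : Cmd K).bound +
      ((σ.natArr 7 (2 * w) - 2 + 1) * ((BExp.natLt (.var 11) (.arr 7 (.mul (.lit 2) (.var 3))) :
        BExp K).cost + 1 + (rebuildBody : Cmd K).bound) + 20)) σ (fun τ => Level τ w F i j w ∧
      (∀ a x, (x < 8 * w ∨ 16 * w ≤ x) → (a = 3 ∨ a = 4 ∨ a = 5) →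
        τ.natArr a x = σ.natArr a x) ∧
      (∀ a x, x ≠ w → (a = 6 ∨ a = 7) → τ.natArr a x = σ.natArr a x)) := by
    refine Run.seq (R := fun τ => RebuildInv σ w i j v 0 τ ∧ τ.natVar 14 = 16 * w ∧
      τ.natVar 15 = 8 * w) (Run.of_loopFree rfl ?_) ?_
    · refine ⟨⟨?_, ?_, ?_, ?_, ?_, ?_, ?_, ?_, ⟨v, fun i' j' a b c d => ⟨(hv i' j' a b c d).1,
        (hv i' j' a b c d).2.1, ?_, ?_⟩⟩, ?_, ?_, ?_⟩, ?_, ?_⟩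
      all_goals simp [rebuildInit, e16, e8, e2, e1, h3, e8w, e16w]
      · intro x hx; split_ifs <;> omega
      · intros; omega
      · intros; omega
      · intros; omega
      · intros; omega
      · intros; omega
      · intro x hx
        split_ifs with h h'
        · rw [h]
        · rw [h']
        · omega
    intro τ hτ ⟨hI, h14, h15⟩
    have t3 : τ.natVar 3 = w := (hτ.natVar 3 rfl).trans h3
    have t7 : τ.natVar 7 = i := (hτ.natVar 7 rfl).trans h7
    have t8 : τ.natVar 8 = j := (hτ.natVar 8 rfl).trans h8
    have a6 : τ.natArr 6 = σ.natArr 6 := hτ.natArr 6 rfl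
    have a7 : τ.natArr 7 = σ.natArr 7 := hτ.natArr 7 rfl
    refine Run.seq (Run.loop_const (σ.natArr 7 (2 * w) - 2) _ (fun q υ => RebuildInv σ w i j v q υ)
      hI ?_ ?_) ?_
    · intro q hq υ hυ hI'
      have u3 : υ.natVar 3 = w := (hυ.natVar 3 rfl).trans t3
      refine ⟨?_, rebuildBody_spec hσ hw hW hW' hW'' (hold _ (by omega) (by omega)) (by omega)
        u3 ((hυ.natVar 7 rfl).trans t7)
        ((hυ.natVar 8 rfl).trans t8) ((hυ.natVar 14 rfl).trans h14) ((hυ.natVar 15 rfl).trans h15)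
        hI'⟩
      simp [hI'.p_eq, u3, hυ.natArr 7 rfl, a7, e2, ew]
      omega
    · intro υ hυ hI'
      have u3 : υ.natVar 3 = w := (hυ.natVar 3 rfl).trans t3
      simp [hI'.p_eq, u3, hυ.natArr 7 rfl, a7, e2, ew]
      omega
    · intro υ hυ hI'
      have u3 : υ.natVar 3 = w := (hυ.natVar 3 rfl).trans t3
      have b6 : υ.natArr 6 = σ.natArr 6 := (hυ.natArr 6 rfl).trans a6
      have b7 : υ.natArr 7 = σ.natArr 7 := (hυ.natArr 7 rfl).trans a7
      refine (Run.of_loopFree (P := .setNatArr 7 (.var 3) (.var 12) ;;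
        .setNatArr 6 (.var 3) (.arr 8 (.arr 6 (.mul (.lit 2) (.var 3))))) (Q := fun τ => _) rfl
        ?_).mono (N' := 20) (by simp) (fun _ _ h => h)
      refine ⟨⟨?_, ?_, ?_, ?_, ?_, ?_⟩, ?_, ?_⟩
      · simpa [u3] using hI'.two_le
      · simpa [u3] using le_of_injOn_window hI'.inj hI'.window
      · simpa [u3, b6, e2, ew] using hI'.map_lt _ (by omega)
      · simpa [u3] using hI'.inj
      · simpa [u3] using hI'.succ_lt
      · obtain ⟨v', hv'⟩ := hI'.val
        refine ⟨v', fun i' j' a b c d => ?_⟩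
        obtain ⟨v0, v1, vp, vm⟩ := hv' i' j' a b c d
        refine ⟨v0, v1, by simpa [u3] using vp, ?_⟩
        have := vm (σ.natArr 6 (2 * w)) (by omega)
        rw [(hv i' j' a b c d).2.2.2] at this
        simpa [u3, b6, e2, ew] using this
      · rintro a x hx (rfl | rfl | rfl)
        · simpa using hI'.out3 x hx
        · simpa using hI'.out4 x hx
        · simpa using hI'.out5 x hx
      · rintro a x hx (rfl | rfl)
        · simp [u3, hx, b6]
        · simp [u3, hx, b7]
  refine hrun.mono ?_ fun _ _ h => h
  have hb : (rebuildInit : Cmd K).bound + 20 ≤ 100 := by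
    simp [rebuildInit]
  have hb' : (BExp.natLt (.var 11) (.arr 7 (.mul (.lit 2) (.var 3))) :
        BExp K).cost + 1 + (rebuildBody : Cmd K).bound ≤ 150 := by
    simp [rebuildBody, rebuildKeep, BExp.natLt]
  -- At most 4w inner nodes, plus one for the final loop test, are at most 5w rounds since w ≥ 1.
  calc _ ≤ (5 * w) * 150 + 100 := by
        have := Nat.mul_le_mul (show σ.natArr 7 (2 * w) - 2 + 1 ≤ 5 * w by omega) hb'
        omega
    _ ≤ _ := by omega

end Levels

/-! ## Sweeping the window -/

section Sweep

variable {K : Type} {W : ℕ} {ops : K → ℝ → ℝ → ℝ}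

/-- One round of `refresh`. -/
def refreshBody : Cmd K :=
  .ite (.natLe (.sub (.var 9) (.mul (.div (.var 9) (.var 3)) (.var 3))) (.lit 0)) rebuild .skip ;;
  .setNat 3 (.div (.var 3) (.lit 2))

/-- Rebuild the forests of all scales that divide the time (integer variable `9`). -/
def refresh : Cmd K :=
  .setNat 3 (.var 1) ;; .loop (.natLe (.lit 1) (.var 3)) refreshBody

/-- The forests that are up to date at time `t` with the window `[i, j)`, when all scales `2 ^ k`
with `s k` have just been refreshed. -/
structure Levels (σ : State) (L t i j : ℕ) (F : ℕ → ℕ → Prop) (s : ℕ → Prop) : Prop where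
  top : Level σ (2 * 2 ^ L) F 0 0 (2 * 2 ^ L)
  level : ∀ k ≤ L, s k ∨ t % 2 ^ k ≠ 0 → Level σ (2 ^ k) F i j (2 ^ k - t % 2 ^ k)

theorem Levels.congr {σ τ : State} {L t i j : ℕ} {F : ℕ → ℕ → Prop} {s : ℕ → Prop}
    (h : Levels σ L t i j F s) (h' : ∀ a, 3 ≤ a → a ≤ 7 → τ.natArr a = σ.natArr a) :
    Levels τ L t i j F s := by
  have h3 := h' 3 (by omega) (by omega)
  have h4 := h' 4 (by omega) (by omega)
  have h5 := h' 5 (by omega) (by omega)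
  have h6 := h' 6 (by omega) (by omega)
  have h7 := h' 7 (by omega) (by omega)
  exact ⟨h.top.congr (by have := @Nat.one_le_two_pow L; omega) (by simp [h3]) (by simp [h4]) (by simp [h5]) (by simp [h6])
      (by simp [h7]), fun k hk hs => (h.level k hk hs).congr Nat.one_le_two_pow (by simp [h3])
      (by simp [h4]) (by simp [h5]) (by simp [h6]) (by simp [h7])⟩

/-- A forest of scale 2^k expires exactly when 2^k divides the time. The forest of the next larger
scale has then already been refreshed and serves as the source; for k = L the source is the
uncontracted forest, which is correct for all windows that occur. -/
theorem refreshBody_spec {σ : State} {L t i j k : ℕ} {F : ℕ → ℕ → Prop} {s : ℕ → Prop}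
    (hW : 100 * 2 ^ L < W) (hi : i ≤ 2 ^ L) (hj : j ≤ 2 ^ L) (hk : k ≤ L) (ht : t < 2 * 2 ^ L)
    (h3 : σ.natVar 3 = 2 ^ k) (h7 : σ.natVar 7 = i) (h8 : σ.natVar 8 = j) (h9 : σ.natVar 9 = t)
    (h : Levels σ L t i j F s) (hs : k < L → s (k + 1)) :
    Run W ops (refreshBody : Cmd K) (20 + if t % 2 ^ k = 0 then 1000 * 2 ^ k else 0) σ
      (fun τ => Levels τ L t i j F (fun k' => s k' ∨ k' = k) ∧ τ.natVar 3 = 2 ^ k / 2) := by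
  have hkL : 2 ^ k ≤ 2 ^ L := Nat.pow_le_pow_right (by norm_num) hk
  have hk0 : 1 ≤ 2 ^ k := Nat.one_le_two_pow
  have e2 : 2 % W = 2 := Nat.mod_eq_of_lt (by omega)
  have hdm := Nat.div_mul_le_self t (2 ^ k)
  have htk := Nat.mod_lt t hk0
  have hmod : t - t / 2 ^ k * 2 ^ k = t % 2 ^ k := by
    have := Nat.div_add_mod' t (2 ^ k); omega
  have edm : (t / 2 ^ k * 2 ^ k) % W = t / 2 ^ k * 2 ^ k := Nat.mod_eq_of_lt (by omega)
  have hb : (BExp.natLe (.sub (.var 9) (.mul (.div (.var 9) (.var 3)) (.var 3))) (.lit 0) :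
      BExp K).holds W ops σ ↔ t % 2 ^ k = 0 := by
    simp only [BExp.holds, NExp.eval, h9, h3, edm, hmod, Nat.zero_mod, Nat.le_zero]
  have hmain : Run W ops (.ite (.natLe (.sub (.var 9) (.mul (.div (.var 9) (.var 3)) (.var 3)))
      (.lit 0)) rebuild .skip : Cmd K) (12 + if t % 2 ^ k = 0 then 1000 * 2 ^ k else 0) σ
      (fun τ => Levels τ L t i j F (fun k' => s k' ∨ k' = k)) := by
    refine (Run.ite (N := 1 + if t % 2 ^ k = 0 then 1000 * 2 ^ k else 0) ?_ ?_).mono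
      (by simp; omega) fun _ _ h => h
    · intro hb'
      have h0 := hb.1 hb'
      rw [if_pos h0]
      have hsrc : Level σ (2 * 2 ^ k) F i j (2 ^ k) := by
        rcases hk.eq_or_lt with rfl | hlt
        · exact h.top.shrink (by omega) (by omega) (by omega) (by omega)
        · have := h.level (k + 1) hlt (Or.inl (hs hlt))
          rw [pow_succ'] at this
          refine this.shrink le_rfl ?_ le_rfl ?_
          all_goals
            -- As 2^k divides t, the larger scale is at the start or exactly in the middle of its
            -- period, so it remains valid for at least 2^k more moves.
            have hm : t % (2 * 2 ^ k) ≤ 2 ^ k := by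
              rw [mul_comm 2, Nat.mod_mul, h0]
              have := Nat.mod_lt (t / 2 ^ k) (show 0 < 2 by norm_num)
              nlinarith
            omega
      refine (rebuild_spec hsrc hk0 (by omega) (by omega) (by omega) h3 h7 h8).mono (by omega) ?_
      rintro τ - ⟨hl, ho, ho'⟩
      have hne : ∀ w, (2 * w ≤ 2 ^ k ∨ 2 * 2 ^ k ≤ w) → 1 ≤ w → ∀ {i j r}, Level σ w F i j r →
          Level τ w F i j r := by
        intro w hw hw' i j r hl'
        refine hl'.congr hw' (fun p _ _ => ?_) (fun p _ _ => ?_) (fun p _ _ => ?_) ?_ ?_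
        · exact ho 3 p (by omega) (by simp)
        · exact ho 4 p (by omega) (by simp)
        · exact ho 5 p (by omega) (by simp)
        · exact ho' 6 w (by omega) (by simp)
        · exact ho' 7 w (by omega) (by simp)
      refine ⟨hne _ (by omega) (by omega) h.top, fun k' hk' hs' => ?_⟩
      rcases lt_trichotomy k' k with hlt | rfl | hlt
      · exact hne _ (Or.inl (two_mul_two_pow_le hlt)) Nat.one_le_two_pow
          (h.level k' hk' (hs'.imp_left fun h => h.resolve_right hlt.ne))
      · rwa [h0]
      · exact hne _ (Or.inr (two_mul_two_pow_le hlt)) Nat.one_le_two_pow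
          (h.level k' hk' (hs'.imp_left fun h => h.resolve_right hlt.ne'))
    · intro hb'
      have h0 := mt hb.2 hb'
      refine (Run.of_loopFree (P := .skip) rfl ?_).mono (by simp) fun _ _ h => h
      refine ⟨h.top, fun k' hk' hs' => h.level k' hk' ?_⟩
      rcases hs' with (hs' | rfl) | hs'
      · exact Or.inl hs'
      · exact Or.inr h0
      · exact Or.inr hs'
  refine (Run.seq (N' := 4) hmain ?_).mono (by omega) fun _ _ h => h
  intro τ hτ hl
  refine ⟨_, _, .setNat _ _ _, by simp, hl.congr fun _ _ _ => rfl, ?_⟩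
  simp [hτ.natVar 3 rfl, h3, e2]

/-- Scales are treated from coarse to fine, since each is rebuilt from the next coarser one: after r
rounds those with index above L - r are current. -/
theorem refresh_spec {σ : State} {L t i j : ℕ} {F : ℕ → ℕ → Prop}
    (hW : 100 * 2 ^ L < W) (hi : i ≤ 2 ^ L) (hj : j ≤ 2 ^ L) (ht : t < 2 * 2 ^ L)
    (h1 : σ.natVar 1 = 2 ^ L) (h7 : σ.natVar 7 = i) (h8 : σ.natVar 8 = j) (h9 : σ.natVar 9 = t)
    (h : Levels σ L t i j F fun _ => False) :
    Run W ops (refresh : Cmd K)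
      (∑ r ∈ Finset.range (L + 1), (24 + if t % 2 ^ r = 0 then 1000 * 2 ^ r else 0) + 6) σ
      (fun τ => Levels τ L t i j F fun _ => True) := by
  have e1 : 1 % W = 1 := Nat.mod_eq_of_lt (by have := @Nat.one_le_two_pow L; omega)
  refine (Run.seq (N := 2) (N' := ∑ r ∈ Finset.range (L + 1), (4 + (20 +
        if t % 2 ^ (L - r) = 0 then 1000 * 2 ^ (L - r) else 0)) + 4)
    (R := fun τ => τ.natVar 3 = 2 ^ L ∧ Levels τ L t i j F fun _ => False)
    ⟨_, _, .setNat _ _ _, by simp, by simp [h1], h.congr fun _ _ _ => rfl⟩ ?_).mono ?_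
    (fun _ _ h => h)
  · intro τ hτ ⟨h3, hl⟩
    refine (Run.loop (L + 1)
      (fun r => 20 + if t % 2 ^ (L - r) = 0 then 1000 * 2 ^ (L - r) else 0)
      (fun r υ => υ.natVar 3 = 2 ^ L / 2 ^ r ∧ Levels υ L t i j F fun k => L < k + r)
      ⟨by simpa using h3, ⟨hl.top, fun k hk hs => hl.level k hk
        (hs.imp_left fun h => by omega)⟩⟩ ?_ ?_).mono le_rfl ?_
    · intro r hr υ hυ ⟨u3, ul⟩
      rw [Nat.pow_div (by omega) (by norm_num)] at u3
      refine ⟨by simp [u3, e1, Nat.one_le_two_pow], (refreshBody_spec hW hi hj (Nat.sub_le L r) ht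
        u3 (((hυ.natVar 7 rfl).trans (hτ.natVar 7 rfl)).trans h7)
        (((hυ.natVar 8 rfl).trans (hτ.natVar 8 rfl)).trans h8)
        (((hυ.natVar 9 rfl).trans (hτ.natVar 9 rfl)).trans h9) ul (by omega)).mono le_rfl ?_⟩
      rintro ψ - ⟨hψ, h3'⟩
      refine ⟨?_, hψ.top, fun k hk hs => hψ.level k hk (hs.imp_left fun h => by omega)⟩
      rw [h3', ← Nat.pow_div (by omega) (by norm_num), Nat.div_div_eq_div_mul, pow_succ]
    · intro υ hυ ⟨u3, ul⟩
      rw [Nat.div_eq_of_lt (Nat.pow_lt_pow_right (by norm_num) (by omega))] at u3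
      simp [u3, e1]
    · rintro υ - ⟨-, ul⟩
      exact ⟨ul.top, fun k hk _ => ul.level k hk (Or.inl (by omega))⟩
  -- The program counts the scales downwards and the bound counts them upwards.
  · rw [← Finset.sum_range_reflect
      (fun r => 24 + if t % 2 ^ r = 0 then 1000 * 2 ^ r else 0)]
    have : ∀ r ∈ Finset.range (L + 1), 4 + (20 +
        if t % 2 ^ (L - r) = 0 then 1000 * 2 ^ (L - r) else 0) =
        24 + if t % 2 ^ (L + 1 - 1 - r) = 0 then 1000 * 2 ^ (L + 1 - 1 - r) else 0 := by
      intro r _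
      rw [Nat.add_sub_cancel]; omega
    rw [← Finset.sum_congr rfl this]
    omega

/-- One step from the node in integer variable `13` of the forest for scale `1`. -/
def queryStep : Cmd K :=
  .ite (.natLe (.lit 2) (.var 13))
    (.ite (.and (.natLe (.var 7) (.arr 3 (.add (.lit 8) (.var 13))))
        (.natLt (.arr 3 (.add (.lit 8) (.var 13))) (.var 8)))
      (.setNat 13 (.arr 4 (.add (.lit 8) (.var 13))))
      (.setNat 13 (.arr 5 (.add (.lit 8) (.var 13)))))
    .skip

/-- Decide the current window; integer variable `13` becomes `1` if it is feasible. -/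
def query : Cmd K :=
  .setNat 13 (.arr 6 (.lit 1)) ;; queryStep ;; queryStep

/-- Successors have smaller numbers, so a step from an inner node lowers the maximal possible node
number by one. -/
theorem queryStep_spec {σ τ : State} {i j q : ℕ} {v : ℕ → Prop} (hW : 20 < W)
    (hq : q ≤ 3)
    (hlt : ∀ p, 2 ≤ p → p ≤ q → σ.natArr 4 (8 + p) < p ∧ σ.natArr 5 (8 + p) < p)
    (hv : ∀ p, 2 ≤ p → p ≤ q → (v p ↔ if i ≤ σ.natArr 3 (8 + p) ∧ σ.natArr 3 (8 + p) < j
      then v (σ.natArr 4 (8 + p)) else v (σ.natArr 5 (8 + p))))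
    (ha : τ.natArr = σ.natArr) (h7 : τ.natVar 7 = i) (h8 : τ.natVar 8 = j)
    (h13 : τ.natVar 13 ≤ q) :
    Run W ops (queryStep : Cmd K) 30 τ
      (fun υ => υ.natVar 13 ≤ max 1 (q - 1) ∧ (v (υ.natVar 13) ↔ v (τ.natVar 13))) := by
  refine (Run.of_loopFree rfl ?_).mono (by simp [queryStep, BExp.natLt]) fun _ _ h => h
  have e2 : 2 % W = 2 := Nat.mod_eq_of_lt (by omega)
  have e8 : 8 % W = 8 := Nat.mod_eq_of_lt (by omega)
  obtain ⟨p, hp⟩ : ∃ p, τ.natVar 13 = p := ⟨_, rfl⟩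
  rw [hp] at h13 ⊢
  have ep : (8 + p) % W = 8 + p := Nat.mod_eq_of_lt (by omega)
  by_cases h2 : 2 ≤ p
  · obtain ⟨l1, l2⟩ := hlt p h2 h13
    rw [queryStep, Cmd.run_ite_pos (by simpa [e2, hp] using h2), hv p h2 h13]
    by_cases hw : i ≤ σ.natArr 3 (8 + p) ∧ σ.natArr 3 (8 + p) < j
    · rw [Cmd.run_ite_pos (by simpa [e8, hp, ep, ha, h7, h8] using hw), if_pos hw]
      simp [e8, hp, ep, ha]
      omega
    · rw [Cmd.run_ite_neg (by simpa [e8, hp, ep, ha, h7, h8] using hw), if_neg hw]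
      simp [e8, hp, ep, ha]
      omega
  · rw [queryStep, Cmd.run_ite_neg (by simpa [e2, hp] using h2)]
    simp [hp]
    omega

/-- At scale 1 there are at most four nodes, 0 to 3, so two steps always end at failure or success.
-/
theorem query_spec {σ : State} {i j : ℕ} {F : ℕ → ℕ → Prop} (hW : 20 < W)
    (h7 : σ.natVar 7 = i) (h8 : σ.natVar 8 = j) (h : Level σ 1 F i j 1) :
    Run W ops (query : Cmd K) 70 σ (fun τ => τ.natVar 13 = 1 ↔ F i j) := by
  have e1 : 1 % W = 1 := Nat.mod_eq_of_lt (by omega)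
  have hs := h.size_le
  have hst := h.start_lt
  obtain ⟨v, hv⟩ := h.val
  obtain ⟨v0, v1, vp, vS⟩ := hv i j le_rfl (by omega) le_rfl (by omega)
  obtain ⟨q, hq⟩ : ∃ q, σ.natArr 7 1 = q + 1 := ⟨σ.natArr 7 1 - 1, by omega⟩
  rw [hq] at hs hst vp
  have hlt := h.succ_lt
  rw [hq] at hlt
  refine (Run.seq (N := 4) (N' := 30 + 30)
    (R := fun τ => τ.natVar 13 ≤ q ∧ (v (τ.natVar 13) i j ↔ F i j))
    ⟨_, _, .setNat _ _ _, by simp, by simp [e1]; omega, by simpa [e1] using vS⟩ ?_).mono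
    (by omega) fun _ _ h => h
  intro τ hτ ⟨hτq, hτv⟩
  refine Run.seq (queryStep_spec (σ := σ) (v := fun p => v p i j) hW (by omega)
    (fun p hp hp' => hlt p hp (by omega)) (fun p hp hp' => vp p hp (by omega))
    (by funext a; exact hτ.natArr a rfl) ((hτ.natVar 7 rfl).trans h7)
    ((hτ.natVar 8 rfl).trans h8) hτq) ?_
  intro υ hυ ⟨hυq, hυv⟩
  refine (queryStep_spec (σ := σ) (q := max 1 (q - 1)) (v := fun p => v p i j) hW (by omega)
    (fun p hp hp' => hlt p hp (by omega)) (fun p hp hp' => vp p hp (by omega))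
    (by funext a; exact (hυ.natArr a rfl).trans (hτ.natArr a rfl))
    ((hυ.natVar 7 rfl).trans ((hτ.natVar 7 rfl).trans h7))
    ((hυ.natVar 8 rfl).trans ((hτ.natVar 8 rfl).trans h8)) hυq).mono le_rfl ?_
  rintro ψ - ⟨hψq, hψv⟩
  rw [← hτv, ← hυv, ← hψv]
  have : ψ.natVar 13 = 0 ∨ ψ.natVar 13 = 1 := by omega
  rcases this with h | h <;> rw [h]
  · simpa using v0
  · simpa using v1

/-- The best value found so far: real variable `0`, or `+∞` if integer variable `10` is nonzero. -/
noncomputable def State.best (σ : State) : WithTop ℝ :=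
  if σ.natVar 10 = 0 then (σ.realVar 0 : WithTop ℝ) else ⊤

/-- The test `c` and the expression `e` compute `G s t` from `s`, `t` in the real variables
`1`, `2`: it is `+∞` if `c` holds, and otherwise the value of `e`. -/
def Computes (W : ℕ) (ops : K → ℝ → ℝ → ℝ) (c : BExp K) (e : RExp K) (G : ℝ → ℝ → WithTop ℝ) :
    Prop :=
  ∀ σ : State, (c.holds W ops σ → G (σ.realVar 1) (σ.realVar 2) = ⊤) ∧
    (¬ c.holds W ops σ → G (σ.realVar 1) (σ.realVar 2) = (e.eval W ops σ : ℝ))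

/-- Compare the value of the range in real variables `1`, `2` with the best one. -/
def record (c : BExp K) (e : RExp K) : Cmd K :=
  .ite c .skip
    (.setReal 3 e ;;
      .ite (.and (.natLe (.var 10) (.lit 0)) (.realLe (.var 0) (.var 3))) .skip
        (.setReal 0 (.var 3) ;; .setNat 10 (.lit 0)))

/-- Take the current window into account and move its left end. -/
def candidate (c : BExp K) (e : RExp K) : Cmd K :=
  .setReal 1 (.arr 2 (.arr 0 (.var 7))) ;;
  .setReal 2 (.arr 2 (.arr 0 (.sub (.var 8) (.lit 1)))) ;;
  record c e

theorem record_spec {c : BExp K} {e : RExp K} {G : ℝ → ℝ → WithTop ℝ}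
    (hG : Computes W ops c e G) (σ : State) :
    ((record c e).run W ops σ).best = min σ.best (G (σ.realVar 1) (σ.realVar 2)) := by
  obtain ⟨h1, h2⟩ := hG σ
  by_cases hc : c.holds W ops σ
  · rw [record, Cmd.run_ite_pos hc, h1 hc]
    simp
  · rw [record, Cmd.run_ite_neg hc, h2 hc, Cmd.run_seq]
    by_cases hb : σ.natVar 10 = 0 ∧ σ.realVar 0 ≤ e.eval W ops σ
    · rw [Cmd.run_ite_pos (by simpa using hb)]
      simpa [State.best, hb.1] using hb.2
    · rw [Cmd.run_ite_neg (by simpa using hb)]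
      by_cases h0 : σ.natVar 10 = 0
      · have : e.eval W ops σ ≤ σ.realVar 0 := by
          have := mt (And.intro h0) hb
          exact (not_le.1 this).le
        simpa [State.best, h0] using this
      · simp [State.best, h0]

/-- Move one end of the window, depending on the answer in integer variable `13`. -/
def advance (c : BExp K) (e : RExp K) : Cmd K :=
  .ite (.and (.natLe (.var 13) (.lit 1)) (.natLe (.lit 1) (.var 13)))
    (candidate c e ;; .setNat 7 (.add (.var 7) (.lit 1)))
    (.ite (.natLt (.var 8) (.var 1)) (.setNat 8 (.add (.var 8) (.lit 1))) .skip) ;;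
  .setNat 9 (.add (.var 9) (.lit 1))

/-- The invariant of `sweep` at time `t`. -/
structure SweepInv (F : ℕ → ℕ → Prop) (G : ℝ → ℝ → WithTop ℝ) (V : ℕ → ℝ) (L t i j : ℕ)
    (τ : State) : Prop where
  h7 : τ.natVar 7 = i
  h8 : τ.natVar 8 = j
  h9 : τ.natVar 9 = t
  hi : i ≤ 2 ^ L
  hj : j ≤ 2 ^ L
  progress : i + j = t ∨ i + j ≤ t ∧ j = 2 ^ L ∧ ¬ F i (2 ^ L)
  levels : Levels τ L t i j F fun _ => False
  below : ∀ i' < i, ∀ j' ≤ 2 ^ L, F i' j' → τ.best ≤ G (V i') (V (j' - 1))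
  attained : τ.best = ⊤ ∨ ∃ i' j', i' < j' ∧ j' ≤ 2 ^ L ∧ F i' j' ∧
    τ.best = G (V i') (V (j' - 1))
  infeasible : ∀ i' j', i ≤ i' → j' < j → ¬ F i' j'

theorem succ_mod_of_ne_zero {t w : ℕ} (h : (t + 1) % w ≠ 0) : (t + 1) % w = t % w + 1 := by
  rcases Nat.eq_zero_or_pos w with rfl | hw
  · simp
  have h1 := Nat.mod_lt t hw
  rw [Nat.add_mod_eq_ite] at h ⊢
  rcases Nat.lt_or_ge 1 w with h2 | h2
  · rw [Nat.mod_eq_of_lt h2] at h ⊢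
    split_ifs at h ⊢ with h3
    · omega
    · rfl
  · obtain rfl : w = 1 := by omega
    simp [Nat.mod_one] at h

/-- Either the next time is divisible by 2^k and nothing is claimed for this scale until its
refresh, or its phase grows by one, which pays for the move of the window by at most one. -/
theorem Levels.advance {σ τ : State} {L t i j i₂ j₂ : ℕ} {F : ℕ → ℕ → Prop}
    (h : Levels σ L t i j F fun _ => True) (h' : ∀ a, 3 ≤ a → a ≤ 7 → τ.natArr a = σ.natArr a)
    (hi : i ≤ i₂) (hi' : i₂ ≤ i + 1) (hj : j ≤ j₂) (hj' : j₂ ≤ j + 1) :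
    Levels τ L (t + 1) i₂ j₂ F fun _ => False := by
  have h2 := h.congr h'
  refine ⟨h2.top, fun k hk hs => ?_⟩
  have h0 : (t + 1) % 2 ^ k ≠ 0 := by simpa using hs
  rw [succ_mod_of_ne_zero h0]
  have := Nat.mod_lt t (show 0 < 2 ^ k by positivity)
  exact (h2.level k hk (Or.inl trivial)).shrink hi (by omega) hj (by omega)

/-- The invariant says that no window that starts at i or later and ends before j is feasible. So if
[i, j) is feasible, it has the smallest right end for its left end, and by monotonicity of the value
no window starting at i is better; the left end may move on. If it is infeasible, so are all its
subwindows, and the right end may move on. -/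
theorem advance_spec {F : ℕ → ℕ → Prop} {G : ℝ → ℝ → WithTop ℝ} {V : ℕ → ℝ} {L t i j : ℕ}
    {c : BExp K} {e : RExp K} {σ τ : State} (hG : Computes W ops c e G)
    (hGm : ∀ c a b e : ℝ, 0 ≤ c → c ≤ a → a ≤ b → b ≤ e → G a b ≤ G c e)
    (hF : ∀ i j, F i j → i < j) (hFm : ∀ i j i' j', i' ≤ i → j ≤ j' → F i j → F i' j')
    (hV : ∀ a b, a ≤ b → b < 2 ^ L → V a ≤ V b) (hV0 : ∀ a < 2 ^ L, 0 ≤ V a)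
    (hW : 100 * 2 ^ L < W) (ht : t < 2 * 2 ^ L) (hI : SweepInv F G V L t i j σ)
    (h1 : τ.natVar 1 = 2 ^ L) (h7 : τ.natVar 7 = i) (h8 : τ.natVar 8 = j) (h9 : τ.natVar 9 = t)
    (h10 : τ.natVar 10 = σ.natVar 10) (h0 : τ.realVar 0 = σ.realVar 0)
    (h13 : τ.natVar 13 = 1 ↔ F i j) (hl : Levels τ L t i j F fun _ => True)
    (hVτ : ∀ a, τ.realArr 2 (τ.natArr 0 a) = V a) :
    Run W ops (advance c e) (advance c e).bound τ
      (fun υ => ∃ i₂ j₂, SweepInv F G V L (t + 1) i₂ j₂ υ) := by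
  have hi := hI.hi
  have hj := hI.hj
  have hpr := hI.progress
  have e1 : 1 % W = 1 := Nat.mod_eq_of_lt (by omega)
  have ei : (i + 1) % W = i + 1 := Nat.mod_eq_of_lt (by omega)
  have ej : (j + 1) % W = j + 1 := Nat.mod_eq_of_lt (by omega)
  have et : (t + 1) % W = t + 1 := Nat.mod_eq_of_lt (by omega)
  have hbest : τ.best = σ.best := by simp only [State.best, h10, h0]
  have hb : (BExp.and (.natLe (.var 13) (.lit 1)) (.natLe (.lit 1) (.var 13)) : BExp K).holds
      W ops τ ↔ F i j := by
    simp only [BExp.holds, NExp.eval, e1, ← h13]; omega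
  apply Run.of_loopFree rfl
  rw [advance, Cmd.run_seq]
  by_cases hf : F i j
  · rw [Cmd.run_ite_pos (hb.2 hf), Cmd.run_seq, candidate, Cmd.run_seq, Cmd.run_seq]
    obtain ⟨υ, hυ⟩ : ∃ υ, υ = (.setReal 2 (.arr 2 (.arr 0 (.sub (.var 8) (.lit 1)))) : Cmd K).run
      W ops ((.setReal 1 (.arr 2 (.arr 0 (.var 7))) : Cmd K).run W ops τ) := ⟨_, rfl⟩
    rw [← hυ]
    have u1 : υ.realVar 1 = V i := by simp [hυ, h7, hVτ]
    have u2 : υ.realVar 2 = V (j - 1) := by simp [hυ, h8, e1, hVτ]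
    have ub : υ.best = σ.best := by rw [← hbest, hυ]; simp [State.best]
    have un : ∀ x, υ.natVar x = τ.natVar x := by simp [hυ]
    have ua : υ.natArr = τ.natArr := by rw [hυ]; rfl
    have hr := record_spec hG υ
    have hfr := Cmd.frame_run (W := W) (ops := ops) (P := record c e) rfl υ
    rw [u1, u2, ub] at hr
    have hij := hF i j hf
    have k7 : ((record c e).run W ops υ).natVar 7 = i := (hfr.natVar 7 rfl).trans ((un 7).trans h7)
    have k8 : ((record c e).run W ops υ).natVar 8 = j := (hfr.natVar 8 rfl).trans ((un 8).trans h8)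
    have k9 : ((record c e).run W ops υ).natVar 9 = t := (hfr.natVar 9 rfl).trans ((un 9).trans h9)
    have ka : ∀ a, ((record c e).run W ops υ).natArr a = τ.natArr a := fun a =>
      (hfr.natArr a rfl).trans (by rw [ua])
    generalize (record c e).run W ops υ = ψ at *
    have hbest' : ((.setNat 9 (.add (.var 9) (.lit 1)) : Cmd K).run W ops
        ((.setNat 7 (.add (.var 7) (.lit 1)) : Cmd K).run W ops ψ)).best =
        min σ.best (G (V i) (V (j - 1))) := by
      rw [← hr]; simp [State.best]
    have hpr' : i + j = t := by
      rcases hpr with h | ⟨-, rfl, h⟩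
      · exact h
      · exact absurd hf h
    refine ⟨i + 1, j, ?_, ?_, ?_, by omega, hj, by omega, ?_, ?_, ?_, ?_⟩
    · simp [k7, e1, ei]
    · simp [k8]
    · simp [k9, e1, et]
    · exact hl.advance (fun a _ _ => ka a) (by omega) (by omega) le_rfl (by omega)
    · intro i' hi' j' hj' hf'
      rw [hbest']
      rcases Nat.lt_succ_iff_lt_or_eq.1 hi' with h | rfl
      · exact (min_le_left _ _).trans (hI.below i' h j' hj' hf')
      -- Any feasible window with left end i has its right end at j or later, so its range contains
      -- the recorded one.
      · refine (min_le_right _ _).trans (hGm _ _ _ _ (hV0 _ (by omega)) le_rfl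
          (hV _ _ (by omega) (by omega)) (hV _ _ ?_ (by have := hF _ _ hf'; omega)))
        have : ¬ j' < j := fun h => hI.infeasible i' j' le_rfl h hf'
        omega
    · rw [hbest']
      rcases min_choice σ.best (G (V i) (V (j - 1))) with h | h <;> rw [h]
      · exact hI.attained
      · exact Or.inr ⟨i, j, hij, hj, hf, rfl⟩
    · exact fun i' j' hi' hj' => hI.infeasible i' j' (by omega) hj'
  · rw [Cmd.run_ite_neg (mt hb.1 hf)]
    by_cases hjM : j < 2 ^ L
    · rw [Cmd.run_ite_pos (by simpa [h8, h1] using hjM)]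
      have hbest' : ((.setNat 9 (.add (.var 9) (.lit 1)) : Cmd K).run W ops
          ((.setNat 8 (.add (.var 8) (.lit 1)) : Cmd K).run W ops τ)).best = σ.best := by
        rw [← hbest]; simp [State.best]
      refine ⟨i, j + 1, ?_, ?_, ?_, hi, by omega, by omega, ?_, ?_, ?_, ?_⟩
      · simp [h7]
      · simp [h8, e1, ej]
      · simp [h9, e1, et]
      · exact hl.advance (fun a _ _ => rfl) le_rfl (by omega) (by omega) le_rfl
      · rw [hbest']; exact hI.below
      · rw [hbest']; exact hI.attained
      · intro i' j' hi' hj' hf'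
        rcases Nat.lt_succ_iff_lt_or_eq.1 hj' with h | rfl
        · exact hI.infeasible i' j' hi' h hf'
        · exact hf (hFm _ _ _ _ hi' le_rfl hf')
    · rw [Cmd.run_ite_neg (by simpa [h8, h1] using hjM)]
      obtain rfl : j = 2 ^ L := by omega
      have hbest' : ((.setNat 9 (.add (.var 9) (.lit 1)) : Cmd K).run W ops
          ((.skip : Cmd K).run W ops τ)).best = σ.best := by
        rw [← hbest]; simp [State.best]
      -- The sweep is stuck: even the window up to the last rank is infeasible. Time runs on idly,
      -- so that the number of rounds is fixed.
      refine ⟨i, 2 ^ L, ?_, ?_, ?_, hi, by omega, Or.inr ⟨by omega, rfl, hf⟩, ?_, ?_, ?_, ?_⟩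
      · simp [h7]
      · simp [h8]
      · simp [h9, e1, et]
      · exact hl.advance (fun a _ _ => rfl) le_rfl (by omega) le_rfl (by omega)
      · rw [hbest']; exact hI.below
      · rw [hbest']; exact hI.attained
      · exact hI.infeasible

/-- Move the window over all ranks and find the best feasible one. -/
def sweep (c : BExp K) (e : RExp K) : Cmd K :=
  (.setNat 7 (.lit 0) ;; .setNat 8 (.lit 0) ;; .setNat 9 (.lit 0) ;; .setNat 10 (.lit 1)) ;;
  .loop (.natLt (.var 9) (.mul (.lit 2) (.var 1))) (refresh ;; query ;; advance c e)

theorem card_filter_mod_eq_zero (n : ℕ) {w : ℕ} (hw : 0 < w) :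
    ((Finset.range (n * w)).filter fun t => t % w = 0).card = n := by
  have : ((Finset.range (n * w)).filter fun t => t % w = 0) = (Finset.range n).image (· * w) := by
    ext t
    simp only [Finset.mem_filter, Finset.mem_range, Finset.mem_image]
    constructor
    · rintro ⟨h, h0⟩
      obtain ⟨q, rfl⟩ := Nat.dvd_of_mod_eq_zero h0
      rw [mul_comm w] at h
      exact ⟨q, Nat.lt_of_mul_lt_mul_right h, mul_comm _ _⟩
    · rintro ⟨q, h, rfl⟩
      exact ⟨Nat.mul_lt_mul_of_pos_right h hw, Nat.mul_mod_left _ _⟩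
  rw [this, Finset.card_image_of_injective _ fun a b h => Nat.eq_of_mul_eq_mul_right hw h,
    Finset.card_range]

/-- After exchanging the sums, the scale 2^r is rebuilt at 2 * 2^(L - r) times at a cost of 1000 *
2^r each; the product does not depend on r. -/
theorem sum_range_dvd_pow (L : ℕ) :
    ∑ t ∈ Finset.range (2 * 2 ^ L), ∑ r ∈ Finset.range (L + 1),
      (24 + if t % 2 ^ r = 0 then 1000 * 2 ^ r else 0) = 1024 * (2 * 2 ^ L * (L + 1)) := by
  rw [Finset.sum_comm]
  have : ∀ r ∈ Finset.range (L + 1), ∑ t ∈ Finset.range (2 * 2 ^ L),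
      (24 + if t % 2 ^ r = 0 then 1000 * 2 ^ r else 0) = 1024 * (2 * 2 ^ L) := by
    intro r hr
    have hr' : r ≤ L := Nat.lt_succ_iff.1 (Finset.mem_range.1 hr)
    rw [Finset.sum_add_distrib, ← Finset.sum_filter]
    have hcard : ((Finset.range (2 * 2 ^ L)).filter fun t => t % 2 ^ r = 0).card =
        2 * 2 ^ (L - r) := by
      have : 2 * 2 ^ L = 2 * 2 ^ (L - r) * 2 ^ r := by
        rw [mul_assoc, ← pow_add]; congr 2; omega
      rw [this, card_filter_mod_eq_zero _ (by positivity)]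
    simp only [Finset.sum_const, Finset.card_range, hcard, smul_eq_mul]
    have : 2 ^ L = 2 ^ (L - r) * 2 ^ r := by rw [← pow_add]; congr 1; omega
    rw [this]; ring
  rw [Finset.sum_congr rfl this]
  simp
  ring

/-- Each round moves one end until the sweep gets stuck. After 2 * 2^L rounds either both ends are
at 2^L, or no window with the current or a later left end is feasible; in both cases all left ends
of feasible windows have been handled. -/
theorem sweep_spec {F : ℕ → ℕ → Prop} {G : ℝ → ℝ → WithTop ℝ} {V : ℕ → ℝ} {L : ℕ}
    {c : BExp K} {e : RExp K} {σ : State} (hG : Computes W ops c e G)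
    (hGm : ∀ c a b e : ℝ, 0 ≤ c → c ≤ a → a ≤ b → b ≤ e → G a b ≤ G c e)
    (hF : ∀ i j, F i j → i < j) (hFm : ∀ i j i' j', i' ≤ i → j ≤ j' → F i j → F i' j')
    (hF1 : F 0 (2 ^ L))
    (hV : ∀ a b, a ≤ b → b < 2 ^ L → V a ≤ V b) (hV0 : ∀ a < 2 ^ L, 0 ≤ V a)
    (hW : 100 * 2 ^ L < W) 
    (h1 : σ.natVar 1 = 2 ^ L) (hl : Level σ (2 * 2 ^ L) F 0 0 (2 * 2 ^ L))
    (hVσ : ∀ a, σ.realArr 2 (σ.natArr 0 a) = V a) :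
    Run W ops (sweep c e) ((2000 + (advance c e).bound) * (2 * 2 ^ L * (L + 1))) σ
      (fun τ => (∃ i j, i < j ∧ j ≤ 2 ^ L ∧ F i j ∧ τ.best = G (V i) (V (j - 1))) ∧
        ∀ i j, j ≤ 2 ^ L → F i j → τ.best ≤ G (V i) (V (j - 1))) := by
  have hL := @Nat.one_le_two_pow L
  have e1 : 1 % W = 1 := Nat.mod_eq_of_lt (by omega)
  have e2 : 2 % W = 2 := Nat.mod_eq_of_lt (by omega)
  have eM : (2 * 2 ^ L) % W = 2 * 2 ^ L := Nat.mod_eq_of_lt (by omega)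
  refine (Run.seq (N := 8) (N' := ∑ t ∈ Finset.range (2 * 2 ^ L), (7 +
    ((∑ r ∈ Finset.range (L + 1), (24 + if t % 2 ^ r = 0 then 1000 * 2 ^ r else 0) + 6) +
      (70 + (advance c e).bound))) + 7)
    (R := fun τ => SweepInv F G V L 0 0 0 τ) ((Run.of_loopFree rfl ?_).mono (by simp)
      fun _ _ h => h) ?_).mono ?_ fun _ _ h => h
  · refine ⟨?_, ?_, ?_, by omega, by omega, by omega, ⟨?_, ?_⟩, by omega, ?_, by omega⟩
    · simp
    · simp
    · simp
    · exact hl.congr (by omega) (by simp) (by simp) (by simp) (by simp) (by simp)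
    · simp
    · simp [State.best, e1]
  · intro τ hτ hI
    refine (Run.loop (2 * 2 ^ L) (fun t =>
      ((∑ r ∈ Finset.range (L + 1), (24 + if t % 2 ^ r = 0 then 1000 * 2 ^ r else 0) + 6) +
        (70 + (advance c e).bound))) (fun t υ => ∃ i j, SweepInv F G V L t i j υ)
      ⟨0, 0, hI⟩ ?_ ?_).mono (by simp [BExp.natLt]) ?_
    · rintro t ht υ hυ ⟨i, j, hυI⟩
      have u1 : υ.natVar 1 = 2 ^ L := (hυ.natVar 1 rfl).trans ((hτ.natVar 1 rfl).trans h1)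
      refine ⟨by simpa [hυI.h9, u1, e2, eM] using ht, ?_⟩
      refine Run.seq (refresh_spec hW hυI.hi hυI.hj ht u1 hυI.h7 hυI.h8 hυI.h9 hυI.levels) ?_
      intro ψ hψ hψl
      have hψ0 := hψl.level 0 (by omega) (Or.inl trivial)
      simp only [pow_zero, Nat.mod_one, Nat.sub_zero] at hψ0
      refine Run.seq (query_spec (by omega) ((hψ.natVar 7 rfl).trans hυI.h7)
        ((hψ.natVar 8 rfl).trans hυI.h8) hψ0) ?_
      intro χ hχ h13
      have hχψ : ∀ x, x ≠ 13 → χ.natVar x = ψ.natVar x := fun x hx =>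
        hχ.natVar x (by simp [query, queryStep, Cmd.natVars, hx])
      refine advance_spec hG hGm hF hFm hV hV0 hW ht hυI ?_ ?_ ?_ ?_ ?_ ?_ h13 ?_ ?_
      · exact (hχ.natVar 1 rfl).trans ((hψ.natVar 1 rfl).trans u1)
      · exact (hχ.natVar 7 rfl).trans ((hψ.natVar 7 rfl).trans hυI.h7)
      · exact (hχ.natVar 8 rfl).trans ((hψ.natVar 8 rfl).trans hυI.h8)
      · exact (hχ.natVar 9 rfl).trans ((hψ.natVar 9 rfl).trans hυI.h9)
      · exact (hχ.natVar 10 rfl).trans (hψ.natVar 10 rfl)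
      · exact (hχ.realVar 0 rfl).trans (hψ.realVar 0 rfl)
      · exact hψl.congr fun a _ _ => hχ.natArr a rfl
      · intro a
        rw [hχ.natArr 0 rfl, hψ.natArr 0 rfl, hυ.natArr 0 rfl, hτ.natArr 0 rfl,
          hχ.realArr 2 rfl, hψ.realArr 2 rfl, hυ.realArr 2 rfl, hτ.realArr 2 rfl]
        exact hVσ a
    · rintro υ hυ ⟨i, j, hυI⟩
      have u1 : υ.natVar 1 = 2 ^ L := (hυ.natVar 1 rfl).trans ((hτ.natVar 1 rfl).trans h1)
      simp [hυI.h9, u1, e2, eM]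
    · rintro υ - ⟨i, j, hυI⟩
      have hlow : ∀ i j, j ≤ 2 ^ L → F i j → υ.best ≤ G (V i) (V (j - 1)) := by
        intro i' j' hj' hf
        by_cases hi' : i' < i
        · exact hυI.below i' hi' j' hj' hf
        · exfalso
          have hij := hF _ _ hf
          have := hυI.hi
          have := hυI.hj
          rcases hυI.progress with h | ⟨-, -, h⟩
          · omega
          · exact h (hFm _ _ _ _ (by omega) hj' hf)
      refine ⟨?_, hlow⟩
      rcases hυI.attained with h | h
      -- If the best value is still `⊤`, every feasible window has value `⊤`, and the full window,
      -- which is feasible, attains it.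
      · refine ⟨0, 2 ^ L, by omega, le_rfl, hF1, le_antisymm ?_ ?_⟩
        · exact hlow _ _ le_rfl hF1
        · rw [h]; exact le_top
      · exact h
  · simp only [Finset.sum_add_distrib, Finset.sum_const, Finset.card_range, smul_eq_mul]
    have := sum_range_dvd_pow L
    simp only [Finset.sum_add_distrib, Finset.sum_const, Finset.card_range, smul_eq_mul] at this
    rw [this]
    have h2 : 2 * 2 ^ L ≤ 2 * 2 ^ L * (L + 1) := Nat.le_mul_of_pos_right _ (by omega)
    generalize 2 * 2 ^ L * (L + 1) = Z at *
    generalize (advance c e).bound = B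
    nlinarith

end Sweep

/-! ## Deciding feasibility greedily -/

section Greedy

variable {f : ℕ → ℕ → Prop} {m : ℕ}

/-- The greedy path from the position `(k, l)`, which moves the `B`-frog whenever the position is
valid and the `A`-frog otherwise, succeeds. -/
inductive Greedy (f : ℕ → ℕ → Prop) (m : ℕ) : ℕ → ℕ → Prop
  | last : f m m → Greedy f m m m
  | up_last {k : ℕ} : k < m → Greedy f m (k + 1) m → Greedy f m k m
  | next {k l : ℕ} : l < m → f k l → Greedy f m k (l + 1) → Greedy f m k l
  | up {k l : ℕ} : 0 < l → l < m → ¬ f k l → k < m → Greedy f m (k + 1) l → Greedy f m k l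

theorem greedy_last_iff : Greedy f m m m ↔ f m m := by
  refine ⟨fun h => ?_, .last⟩
  cases h with
  | last h => exact h
  | up_last h _ => exact absurd h (lt_irrefl _)
  | next h _ _ => exact absurd h (lt_irrefl _)
  | up _ h _ _ _ => exact absurd h (lt_irrefl _)

theorem greedy_up_last_iff {k : ℕ} (hk : k < m) : Greedy f m k m ↔ Greedy f m (k + 1) m := by
  refine ⟨fun h => ?_, .up_last hk⟩
  cases h with
  | last h => exact absurd hk (lt_irrefl _)
  | up_last _ h => exact h
  | next h _ _ => exact absurd h (lt_irrefl _)
  | up _ h _ _ _ => exact absurd h (lt_irrefl _)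

theorem greedy_next_iff {k l : ℕ} (hl : l < m) (hf : f k l) :
    Greedy f m k l ↔ Greedy f m k (l + 1) := by
  refine ⟨fun h => ?_, .next hl hf⟩
  cases h with
  | last h => exact absurd hl (lt_irrefl _)
  | up_last _ h => exact absurd hl (lt_irrefl _)
  | next _ _ h => exact h
  | up _ _ h _ _ => exact absurd hf h

theorem greedy_up_iff {k l : ℕ} (hl : l < m) (hf : ¬ f k l) :
    Greedy f m k l ↔ 0 < l ∧ k < m ∧ Greedy f m (k + 1) l := by
  refine ⟨fun h => ?_, fun ⟨h1, h2, h3⟩ => .up h1 hl hf h2 h3⟩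
  cases h with
  | last h => exact absurd hl (lt_irrefl _)
  | up_last _ h => exact absurd hl (lt_irrefl _)
  | next _ h _ => exact absurd h hf
  | up h1 _ _ h2 h3 => exact ⟨h1, h2, h3⟩

theorem Greedy.last_valid {k l : ℕ} (h : Greedy f m k l) : f m m := by
  induction h <;> assumption

theorem Greedy.first_valid (h : Greedy f m 0 0) : f 0 0 := by
  rcases Nat.eq_zero_or_pos m with rfl | hm
  · exact greedy_last_iff.1 h
  · by_contra hf
    exact absurd ((greedy_up_iff hm hf).1 h).1 (lt_irrefl _)

/-- The greedy run is itself a path in the graph, without diagonal moves. It leaves a column before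
the last one only by `next`, hence at a valid position. -/
theorem Greedy.exists_path {k l : ℕ} (h : Greedy f m k l) (hk : k < m + 1) (hl : l < m + 1) :
    ∃ P : List (Fin (m + 1) × Fin (m + 1)), P.IsChain Move ∧
      P.head? = some (⟨k, hk⟩, ⟨l, hl⟩) ∧ P.getLast? = some (Fin.last m, Fin.last m) ∧
      ∀ l' : Fin (m + 1), l ≤ l' → l'.val < m → ∃ k' : Fin (m + 1), (k', l') ∈ P ∧ f k' l' := by
  have cons : ∀ (u v : Fin (m + 1) × Fin (m + 1)) (P : List (Fin (m + 1) × Fin (m + 1))),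
      Move u v → P.IsChain Move → P.head? = some v →
      P.getLast? = some (Fin.last m, Fin.last m) → (u :: P).IsChain Move ∧
      (u :: P).head? = some u ∧ (u :: P).getLast? = some (Fin.last m, Fin.last m) := by
    intro u v P hm hc hh hl
    cases P with
    | nil => simp at hh
    | cons w P =>
      simp only [List.head?_cons, Option.some.injEq] at hh
      subst hh
      exact ⟨List.IsChain.cons_cons hm hc, rfl, by simpa using hl⟩
  induction h with
  | last h =>
    exact ⟨[(⟨m, hk⟩, ⟨m, hl⟩)], List.IsChain.singleton _, rfl, rfl,
      fun l' h1 h2 => absurd h1 (by omega)⟩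
  | @up_last k h _ ih =>
    obtain ⟨P, h1, h2, h3, h4⟩ := ih (by omega) hl
    obtain ⟨c1, c2, c3⟩ := cons (⟨k, hk⟩, ⟨m, hl⟩) (⟨k + 1, by omega⟩, ⟨m, hl⟩) P (Or.inl ⟨rfl, rfl⟩) h1 h2 h3
    exact ⟨_, c1, c2, c3, fun l' h1 h2 => absurd h1 (by omega)⟩
  | @next k l h hf _ ih =>
    obtain ⟨P, h1, h2, h3, h4⟩ := ih hk (by omega)
    obtain ⟨c1, c2, c3⟩ := cons (⟨k, hk⟩, ⟨l, hl⟩) (⟨k, hk⟩, ⟨l + 1, by omega⟩) P (Or.inr (Or.inl ⟨rfl, rfl⟩)) h1 h2 h3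
    refine ⟨_, c1, c2, c3, fun l' h1 h2 => ?_⟩
    rcases h1.eq_or_lt with rfl | hlt
    · exact ⟨⟨k, hk⟩, by simp, hf⟩
    · obtain ⟨k', h5, h6⟩ := h4 l' hlt h2
      exact ⟨k', List.mem_cons_of_mem _ h5, h6⟩
  | @up k l _ _ _ h _ ih =>
    obtain ⟨P, h1, h2, h3, h4⟩ := ih (by omega) hl
    obtain ⟨c1, c2, c3⟩ := cons (⟨k, hk⟩, ⟨l, hl⟩) (⟨k + 1, by omega⟩, ⟨l, hl⟩) P (Or.inl ⟨rfl, rfl⟩) h1 h2 h3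
    refine ⟨_, c1, c2, c3, fun l' h1 h2 => ?_⟩
    obtain ⟨k', h5, h6⟩ := h4 l' h1 h2
    exact ⟨k', List.mem_cons_of_mem _ h5, h6⟩

/-- The greedy path succeeds if there is a monotone choice of valid positions. -/
theorem greedy_of_monotone {κ : ℕ → ℕ} (h0 : κ 0 = 0) (hm : κ m = m) (hle : ∀ l ≤ m, κ l ≤ m)
    (hmono : ∀ l < m, κ l ≤ κ (l + 1)) (hf : ∀ l ≤ m, f (κ l) l) : Greedy f m 0 0 := by
  -- The greedy path never overtakes κ: in column l it stops at κ l at the latest, because that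
  -- position is valid. The induction is on a bound for the number of remaining moves.
  have key : ∀ N k l, (m - l) + (m - k) ≤ N → 0 < l → l ≤ m → k ≤ κ l → Greedy f m k l := by
    intro N
    induction N with
    | zero =>
      intro k l hN hl hlm hk
      have := hle l hlm
      obtain rfl : l = m := by omega
      obtain rfl : k = l := by omega
      exact .last (by simpa [hm] using hf k le_rfl)
    | succ N ih =>
      intro k l hN hl hlm hk
      have hkm := hle l hlm
      rcases hlm.eq_or_lt with rfl | hlm
      · rcases (hk.trans hkm).eq_or_lt with rfl | hkl
        · exact .last (by simpa [hm] using hf k le_rfl)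
        · exact .up_last hkl (ih _ _ (by omega) hl le_rfl (by omega))
      · by_cases hv : f k l
        · exact .next hlm hv (ih _ _ (by omega) (by omega) hlm (hk.trans (hmono l hlm)))
        · have : k ≠ κ l := fun h => hv (h ▸ hf l hlm.le)
          exact .up hl hlm hv (by omega) (ih _ _ (by omega) hl hlm.le (by omega))
  rcases Nat.eq_zero_or_pos m with rfl | hpos
  · exact .last (by simpa [h0] using hf 0 le_rfl)
  · exact .next hpos (by simpa [h0] using hf 0 (Nat.zero_le _))
      (key _ _ _ le_rfl (by omega) hpos (Nat.zero_le _))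

theorem Move.le {u v : Fin (m + 1) × Fin (m + 1)} (h : Move u v) : u ≤ v := by
  rw [Prod.le_def, Fin.le_def, Fin.le_def]
  rcases h with ⟨h1, h2⟩ | ⟨h1, h2⟩ | ⟨h1, h2⟩
  · rw [h2]; omega
  · rw [h1]; omega
  · omega

/-- The positions on a path are totally ordered, so the valid positions that an s-path meets in
successive columns form a monotone choice, which the greedy path can follow. The converse is the
greedy path itself. -/
theorem sReachable_iff_greedy :
    SReachable (fun p : Fin (m + 1) × Fin (m + 1) => f p.1 p.2) (Fin.last m, Fin.last m) ↔
      Greedy f m 0 0 := by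
  constructor
  · rintro ⟨P, hP⟩
    have hcmp : ∀ u ∈ P, ∀ v ∈ P, u ≤ v ∨ v ≤ u := by
      have h1 : P.Pairwise (· ≤ ·) :=
        List.isChain_iff_pairwise.1 (hP.isChain.imp fun _ _ h => h.le)
      have h2 : P.Pairwise (fun u v => u ≤ v ∨ v ≤ u) := h1.imp fun h => Or.inl h
      have : Std.Symm fun u v : Fin (m + 1) × Fin (m + 1) => u ≤ v ∨ v ≤ u :=
        ⟨fun _ _ h => h.symm⟩
      intro u hu v hv
      exact List.Pairwise.forall_of_forall
        (R := fun u v : Fin (m + 1) × Fin (m + 1) => u ≤ v ∨ v ≤ u)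
        (fun x _ => Or.inl le_rfl) h2 hu hv
    -- In the first and last columns the corner positions are chosen; for columns beyond `m` the
    -- value 0 is irrelevant.
    have hex : ∀ l, ∃ k, l ≤ m → f k l ∧ (∃ p ∈ P, p.1.val = k ∧ p.2.val = l) ∧
        (l = 0 → k = 0) ∧ (l = m → k = m) := by
      intro l
      by_cases hlm : l ≤ m
      · rcases Nat.eq_zero_or_pos l with rfl | h0
        · refine ⟨0, fun _ => ⟨by simpa using hP.valid_first, ⟨(0, 0), List.mem_of_mem_head? hP.head,
            rfl, rfl⟩, by simp, by simp⟩⟩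
        · rcases hlm.eq_or_lt with rfl | h1
          · exact ⟨l, fun _ => ⟨by simpa using hP.valid_last,
              ⟨_, List.mem_of_getLast? hP.last, rfl, rfl⟩, by omega, by simp⟩⟩
          · obtain ⟨k, hk, hk'⟩ := hP.valid_between ⟨l, by omega⟩ (by rw [Fin.lt_def]; exact h0)
              (by rw [Fin.lt_def]; exact h1)
            exact ⟨k, fun _ => ⟨hk', ⟨_, hk, rfl, rfl⟩, by omega, by omega⟩⟩
      · exact ⟨0, fun h => absurd h hlm⟩
    choose κ hκ using hex
    refine greedy_of_monotone (κ := κ) ((hκ 0 (Nat.zero_le _)).2.2.1 rfl)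
      ((hκ m le_rfl).2.2.2 rfl) (fun l hl => ?_) (fun l hl => ?_) fun l hl => (hκ l hl).1
    · obtain ⟨p, -, h, -⟩ := (hκ l hl).2.1
      omega
    · obtain ⟨p, hp, p1, p2⟩ := (hκ l hl.le).2.1
      obtain ⟨q, hq, q1, q2⟩ := (hκ (l + 1) hl).2.1
      rw [← p1, ← q1]
      rcases hcmp p hp q hq with h | h
      · exact h.1
      · have := h.2
        rw [Fin.le_def] at this
        omega
  · intro h
    obtain ⟨P, h1, h2, h3, h4⟩ := h.exists_path (by omega) (by omega)
    exact ⟨P, h1, h2, h3, by simpa using h.first_valid, by simpa using h.last_valid,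
      fun l _ hl => h4 l (Nat.zero_le _) (by simpa [Fin.lt_def] using hl)⟩

theorem SReachable.mono {f g : Fin (m + 1) × Fin (m + 1) → Prop}
    {v : Fin (m + 1) × Fin (m + 1)} (h : SReachable f v) (hfg : ∀ p, f p → g p) :
    SReachable g v := by
  obtain ⟨P, h1, h2, h3, h4, h5, h6⟩ := h
  exact ⟨P, h1, h2, h3, hfg _ h4, hfg _ h5, fun l hl hl' =>
    let ⟨k, hk, hk'⟩ := h6 l hl hl'; ⟨k, hk, hfg _ hk'⟩⟩

theorem sReachable_of_forall {f : Fin (m + 1) × Fin (m + 1) → Prop} (h : ∀ p, f p) :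
    SReachable f (Fin.last m, Fin.last m) := by
  refine (sReachable_iff_greedy (f := fun _ _ => True).2 ?_).mono fun p _ => h p
  refine greedy_of_monotone (κ := fun l => if l = m then m else 0) ?_ ?_ ?_ ?_ ?_
  · simp; omega
  · simp
  · intro l _; split_ifs <;> omega
  · intro l hl; split_ifs <;> omega
  · simp

end Greedy

/-! ## Windows of ranks -/

section Windows

variable {m d : ℕ}

/-- The positions whose ranks are in `[i, j)` admit an s-path between the corners. -/
def Feasible (r : Fin (m + 1) × Fin (m + 1) → ℕ) (i j : ℕ) : Prop :=
  SReachable (fun p => i ≤ r p ∧ r p < j) (Fin.last m, Fin.last m)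

/-- Positions with ranks in a window have distances between those at its ends, so feasible windows
give feasible ranges. Conversely, the window spanned by the ranks of the valid positions contains
all of them, and its range lies inside [s, t]. Equal distances do no harm: the first argument needs
only one inclusion, and in the second the spanned window contains all of the valid positions. Ranks
that belong to no position are harmless as well. -/
theorem isSRange_of_windows {A B : Fin (m + 1) → EuclideanSpace ℝ (Fin d)}
    {G : ℝ → ℝ → WithTop ℝ} {r : Fin (m + 1) × Fin (m + 1) → ℕ} {V : ℕ → ℝ} {M : ℕ}
    {δ : WithTop ℝ}
    (hGm : ∀ c a b e : ℝ, 0 ≤ c → c ≤ a → a ≤ b → b ≤ e → G a b ≤ G c e)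
    (hr : ∀ p, r p < M) (hV : ∀ p, V (r p) = dist (A p.1) (B p.2))
    (hVm : ∀ a b, a ≤ b → b < M → V a ≤ V b) (hV0 : ∀ a < M, 0 ≤ V a)
    (hδ : ∃ i j, i < j ∧ j ≤ M ∧ Feasible r i j ∧ δ = G (V i) (V (j - 1)))
    (hδ' : ∀ i j, j ≤ M → Feasible r i j → δ ≤ G (V i) (V (j - 1))) : IsSRange G A B δ := by
  constructor
  · obtain ⟨i, j, hij, hj, hf, he⟩ := hδ
    refine ⟨V i, V (j - 1), hV0 i (by omega), hVm _ _ (by omega) (by omega), ?_, he⟩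
    refine SReachable.mono hf fun p ⟨h1, h2⟩ => ?_
    rw [← hV p]
    exact ⟨hVm _ _ h1 (hr p), hVm _ _ (by omega) (by omega)⟩
  · rintro x ⟨s, t, hs, hst, hf, rfl⟩
    classical
    let S : Finset (Fin (m + 1) × Fin (m + 1)) := Finset.univ.filter fun p =>
      s ≤ dist (A p.1) (B p.2) ∧ dist (A p.1) (B p.2) ≤ t
    have hS : S.Nonempty := by
      obtain ⟨P, hP⟩ := hf
      exact ⟨(0, 0), Finset.mem_filter.2 ⟨Finset.mem_univ _, hP.valid_first⟩⟩
    obtain ⟨p, hp, hpm⟩ := S.exists_min_image r hS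
    obtain ⟨q, hq, hqm⟩ := S.exists_max_image r hS
    have hp' := (Finset.mem_filter.1 hp).2
    have hq' := (Finset.mem_filter.1 hq).2
    have hw : Feasible r (r p) (r q + 1) := by
      refine SReachable.mono hf fun u hu => ?_
      have hu' : u ∈ S := Finset.mem_filter.2 ⟨Finset.mem_univ _, hu⟩
      exact ⟨hpm u hu', Nat.lt_succ_of_le (hqm u hu')⟩
    refine (hδ' _ _ (hr q) hw).trans (hGm _ _ _ _ hs ?_ ?_ ?_)
    · rw [hV]; exact hp'.1
    · exact hVm _ _ (hpm q hq) (hr q)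
    · rw [Nat.succ_sub_one, hV]; exact hq'.2

theorem Feasible.lt {r : Fin (m + 1) × Fin (m + 1) → ℕ} {i j : ℕ} (h : Feasible r i j) :
    i < j := by
  obtain ⟨P, hP⟩ := h
  exact hP.valid_first.1.trans_lt hP.valid_first.2

theorem Feasible.mono {r : Fin (m + 1) × Fin (m + 1) → ℕ} {i j i' j' : ℕ} (hi : i' ≤ i)
    (hj : j ≤ j') (h : Feasible r i j) : Feasible r i' j' :=
  SReachable.mono h fun _ hp => ⟨hi.trans hp.1, hp.2.trans_le hj⟩

theorem feasible_of_forall_lt {r : Fin (m + 1) × Fin (m + 1) → ℕ} {M : ℕ} (h : ∀ p, r p < M) :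
    Feasible r 0 M :=
  sReachable_of_forall fun p => ⟨Nat.zero_le _, h p⟩

end Windows

/-! ## The forest of all positions -/

section Grid

variable {K : Type} {W : ℕ} {ops : K → ℝ → ℝ → ℝ}

theorem mul_add_divMod {l n k : ℕ} (hk : k < n) : (l * n + k) / n = l ∧ (l * n + k) % n = k := by
  rw [Nat.add_comm, Nat.add_mul_mod_self_right, Nat.mod_eq_of_lt hk,
    Nat.add_mul_div_right _ _ (by omega), Nat.div_eq_of_lt hk]
  omega

/-- The position with index `q`; positions are numbered backwards, column by column. -/
def cell (m q : ℕ) : ℕ × ℕ := (m - q % (m + 1), m - q / (m + 1))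

/-- The index of a position. -/
def cellIndex {m : ℕ} (p : Fin (m + 1) × Fin (m + 1)) : ℕ :=
  (m - p.2) * (m + 1) + (m - p.1)

theorem cellIndex_lt {m : ℕ} (p : Fin (m + 1) × Fin (m + 1)) :
    cellIndex p < (m + 1) * (m + 1) := by
  have h : (m - p.2) * (m + 1) ≤ m * (m + 1) := Nat.mul_le_mul_right _ (Nat.sub_le _ _)
  have h' : (m + 1) * (m + 1) = m * (m + 1) + (m + 1) := by ring
  have := Nat.sub_le m p.1.val
  rw [cellIndex, h']; omega

theorem cell_cellIndex {m : ℕ} (p : Fin (m + 1) × Fin (m + 1)) :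
    cell m (cellIndex p) = (p.1.val, p.2.val) := by
  have h1 : (m - p.1.val) < m + 1 := by omega
  have := p.1.is_lt
  have := p.2.is_lt
  rw [cell, cellIndex, (mul_add_divMod h1).1, (mul_add_divMod h1).2]
  simp only [Prod.mk.injEq]
  omega

/-- Successor of node `q + 2` if its position is valid. -/
def gridNext (m q : ℕ) : ℕ :=
  if q / (m + 1) ≤ 0 then if q % (m + 1) ≤ 0 then 1 else q + 1 else q + 1 - m

/-- Successor of node `q + 2` if its position is not valid. -/
def gridUp (m q : ℕ) : ℕ :=
  if q % (m + 1) ≤ 0 then 0 else if m + 1 ≤ q / (m + 1) + 1 then 0 else q + 1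

/-- Backward numbering makes both successors of a node smaller than the node, as the rebuilding of
forests requires. -/
theorem gridNext_lt (m q : ℕ) : gridNext m q < q + 2 := by
  unfold gridNext; split_ifs <;> omega

theorem gridUp_lt (m q : ℕ) : gridUp m q < q + 2 := by
  unfold gridUp; split_ifs <;> omega

/-- Success of the greedy path from a node. -/
def GridVal (f : ℕ → ℕ → Prop) (m p : ℕ) : Prop :=
  p = 1 ∨ 2 ≤ p ∧ Greedy f m (cell m (p - 2)).1 (cell m (p - 2)).2

theorem gridVal_mk {f : ℕ → ℕ → Prop} {m k l : ℕ} (hk : k ≤ m) (p : ℕ)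
    (hp : p = (l * (m + 1) + k) + 2) : GridVal f m p ↔ Greedy f m (m - k) (m - l) := by
  subst hp
  have h1 : k < m + 1 := by omega
  rw [GridVal, Nat.add_sub_cancel, cell, (mul_add_divMod h1).1, (mul_add_divMod h1).2]
  constructor
  · rintro (h | ⟨-, h⟩)
    · omega
    · exact h
  · exact fun h => Or.inr ⟨by omega, h⟩

/-- The four shapes of a greedy move become the two successor functions. In the last column both
outcomes move the A-frog, except at the final corner, where validity decides; in the first column an
invalid position fails outright, unless this column is also the last. -/
theorem gridVal_iff {f : ℕ → ℕ → Prop} [DecidableRel f] {m q : ℕ}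
    (hq : q < (m + 1) * (m + 1)) :
    GridVal f m (q + 2) ↔
      if f (cell m q).1 (cell m q).2 then GridVal f m (gridNext m q)
      else GridVal f m (gridUp m q) := by
  have hk : q % (m + 1) ≤ m := Nat.lt_succ_iff.1 (Nat.mod_lt _ (by omega))
  have hl : q / (m + 1) ≤ m := Nat.lt_succ_iff.1 (Nat.div_lt_of_lt_mul hq)
  have hqe : q = q / (m + 1) * (m + 1) + q % (m + 1) := (Nat.div_add_mod' q (m + 1)).symm
  rw [cell, gridNext, gridUp]
  generalize q % (m + 1) = k at *
  generalize q / (m + 1) = l at *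
  have h0 : ¬ GridVal f m 0 := by simp [GridVal]
  have h1 : GridVal f m 1 := Or.inl rfl
  rw [gridVal_mk (l := l) hk _ (by rw [hqe])]
  have hm1 : 0 < k → (GridVal f m (q + 1) ↔ Greedy f m (m - k + 1) (m - l)) := by
    intro hk0
    rw [gridVal_mk (k := k - 1) (l := l) (by omega) _ (by omega)]
    rw [show m - (k - 1) = m - k + 1 by omega]
  rcases Nat.eq_zero_or_pos l with rfl | hl0
  · rcases Nat.eq_zero_or_pos k with rfl | hk0
    · simp [greedy_last_iff, h0, h1]
    · have : ¬ m + 1 ≤ 0 + 1 := by omega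
      simp only [le_refl, if_true, if_false, this, hk0.not_ge, hm1 hk0, Nat.sub_zero, ite_self]
      rw [greedy_up_last_iff (by omega)]
  · have hlm : m - l < m := by omega
    rw [if_neg hl0.not_ge]
    by_cases hf : f (m - k) (m - l)
    · rw [if_pos hf, greedy_next_iff hlm hf, gridVal_mk (k := k) (l := l - 1) hk]
      · rw [show m - (l - 1) = m - l + 1 by omega]
      · obtain ⟨l', rfl⟩ : ∃ l', l = l' + 1 := ⟨l - 1, by omega⟩
        rw [add_mul, one_mul] at hqe
        rw [Nat.add_sub_cancel]
        omega
    · rw [if_neg hf, greedy_up_iff hlm hf]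
      rcases Nat.eq_zero_or_pos k with rfl | hk0
      · simp [h0]
      · rw [if_neg hk0.not_ge]
        split_ifs with hlm'
        · simp only [h0, iff_false]; omega
        · rw [hm1 hk0]
          constructor
          · exact fun h => h.2.2
          · exact fun h => ⟨by omega, by omega, h⟩

/-- The forest of all positions, given their ranks. -/
theorem level_of_grid {σ : State} {m M : ℕ} {ρ : ℕ → ℕ} (hM : (m + 1) * (m + 1) ≤ M)
    (h3 : ∀ q < (m + 1) * (m + 1), σ.natArr 3 (16 * M + (q + 2)) = ρ q)
    (h4 : ∀ q < (m + 1) * (m + 1), σ.natArr 4 (16 * M + (q + 2)) = gridNext m q)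
    (h5 : ∀ q < (m + 1) * (m + 1), σ.natArr 5 (16 * M + (q + 2)) = gridUp m q)
    (h6 : σ.natArr 6 (2 * M) = (m + 1) * (m + 1) + 1)
    (h7 : σ.natArr 7 (2 * M) = (m + 1) * (m + 1) + 2)
    (hρ : ∀ u < (m + 1) * (m + 1), ∀ v < (m + 1) * (m + 1), ρ u = ρ v → u = v) (r : ℕ) :
    Level σ (2 * M) (Feasible fun p : Fin (m + 1) × Fin (m + 1) => ρ (cellIndex p)) 0 0 r := by
  classical
  have e : ∀ x, 8 * (2 * M) + x = 16 * M + x := by intro x; ring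
  have hsub : ∀ {p}, 2 ≤ p → p < (m + 1) * (m + 1) + 2 →
      ∃ q < (m + 1) * (m + 1), p = q + 2 := fun {p} h1 h2 => ⟨p - 2, by omega, by omega⟩
  refine ⟨by omega, by omega, by omega, ?_, ?_, ?_⟩
  · intro p q hp hp' hq hq' he
    rw [h7] at hp' hq'
    obtain ⟨p, hpN, rfl⟩ := hsub hp hp'
    obtain ⟨q, hqN, rfl⟩ := hsub hq hq'
    rw [e, e, h3 p hpN, h3 q hqN] at he
    rw [hρ p hpN q hqN he]
  · intro p hp hp'
    rw [h7] at hp'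
    obtain ⟨p, hpN, rfl⟩ := hsub hp hp'
    rw [e, h4 p hpN, h5 p hpN]
    exact ⟨gridNext_lt m p, gridUp_lt m p⟩
  · let f : ℕ → ℕ → ℕ → ℕ → Prop := fun i j k l =>
      i ≤ ρ ((m - l) * (m + 1) + (m - k)) ∧ ρ ((m - l) * (m + 1) + (m - k)) < j
    have hcell : ∀ q < (m + 1) * (m + 1),
        (m - (cell m q).2) * (m + 1) + (m - (cell m q).1) = q := by
      intro q hq
      have hk : q % (m + 1) < m + 1 := Nat.mod_lt _ (by omega)
      have hl : q / (m + 1) < m + 1 := Nat.div_lt_of_lt_mul hq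
      rw [cell, Nat.sub_sub_self (Nat.lt_succ_iff.1 hl), Nat.sub_sub_self (Nat.lt_succ_iff.1 hk),
        Nat.div_add_mod']
    refine ⟨fun p i j => GridVal (f i j) m p, fun i j _ _ _ _ => ⟨by simp [GridVal], Or.inl rfl,
      fun p hp hp' => ?_, ?_⟩⟩
    · rw [h7] at hp'
      obtain ⟨q, hqN, rfl⟩ := hsub hp hp'
      dsimp only
      rw [e, h3 q hqN, h4 q hqN, h5 q hqN, gridVal_iff hqN]
      simp only [f, hcell q hqN]
    · dsimp only
      -- In the reversed numbering the start position (0, 0) has the largest index, (m + 1)² - 1,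
      -- hence node number (m + 1)² + 1.
      rw [h6, gridVal_mk (k := m) (l := m) le_rfl ((m + 1) * (m + 1) + 1) (by ring), Nat.sub_self,
        ← sReachable_iff_greedy]
      rfl

end Grid

/-! ## The algorithm -/

section Algorithm

variable {K : Type} {W : ℕ} {ops : K → ℝ → ℝ → ℝ}

/-- Run `P` for the values `0, 1, …` of integer variable `2` below the bound `b`. -/
def forLoop (b : NExp) (P : Cmd K) : Cmd K :=
  .setNat 2 (.lit 0) ;; .loop (.natLt (.var 2) b) (P ;; .setNat 2 (.add (.var 2) (.lit 1)))

/-- The invariant is required in the memory after the increment of the counter, so that bodies need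
not mention it. -/
theorem Run.forLoop {b : NExp} {P : Cmd K} {σ : State} (n c : ℕ) (I : ℕ → State → Prop)
    (hn : n + 1 < W) (hP : P.natVars.contains 2 = false)
    (hb : ∀ τ, (DiscreteFrechet.forLoop b P).Frame σ τ → b.eval W τ = n)
    (h0 : I 0 (σ.putNat 2 0))
    (hstep : ∀ q < n, ∀ τ, (DiscreteFrechet.forLoop b P).Frame σ τ → τ.natVar 2 = q → I q τ →
      Run W ops P c τ fun υ => I (q + 1) (υ.putNat 2 (q + 1))) :
    Run W ops (DiscreteFrechet.forLoop b P) ((n + 1) * (b.cost + c + 12)) σ (I n) := by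
  have e1 : 1 % W = 1 := Nat.mod_eq_of_lt (by omega)
  have hfr : ∀ {τ υ : State}, (Cmd.setNat 2 (.lit 0) : Cmd K).Frame σ τ →
      (P ;; .setNat 2 (.add (.var 2) (.lit 1)) : Cmd K).Frame τ υ →
      (DiscreteFrechet.forLoop b P).Frame σ υ := by
    intro τ υ h h'
    refine (h.mono ?_ ?_ ?_ ?_).trans (h'.mono ?_ ?_ ?_ ?_) <;>
      simp [DiscreteFrechet.forLoop, Cmd.natVars, Cmd.realVars, Cmd.natArrs, Cmd.realArrs]
  refine (Run.seq (N := 2) (N' := (n + 1) * ((BExp.natLt (.var 2) b : BExp K).cost + 1 + (c + 4)))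
    (R := fun τ => τ = σ.putNat 2 0) ⟨_, _, .setNat _ _ _, by simp, by simp⟩ ?_).mono ?_
    fun _ _ h => h
  · rintro τ hτ rfl
    refine (Run.loop_const n _ (fun q υ => υ.natVar 2 = q ∧ I q υ) ⟨by simp, h0⟩ ?_ ?_).mono le_rfl
      fun _ _ h => h.2
    · rintro q hq υ hυ ⟨u2, hI⟩
      refine ⟨by simpa [u2, hb υ (hfr hτ hυ)] using hq, ?_⟩
      refine Run.seq (hstep q hq υ (hfr hτ hυ) u2 hI) ?_
      intro ψ hψ hI'
      have p2 : ψ.natVar 2 = q := (hψ.natVar 2 hP).trans u2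
      have eq : (NExp.add (.var 2) (.lit 1)).eval W ψ = q + 1 := by
        simp only [NExp.eval, p2, e1]
        exact Nat.mod_eq_of_lt (by omega)
      refine ⟨_, _, .setNat _ _ _, by simp, ?_, ?_⟩
      · rw [eq]; simp
      · rw [eq]; exact hI'
    · rintro υ hυ ⟨u2, -⟩
      simp [u2, hb υ (hfr hτ hυ)]
  · simp only [BExp.natLt, BExp.cost, NExp.cost]
    nlinarith

/-- Compute in integer variable `1` the least power of two that is at least `n ^ 2`. -/
def initSize : Cmd K :=
  .setNat 1 (.lit 1) ;;
  .loop (.natLt (.var 1) (.mul (.var 0) (.var 0))) (.setNat 1 (.mul (.lit 2) (.var 1)))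

theorem initSize_spec {σ : State} {n : ℕ} (hn : 1 ≤ n) (hW : 4 * (n * n) < W)
    (h0 : σ.natVar 0 = n) :
    Run W ops (initSize : Cmd K) (20 * (Nat.clog 2 (n * n) + 1)) σ
      (fun τ => τ.natVar 1 = 2 ^ Nat.clog 2 (n * n)) := by
  have hnn : 1 ≤ n * n := Nat.mul_pos hn hn
  have e1 : 1 % W = 1 := Nat.mod_eq_of_lt (by omega)
  have e2 : 2 % W = 2 := Nat.mod_eq_of_lt (by omega)
  have en : (n * n) % W = n * n := Nat.mod_eq_of_lt (by omega)
  refine (Run.seq (N := 2) (R := fun τ => τ.natVar 1 = 1)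
    ⟨_, _, .setNat _ _ _, by simp, by simp [e1]⟩ fun τ hτ t1 =>
      Run.loop_const (Nat.clog 2 (n * n)) 4 (fun r υ => υ.natVar 1 = 2 ^ r) (by simpa using t1)
      ?_ ?_).mono ?_ fun _ _ h => h
  · intro r hr υ hυ u1
    have hlt : 2 ^ r < n * n := (Nat.lt_clog_iff_pow_lt (by norm_num)).1 hr
    have er : (2 * 2 ^ r) % W = 2 * 2 ^ r := Nat.mod_eq_of_lt (by omega)
    refine ⟨by simpa [u1, (hυ.natVar 0 rfl).trans ((hτ.natVar 0 rfl).trans h0), en] using hlt,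
      _, _, .setNat _ _ _, by simp, by simp [u1, e2, er, pow_succ']⟩
  · intro υ hυ u1
    simpa [u1, (hυ.natVar 0 rfl).trans ((hτ.natVar 0 rfl).trans h0), en] using
      Nat.le_pow_clog (by norm_num) (n * n)
  · simp only [BExp.natLt, BExp.cost, NExp.cost]
    omega

/-- The sum of the first `j` squared coordinate differences of the points with the indices in
integer variables `16`, `17`. -/
def sqDist (d : ℕ) : ℕ → RExp K
  | 0 => .lit 0
  | j + 1 => .add (sqDist d j) (.mul
      (.sub (.arr 0 (.add (.mul (.var 16) (.lit d)) (.lit j)))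
        (.arr 1 (.add (.mul (.var 17) (.lit d)) (.lit j))))
      (.sub (.arr 0 (.add (.mul (.var 16) (.lit d)) (.lit j)))
        (.arr 1 (.add (.mul (.var 17) (.lit d)) (.lit j)))))

theorem coords_mul_add {n d : ℕ} (A : Fin n → EuclideanSpace ℝ (Fin d)) (k : Fin n) (j : Fin d) :
    coords A (k * d + j) = A k j := by
  have hd : 0 < d := j.pos
  have h : k * d + j < n * d := by
    have := Nat.mul_le_mul_right d (show k.val + 1 ≤ n from k.is_lt)
    rw [add_mul, one_mul] at this
    have := j.is_lt
    omega
  obtain ⟨h1, h2⟩ := mul_add_divMod (l := k) (n := d) j.is_lt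
  rw [coords, dif_pos h]
  have hk : Fin.divNat ⟨k * d + j, h⟩ = k := Fin.ext h1
  have hj : Fin.modNat ⟨k * d + j, h⟩ = j := Fin.ext h2
  rw [hk, hj]

/-- The dimension is fixed, so the sum over coordinates is unrolled in the program text and costs a
constant. The bound on `W` keeps the literal `d` and the coordinate indices from wrapping around. -/
theorem sqDist_eval {n d : ℕ} {A B : Fin n → EuclideanSpace ℝ (Fin d)} {σ : State} {k l : Fin n}
    (hW : n * d + d < W) (h0 : σ.realArr 0 = coords A) (h1 : σ.realArr 1 = coords B)
    (h16 : σ.natVar 16 = k) (h17 : σ.natVar 17 = l) :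
    Real.sqrt ((sqDist d d : RExp K).eval W ops σ) = dist (A k) (B l) := by
  have key : ∀ j ≤ d, (sqDist d j : RExp K).eval W ops σ =
      ∑ i ∈ Finset.range j, (coords A (k * d + i) - coords B (l * d + i)) ^ 2 := by
    intro j
    induction j with
    | zero => intro _; simp [sqDist]
    | succ j ih =>
      intro hj
      have hb : ∀ p : Fin n, p.val * d ≤ n * d := fun p => Nat.mul_le_mul_right d p.is_lt.le
      have ed : d % W = d := Nat.mod_eq_of_lt (by omega)
      have ej : j % W = j := Nat.mod_eq_of_lt (by omega)
      have e1 : ∀ p : Fin n, (p.val * d) % W = p.val * d := fun p =>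
        Nat.mod_eq_of_lt (by have := hb p; omega)
      have e2 : ∀ p : Fin n, (p.val * d + j) % W = p.val * d + j := fun p =>
        Nat.mod_eq_of_lt (by have := hb p; omega)
      rw [Finset.sum_range_succ, ← ih (by omega), sq]
      simp only [sqDist, RExp.eval, NExp.eval, h16, h17, h0, h1, ed, ej, e1, e2]
  rw [key d le_rfl, EuclideanSpace.dist_eq, ← Fin.sum_univ_eq_sum_range
    (fun i => (coords A (k * d + i) - coords B (l * d + i)) ^ 2)]
  simp only [coords_mul_add, Real.dist_eq, sq_abs]

/-- Compute the distance of the position with index `z` (integer variable `2`). -/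
def distBody (d : ℕ) : Cmd K :=
  .setNat 14 (.div (.var 2) (.var 0)) ;;
  .setNat 15 (.sub (.var 2) (.mul (.var 14) (.var 0))) ;;
  .setNat 16 (.sub (.sub (.var 0) (.lit 1)) (.var 15)) ;;
  .setNat 17 (.sub (.sub (.var 0) (.lit 1)) (.var 14)) ;;
  .setRealArr 2 (.var 2) (.sqrt (sqDist d d))

/-- The distance of the position with index `q`, and `0` for other indices. -/
noncomputable def key {m d : ℕ} (A B : Fin (m + 1) → EuclideanSpace ℝ (Fin d)) (q : ℕ) : ℝ :=
  if q < (m + 1) * (m + 1) then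
    dist (A (Fin.ofNat (m + 1) (cell m q).1)) (B (Fin.ofNat (m + 1) (cell m q).2)) else 0

theorem key_cellIndex {m d : ℕ} (A B : Fin (m + 1) → EuclideanSpace ℝ (Fin d))
    (p : Fin (m + 1) × Fin (m + 1)) : key A B (cellIndex p) = dist (A p.1) (B p.2) := by
  rw [key, if_pos (cellIndex_lt p), cell_cellIndex]
  simp

theorem key_nonneg {m d : ℕ} (A B : Fin (m + 1) → EuclideanSpace ℝ (Fin d)) (q : ℕ) :
    0 ≤ key A B q := by
  rw [key]; split_ifs
  · exact dist_nonneg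
  · exact le_rfl

theorem divMod_eval {m z : ℕ} (hW : (m + 1) * (m + 1) < W)
    (hz : z < (m + 1) * (m + 1)) :
    (z / (m + 1) * (m + 1)) % W = z / (m + 1) * (m + 1) ∧
      z - z / (m + 1) * (m + 1) = z % (m + 1) := by
  have h := Nat.div_add_mod' z (m + 1)
  exact ⟨Nat.mod_eq_of_lt (by omega), by omega⟩

/-- Indices from (m + 1)² on only fill up to a power of two. Their keys are 0 because the array is
initially 0; all that the sweep needs from these keys is that they are nonnegative. -/
theorem initDist_spec {m d : ℕ} {A B : Fin (m + 1) → EuclideanSpace ℝ (Fin d)} {σ : State}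
    (hW : (m + 1) * d + d < W) (hW' : 4 * ((m + 1) * (m + 1)) < W)
    (h0 : σ.natVar 0 = m + 1) (hA : σ.realArr 0 = coords A) (hB : σ.realArr 1 = coords B)
    (h2 : ∀ z, σ.realArr 2 z = 0) :
    Run W ops (forLoop (.mul (.var 0) (.var 0)) (distBody d) : Cmd K)
      (((m + 1) * (m + 1) + 1) * (3 + (distBody d : Cmd K).bound + 12)) σ
      (fun τ => τ.realArr 2 = key A B) := by
  have hN : 1 ≤ (m + 1) * (m + 1) := Nat.mul_pos (by omega) (by omega)
  have e1 : 1 % W = 1 := Nat.mod_eq_of_lt (by omega)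
  refine (Run.forLoop ((m + 1) * (m + 1)) _ (fun q τ => ∀ z, τ.realArr 2 z =
    if z < q then key A B z else 0) (by omega) rfl ?_ ?_ ?_).mono le_rfl ?_
  · intro τ hτ
    simp only [NExp.eval, hτ.natVar 0 rfl, h0]
    exact Nat.mod_eq_of_lt (by omega)
  · simpa using h2
  · intro q hq τ hτ t2 hI
    have t0 : τ.natVar 0 = m + 1 := (hτ.natVar 0 rfl).trans h0
    obtain ⟨ed, em⟩ := divMod_eval (W := W) (by omega) hq
    apply Run.of_loopFree rfl
    simp only [distBody, Cmd.run, State.realArr_putNat, State.realArr_putRealArr, NExp.eval,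
      State.natVar_putNat, t0, t2, ed, em, e1, RExp.eval, if_true, if_false, Nat.reduceEqDiff,
      true_and, Nat.add_sub_cancel]
    intro z
    rw [sqDist_eval (A := A) (B := B) (k := Fin.ofNat (m + 1) (cell m q).1)
      (l := Fin.ofNat (m + 1) (cell m q).2)
      (σ := (((τ.putNat 14 (q / (m + 1))).putNat 15 (q % (m + 1))).putNat 16
        (m - q % (m + 1))).putNat 17 (m - q / (m + 1))) hW ((hτ.realArr 0 rfl).trans hA)
      ((hτ.realArr 1 rfl).trans hB)
      (by simp [cell, Fin.ofNat, Nat.mod_eq_of_lt, Nat.lt_succ_of_le (Nat.sub_le _ _)])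
      (by simp [cell, Fin.ofNat, Nat.mod_eq_of_lt, Nat.lt_succ_of_le (Nat.sub_le _ _)])]
    by_cases hz : z = q
    · rw [if_pos hz, if_pos (by omega), hz, key, if_pos hq]
    · rw [if_neg hz, hI z]
      by_cases hz' : z < q
      · rw [if_pos hz', if_pos (by omega)]
      · rw [if_neg hz', if_neg (by omega)]
  · intro τ _ h
    funext z
    rw [h z, key]
    split_ifs <;> rfl

/-- Fill array `0` with the identity. -/
def initPerm : Cmd K := forLoop (.var 1) (.setNatArr 0 (.var 2) (.var 2))

theorem initPerm_spec {M : ℕ} {σ : State} (hW : M + 1 < W) (h1 : σ.natVar 1 = M) :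
    Run W ops (initPerm : Cmd K) ((M + 1) * 20) σ (fun τ => IsPerm M (τ.natArr 0)) := by
  refine (Run.forLoop M 3 (fun q τ => ∀ z < q, τ.natArr 0 z = z) hW rfl ?_ ?_ ?_).mono
    (by simp) ?_
  · exact fun τ hτ => (hτ.natVar 1 rfl).trans h1
  · simp
  · intro q hq τ hτ t2 hI
    refine ⟨_, _, .setNatArr _ _ _ _, by simp, fun z hz => ?_⟩
    simp only [NExp.eval, t2, State.natArr_putNat, State.natArr_putNatArr, true_and]
    split_ifs with h
    · exact h.symm
    · exact hI z (by omega)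
  · intro τ _ h
    exact ⟨fun u hu => by rw [h u hu]; exact hu, fun u hu v hv e => by
      rwa [h u hu, h v hv] at e⟩

/-- Invert the permutation in array `0`. -/
def initRank : Cmd K := forLoop (.var 1) (.setNatArr 2 (.arr 0 (.var 2)) (.var 2))

theorem initRank_spec {M : ℕ} {P : ℕ → ℕ} {σ : State} (hW : M + 1 < W) (h1 : σ.natVar 1 = M)
    (hP : IsPerm M P) (hPσ : σ.natArr 0 = P) :
    Run W ops (initRank : Cmd K) ((M + 1) * 20) σ
      (fun τ => ∀ z < M, τ.natArr 2 (P z) = z) := by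
  refine (Run.forLoop M 4 (fun q τ => ∀ z < q, τ.natArr 2 (P z) = z) hW rfl ?_ ?_ ?_).mono
    (by simp) fun _ _ h => h
  · exact fun τ hτ => (hτ.natVar 1 rfl).trans h1
  · simp
  · intro q hq τ hτ t2 hI
    refine ⟨_, _, .setNatArr _ _ _ _, by simp, fun z hz => ?_⟩
    simp only [NExp.eval, t2, State.natArr_putNat, State.natArr_putNatArr, true_and,
      (hτ.natArr 0 rfl).trans hPσ]
    split_ifs with h
    -- By injectivity the entry just written cannot overwrite an earlier one.
    · exact hP.inj q hq z (by omega) h.symm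
    · refine hI z (lt_of_le_of_ne (by omega) fun e => h (by rw [e]))

theorem IsPerm.exists_eq {M : ℕ} {P : ℕ → ℕ} (hP : IsPerm M P) {q : ℕ} (hq : q < M) :
    ∃ z < M, P z = q := by
  have := Finset.surj_on_of_inj_on_of_card_le (s := Finset.range M) (t := Finset.range M)
    (fun z _ => P z) (fun z hz => Finset.mem_range.2 (hP.lt z (Finset.mem_range.1 hz)))
    (fun u v hu hv e => hP.inj u (Finset.mem_range.1 hu) v (Finset.mem_range.1 hv) e) le_rfl q
    (Finset.mem_range.2 hq)
  obtain ⟨z, hz, e⟩ := this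
  exact ⟨z, Finset.mem_range.1 hz, e.symm⟩

/-- Write the node of the position with index `z` (integer variable `2`). -/
def topBody : Cmd K :=
  .setNat 14 (.div (.var 2) (.var 0)) ;;
  .setNat 15 (.sub (.var 2) (.mul (.var 14) (.var 0))) ;;
  .setNat 18 (.add (.mul (.lit 16) (.var 1)) (.add (.var 2) (.lit 2))) ;;
  .setNatArr 3 (.var 18) (.arr 2 (.var 2)) ;;
  .ite (.natLe (.var 14) (.lit 0))
    (.ite (.natLe (.var 15) (.lit 0)) (.setNatArr 4 (.var 18) (.lit 1))
      (.setNatArr 4 (.var 18) (.add (.var 2) (.lit 1))))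
    (.setNatArr 4 (.var 18) (.sub (.add (.var 2) (.lit 1)) (.sub (.var 0) (.lit 1)))) ;;
  .ite (.natLe (.var 15) (.lit 0)) (.setNatArr 5 (.var 18) (.lit 0))
    (.ite (.natLe (.var 0) (.add (.var 14) (.lit 1))) (.setNatArr 5 (.var 18) (.lit 0))
      (.setNatArr 5 (.var 18) (.add (.var 2) (.lit 1))))

theorem topBody_spec {m M q : ℕ} {τ : State} (hW : 40 * M < W)
    (hM : (m + 1) * (m + 1) ≤ M) (hq : q < (m + 1) * (m + 1))
    (h0 : τ.natVar 0 = m + 1) (h1 : τ.natVar 1 = M) (h2 : τ.natVar 2 = q) :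
    Run W ops (topBody : Cmd K) 100 τ (fun υ => ∀ x,
      υ.natArr 3 x = (if x = 16 * M + (q + 2) then τ.natArr 2 q else τ.natArr 3 x) ∧
      υ.natArr 4 x = (if x = 16 * M + (q + 2) then gridNext m q else τ.natArr 4 x) ∧
      υ.natArr 5 x = (if x = 16 * M + (q + 2) then gridUp m q else τ.natArr 5 x)) := by
  have hmN : m + 1 ≤ (m + 1) * (m + 1) := Nat.le_mul_of_pos_left _ (by omega)
  obtain ⟨ed, em⟩ := divMod_eval (W := W) (by omega) hq
  have hqm : q / (m + 1) ≤ q := Nat.div_le_self _ _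
  have e1 : 1 % W = 1 := Nat.mod_eq_of_lt (by omega)
  have e2 : 2 % W = 2 := Nat.mod_eq_of_lt (by omega)
  have e16 : 16 % W = 16 := Nat.mod_eq_of_lt (by omega)
  have eM : (16 * M) % W = 16 * M := Nat.mod_eq_of_lt (by omega)
  have eq1 : (q + 1) % W = q + 1 := Nat.mod_eq_of_lt (by omega)
  have eq2 : (q + 2) % W = q + 2 := Nat.mod_eq_of_lt (by omega)
  have eq3 : (q / (m + 1) + 1) % W = q / (m + 1) + 1 := Nat.mod_eq_of_lt (by omega)
  have ep : (16 * M + (q + 2)) % W = 16 * M + (q + 2) := Nat.mod_eq_of_lt (by omega)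
  refine (Run.of_loopFree rfl ?_).mono (by simp [topBody]) fun _ _ h => h
  intro x
  have hrun : ∃ υ : State, υ = (.setNatArr 3 (.var 18) (.arr 2 (.var 2)) : Cmd K).run W ops
    ((.setNat 18 (.add (.mul (.lit 16) (.var 1)) (.add (.var 2) (.lit 2))) : Cmd K).run W ops
    ((.setNat 15 (.sub (.var 2) (.mul (.var 14) (.var 0))) : Cmd K).run W ops
    ((.setNat 14 (.div (.var 2) (.var 0)) : Cmd K).run W ops τ))) := ⟨_, rfl⟩
  obtain ⟨υ, hυ⟩ := hrun
  rw [topBody, Cmd.run_seq, Cmd.run_seq, Cmd.run_seq, Cmd.run_seq, Cmd.run_seq, ← hυ]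
  have u0 : υ.natVar 0 = m + 1 := by simp [hυ, h0]
  have u2 : υ.natVar 2 = q := by simp [hυ, h2]
  have u14 : υ.natVar 14 = q / (m + 1) := by simp [hυ, h2, h0]
  have u15 : υ.natVar 15 = q % (m + 1) := by simp [hυ, h2, h0, ed, em]
  have u18 : υ.natVar 18 = 16 * M + (q + 2) := by simp [hυ, h2, h1, e16, eM, e2, eq2, ep]
  have u3 : ∀ x, υ.natArr 3 x = if x = 16 * M + (q + 2) then τ.natArr 2 q else τ.natArr 3 x := by
    intro x; simp [hυ, h2, h1, e16, eM, e2, eq2, ep]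
  have u4 : υ.natArr 4 = τ.natArr 4 := by
    funext x; simp [hυ]
  have u5 : υ.natArr 5 = τ.natArr 5 := by
    funext x; simp [hυ]
  clear hυ
  simp only [gridNext, gridUp, Cmd.run, BExp.holds, NExp.eval, u14, u15, Nat.zero_mod]
  by_cases c1 : q / (m + 1) ≤ 0 <;> by_cases c2 : q % (m + 1) ≤ 0 <;>
    by_cases c3 : m + 1 ≤ q / (m + 1) + 1 <;>
    simp [c1, c2, c3, u0, u2, u3, u4, u5, u14, u15, u18, e1, eq1, eq3]

/-- Build the forest of all positions. -/
def initTop : Cmd K :=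
  forLoop (.mul (.var 0) (.var 0)) topBody ;;
  .setNatArr 6 (.mul (.lit 2) (.var 1)) (.add (.mul (.var 0) (.var 0)) (.lit 1)) ;;
  .setNatArr 7 (.mul (.lit 2) (.var 1)) (.add (.mul (.var 0) (.var 0)) (.lit 2))

theorem initTop_spec {m M : ℕ} {ρ : ℕ → ℕ} {σ : State} (hW : 40 * M < W)
    (hM : (m + 1) * (m + 1) ≤ M) (h0 : σ.natVar 0 = m + 1) (h1 : σ.natVar 1 = M)
    (h2 : σ.natArr 2 = ρ)
    (hρ : ∀ u < (m + 1) * (m + 1), ∀ v < (m + 1) * (m + 1), ρ u = ρ v → u = v) (r : ℕ) :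
    Run W ops (initTop : Cmd K) ((M + 1) * 120 + 20) σ (fun τ =>
      Level τ (2 * M) (Feasible fun p : Fin (m + 1) × Fin (m + 1) => ρ (cellIndex p)) 0 0 r) := by
  have hN : 1 ≤ (m + 1) * (m + 1) := Nat.mul_pos (by omega) (by omega)
  have e1 : 1 % W = 1 := Nat.mod_eq_of_lt (by omega)
  have e2 : 2 % W = 2 := Nat.mod_eq_of_lt (by omega)
  have eM : (2 * M) % W = 2 * M := Nat.mod_eq_of_lt (by omega)
  have eN : ((m + 1) * (m + 1)) % W = (m + 1) * (m + 1) := Nat.mod_eq_of_lt (by omega)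
  have eN1 : ((m + 1) * (m + 1) + 1) % W = (m + 1) * (m + 1) + 1 := Nat.mod_eq_of_lt (by omega)
  have eN2 : ((m + 1) * (m + 1) + 2) % W = (m + 1) * (m + 1) + 2 := Nat.mod_eq_of_lt (by omega)
  refine (Run.seq (N' := 20) (Run.forLoop ((m + 1) * (m + 1)) 100 (fun q τ => ∀ z < q,
    τ.natArr 3 (16 * M + (z + 2)) = ρ z ∧ τ.natArr 4 (16 * M + (z + 2)) = gridNext m z ∧
    τ.natArr 5 (16 * M + (z + 2)) = gridUp m z) (by omega) rfl ?_ ?_ ?_) ?_).mono ?_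
    fun _ _ h => h
  · intro τ hτ
    simp only [NExp.eval, hτ.natVar 0 rfl, h0, eN]
  · simp
  · intro q hq τ hτ t2 hI
    refine (topBody_spec hW hM hq ((hτ.natVar 0 rfl).trans h0) ((hτ.natVar 1 rfl).trans h1)
      t2).mono le_rfl ?_
    intro υ hυ h z hz
    obtain ⟨g3, g4, g5⟩ := h (16 * M + (z + 2))
    simp only [State.natArr_putNat]
    rw [g3, g4, g5]
    by_cases hzq : z = q
    · subst hzq
      simp [(hτ.natArr 2 rfl).trans h2]
    · rw [if_neg (by omega), if_neg (by omega), if_neg (by omega)]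
      exact hI z (by omega)
  · intro τ hτ hI
    have t0 := (hτ.natVar 0 rfl).trans h0
    have t1 := (hτ.natVar 1 rfl).trans h1
    refine (Run.of_loopFree rfl ?_).mono (by simp) fun _ _ h => h
    apply level_of_grid hM (ρ := ρ) ?_ ?_ ?_ ?_ ?_ hρ
    · intro q hq; simpa using (hI q hq).1
    · intro q hq; simpa using (hI q hq).2.1
    · intro q hq; simpa using (hI q hq).2.2
    · simp [t0, t1, e2, e1, eM, eN, eN1]
    · simp [t0, t1, e2, eM, eN, eN2]
  · simp only [NExp.cost]
    have := Nat.mul_le_mul_right 115 (show (m + 1) * (m + 1) + 1 ≤ M + 1 by omega)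
    omega

/-- The algorithm for points in dimension `d`, where `c` and `e` compute the value of a range. -/
def solve (d : ℕ) (c : BExp K) (e : RExp K) : Cmd K :=
  initSize ;; forLoop (.mul (.var 0) (.var 0)) (distBody d) ;; initPerm ;; mergeSort ;;
  initRank ;; initTop ;; sweep c e ;; .setNat 0 (.var 10)

/-- The factor in the bound for the number of steps of `solve`. -/
def solveFactor (d : ℕ) (c : BExp K) (e : RExp K) : ℕ :=
  10000 + 2 * (distBody d : Cmd K).bound + 2 * (advance c e).bound

/-- The number of steps of `solve` is proportional to this function of the number of points. -/
def solveSteps (n : ℕ) : ℕ := 2 ^ Nat.clog 2 (n * n) * (Nat.clog 2 (n * n) + 1)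

/-- Sorting gives a permutation `P` and its inverse `ρ`; the rank of a position is `ρ` of its index,
and `V` is the key composed with `P`. So `V` is monotone, and at the rank of a position it is the
distance there, which links the sweep over ranks to ranges of distances. -/
theorem solve_spec {m d : ℕ} {A B : Fin (m + 1) → EuclideanSpace ℝ (Fin d)}
    {G : ℝ → ℝ → WithTop ℝ} {c : BExp K} {e : RExp K} (hG : Computes W ops c e G)
    (hGm : ∀ c a b e : ℝ, 0 ≤ c → c ≤ a → a ≤ b → b ≤ e → G a b ≤ G c e)
    (hW : (m + 1) * d + d < W) (hW' : 100 * 2 ^ Nat.clog 2 ((m + 1) * (m + 1)) < W) :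
    Run W ops (solve d c e) (solveFactor d c e * solveSteps (m + 1)) (inputState A B)
      (fun τ => IsSRange G A B τ.output) := by
  have hN : 1 ≤ (m + 1) * (m + 1) := Nat.mul_pos (by omega) (by omega)
  have hM : (m + 1) * (m + 1) ≤ 2 ^ Nat.clog 2 ((m + 1) * (m + 1)) :=
    Nat.le_pow_clog (by norm_num) _
  have hZ : solveSteps (m + 1) = 2 ^ Nat.clog 2 ((m + 1) * (m + 1)) *
    (Nat.clog 2 ((m + 1) * (m + 1)) + 1) := rfl
  rw [hZ]
  obtain ⟨L, hL⟩ : ∃ L, Nat.clog 2 ((m + 1) * (m + 1)) = L := ⟨_, rfl⟩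
  rw [hL] at hM hW' ⊢
  have hrun : Run W ops (solve d c e) (20 * (L + 1) +
      (((m + 1) * (m + 1) + 1) * (3 + (distBody d : Cmd K).bound + 12) +
      ((2 ^ L + 1) * 20 + (600 * (2 ^ L * (L + 1)) + ((2 ^ L + 1) * 20 +
      (((2 ^ L + 1) * 120 + 20) + ((2000 + (advance c e).bound) * (2 * 2 ^ L * (L + 1)) + 2)))))))
      (inputState A B) (fun τ => IsSRange G A B τ.output) := by
    have hsize := initSize_spec (ops := ops) (W := W) (σ := inputState A B) (n := m + 1)
      (by omega) (by omega) rfl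
    rw [hL] at hsize
    refine Run.seq hsize fun σ₁ f₁ v1 => ?_
    have v0 : σ₁.natVar 0 = m + 1 := f₁.natVar 0 rfl
    refine Run.seq (initDist_spec (A := A) (B := B) hW (by omega) v0 (f₁.realArr 0 rfl)
      (f₁.realArr 1 rfl) fun z => by rw [f₁.realArr 2 rfl]; rfl) fun σ₂ f₂ r2 => ?_
    have v0 := (f₂.natVar 0 rfl).trans v0
    have v1 := (f₂.natVar 1 rfl).trans v1
    refine Run.seq (initPerm_spec (by omega) v1) fun σ₃ f₃ hP => ?_
    have v0 := (f₃.natVar 0 rfl).trans v0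
    have v1 := (f₃.natVar 1 rfl).trans v1
    have r2 := (f₃.realArr 2 rfl).trans r2
    refine Run.seq (mergeSort_spec (by omega) hP v1 r2) fun σ₄ f₄ ⟨hP, hs⟩ => ?_
    have v0 := (f₄.natVar 0 rfl).trans v0
    have v1 := (f₄.natVar 1 rfl).trans v1
    have r2 := (f₄.realArr 2 rfl).trans r2
    obtain ⟨P, hPσ⟩ : ∃ P, σ₄.natArr 0 = P := ⟨_, rfl⟩
    rw [hPσ] at hP hs
    refine Run.seq (initRank_spec (by omega) v1 hP hPσ) fun σ₅ f₅ hr => ?_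
    have v0 := (f₅.natVar 0 rfl).trans v0
    have v1 := (f₅.natVar 1 rfl).trans v1
    have r2 := (f₅.realArr 2 rfl).trans r2
    have hPσ := (f₅.natArr 0 rfl).trans hPσ
    obtain ⟨ρ, hρσ⟩ : ∃ ρ, σ₅.natArr 2 = ρ := ⟨_, rfl⟩
    rw [hρσ] at hr
    have hPρ : ∀ u < 2 ^ L, P (ρ u) = u := by
      intro u hu
      obtain ⟨z, hz, rfl⟩ := hP.exists_eq hu
      rw [hr z hz]
    have hρlt : ∀ u < 2 ^ L, ρ u < 2 ^ L := by
      intro u hu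
      obtain ⟨z, hz, rfl⟩ := hP.exists_eq hu
      rwa [hr z hz]
    refine Run.seq (initTop_spec (by omega) hM v0 v1 hρσ (fun u hu v hv e => by
      rw [← hPρ u (by omega), e, hPρ v (by omega)]) (2 * 2 ^ L)) fun σ₆ f₆ hl => ?_
    have v1 := (f₆.natVar 1 rfl).trans v1
    have r2 := (f₆.realArr 2 rfl).trans r2
    have hPσ := (f₆.natArr 0 rfl).trans hPσ
    have hlt : ∀ p : Fin (m + 1) × Fin (m + 1), ρ (cellIndex p) < 2 ^ L := fun p =>
      hρlt _ ((cellIndex_lt p).trans_le hM)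
    have hV : ∀ a b, a ≤ b → b < 2 ^ L → key A B (P a) ≤ key A B (P b) :=
      fun a b => hs a b (Nat.zero_le _)
    refine Run.seq (sweep_spec (V := fun a => key A B (P a)) hG hGm (fun _ _ h => h.lt)
      (fun _ _ _ _ hi hj h => h.mono hi hj) (feasible_of_forall_lt hlt) hV
      (fun a _ => key_nonneg A B _) hW' v1 hl (fun a => by rw [r2, hPσ])) fun σ₇ f₇ ⟨h₁, h₂⟩ => ?_
    refine ⟨_, _, .setNat _ _ _, by simp, ?_⟩
    refine isSRange_of_windows hGm hlt (V := fun a => key A B (P a)) (fun p => ?_) hV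
      (fun a _ => key_nonneg A B _) ?_ ?_
    · rw [hPρ _ ((cellIndex_lt p).trans_le hM), key_cellIndex]
    · simpa [State.output, State.best] using h₁
    · simpa [State.output, State.best] using h₂
  refine hrun.mono ?_ fun _ _ h => h
  rw [solveFactor]
  have h1 : 2 ^ L ≤ 2 ^ L * (L + 1) := Nat.le_mul_of_pos_right _ (by omega)
  have h2 : L + 1 ≤ 2 ^ L * (L + 1) := Nat.le_mul_of_pos_left _ (by positivity)
  have h3 : 2 * 2 ^ L * (L + 1) = 2 * (2 ^ L * (L + 1)) := by ring
  rw [h3]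
  generalize 2 ^ L * (L + 1) = Z at *
  generalize (advance c e).bound = X
  generalize (distBody d : Cmd K).bound = Y
  have h4 : ((m + 1) * (m + 1) + 1) * (3 + Y + 12) ≤ (2 * Z) * (3 + Y + 12) :=
    Nat.mul_le_mul_right _ (by omega)
  nlinarith

end Algorithm

/-! ### Asymptotics, word size and the main theorem -/

theorem two_pow_clog_le {n : ℕ} (hn : 1 ≤ n) : 2 ^ Nat.clog 2 n ≤ 2 * n := by
  rcases hn.eq_or_lt with rfl | hn
  · simp
  · have h := Nat.pow_pred_clog_lt_self (b := 2) (by norm_num) hn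
    have h0 := Nat.clog_pos (b := 2) (by norm_num) hn
    obtain ⟨c, hc⟩ : ∃ c, Nat.clog 2 n = c + 1 := ⟨Nat.clog 2 n - 1, by omega⟩
    rw [hc, Nat.pred_eq_sub_one, Nat.add_sub_cancel] at h
    rw [hc, pow_succ]
    omega

/-- The power of two is below 2n² and its exponent is O(log n). The second logarithm in the bound is
slack. -/
theorem solveSteps_le {n : ℕ} (hn : 3 ≤ n) :
    (solveSteps n : ℝ) ≤ 12 * ((n : ℝ) ^ 2 * Real.log n ^ 2) := by
  have hnn : 1 < n * n := by nlinarith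
  have hn0 : (0 : ℝ) < n := by exact_mod_cast (by omega : 0 < n)
  -- This is where n ≥ 3 > e is used; it absorbs additive constants into log n and log n into its
  -- square.
  have hlog : 1 ≤ Real.log n := by
    rw [Real.le_log_iff_exp_le hn0]
    exact Real.exp_one_lt_three.le.trans (by exact_mod_cast hn)
  obtain ⟨c, hc⟩ : ∃ c, Nat.clog 2 (n * n) = c + 1 :=
    ⟨Nat.clog 2 (n * n) - 1, by have := Nat.clog_pos (b := 2) (by norm_num) hnn; omega⟩
  have h := Nat.pow_pred_clog_lt_self (b := 2) (by norm_num) hnn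
  rw [hc, Nat.pred_eq_sub_one, Nat.add_sub_cancel] at h
  have h1 : (2 : ℝ) ^ c ≤ (n : ℝ) ^ 2 := by
    rw [sq]; exact_mod_cast h.le
  have h2 : (c : ℝ) * Real.log 2 ≤ 2 * Real.log n := by
    have := Real.log_le_log (by positivity) h1
    rwa [Real.log_pow, Real.log_pow, Nat.cast_ofNat] at this
  have h3 : (c : ℝ) ≤ 4 * Real.log n := by
    have := Real.log_two_gt_d9
    have hc0 : (0 : ℝ) ≤ c := Nat.cast_nonneg c
    nlinarith
  rw [solveSteps, hc]
  push_cast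
  calc (2 : ℝ) ^ (c + 1) * (c + 1 + 1) ≤ (2 * (n : ℝ) ^ 2) * (6 * Real.log n ^ 2) := by
        apply mul_le_mul
        · rw [pow_succ]; linarith
        · nlinarith
        · positivity
        · positivity
    _ = _ := by ring

theorem isBigO_solveSteps (C : ℕ) :
    (fun n : ℕ => ((C * solveSteps n : ℕ) : ℝ)) =O[atTop]
      (fun n : ℕ => (n : ℝ) ^ 2 * Real.log n ^ 2) := by
  refine IsBigO.of_bound (C * 12) ((eventually_ge_atTop 3).mono fun n hn => ?_)
  have h := solveSteps_le hn
  rw [Real.norm_of_nonneg (Nat.cast_nonneg _), Real.norm_of_nonneg (by positivity)]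
  push_cast
  have := mul_le_mul_of_nonneg_left h (Nat.cast_nonneg C : (0 : ℝ) ≤ C)
  linarith

/-- In the word bound (n + 2)^(d + 20) the factor (n + 2)^d exceeds the literal d. Of the other
twenty factors, two cover n² and eighteen, each at least 3, cover the constant in the array sizes.
-/
theorem solve_computesWithin {K : Type} {ops : K → ℝ → ℝ → ℝ} {m d : ℕ}
    (A B : Fin (m + 1) → EuclideanSpace ℝ (Fin d)) {G : ℝ → ℝ → WithTop ℝ} {c : BExp K}
    {e : RExp K} (hG : ∀ W, Computes W ops c e G)
    (hGm : ∀ c a b e : ℝ, 0 ≤ c → c ≤ a → a ≤ b → b ≤ e → G a b ≤ G c e) :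
    ComputesWithin ops (solve d c e) (d + 20) (solveFactor d c e * solveSteps (m + 1)) A B
      (fun δ => IsSRange G A B δ) := by
  refine solve_spec (hG _) hGm ?_ ?_
  · have h1 : d < (m + 1 + 2) ^ d := Nat.lt_pow_self (by omega)
    have h2 : 1 ≤ (m + 1 + 2) ^ 19 := Nat.one_le_pow _ _ (by omega)
    calc (m + 1) * d + d = (m + 2) * d := by ring
      _ ≤ (m + 2) * (m + 1 + 2) ^ d := Nat.mul_le_mul_left _ h1.le
      _ < (m + 1 + 2) * (m + 1 + 2) ^ d := Nat.mul_lt_mul_of_pos_right (by omega) (by omega)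
      _ ≤ (m + 1 + 2) * (m + 1 + 2) ^ d * (m + 1 + 2) ^ 19 := Nat.le_mul_of_pos_right _ h2
      _ = _ := by ring
  · have h1 : 3 ^ 18 ≤ (m + 1 + 2) ^ 18 := Nat.pow_le_pow_left (by omega) 18
    have h2 : 1 ≤ (m + 1 + 2) ^ d := Nat.one_le_pow _ _ (by omega)
    have h3 := two_pow_clog_le (n := (m + 1) * (m + 1)) (Nat.mul_pos (by omega) (by omega))
    calc 100 * 2 ^ Nat.clog 2 ((m + 1) * (m + 1)) ≤ 200 * ((m + 1) * (m + 1)) := by omega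
      _ < 3 ^ 18 * ((m + 1 + 2) ^ 2) := by nlinarith
      _ ≤ (m + 1 + 2) ^ 18 * ((m + 1 + 2) ^ 2) := Nat.mul_le_mul_right _ h1
      _ ≤ (m + 1 + 2) ^ 18 * ((m + 1 + 2) ^ 2) * (m + 1 + 2) ^ d := Nat.le_mul_of_pos_right _ h2
      _ = _ := by ring

/-- A test that fails. -/
def BExp.never {K : Type} : BExp K := .not (.natLe (.lit 0) (.lit 0))

theorem BExp.not_holds_never {K : Type} {W : ℕ} {ops : K → ℝ → ℝ → ℝ} {σ : State} :
    ¬ (BExp.never : BExp K).holds W ops σ := fun h => h le_rfl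

/-- The test that real variable `1` is zero. -/
def BExp.isZero {K : Type} : BExp K := .and (.realLe (.var 1) (.lit 0)) (.realLe (.lit 0) (.var 1))

theorem BExp.holds_isZero {K : Type} {W : ℕ} {ops : K → ℝ → ℝ → ℝ} {σ : State} :
    (BExp.isZero : BExp K).holds W ops σ ↔ σ.realVar 1 = 0 := by
  simp only [BExp.isZero, BExp.holds, RExp.eval, Nat.cast_zero]
  exact le_antisymm_iff.symm

end DiscreteFrechet

theorem mainTheorem1 (d : ℕ) :
    -- the gap
    (∃ (P : DiscreteFrechet.Cmd Empty) (k : ℕ) (T : ℕ → ℕ),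
      (fun n : ℕ => (T n : ℝ)) =O[atTop] (fun n : ℕ => (n : ℝ) ^ 2 * Real.log n ^ 2) ∧
      ∀ (m : ℕ) (A B : Fin (m + 1) → EuclideanSpace ℝ (Fin d)),
        DiscreteFrechet.ComputesWithin (fun z : Empty => z.elim) P k (T (m + 1)) A B
          (fun δ => DiscreteFrechet.IsSGap A B δ)) ∧
    -- the ratio
    (∃ (P : DiscreteFrechet.Cmd Empty) (k : ℕ) (T : ℕ → ℕ),
      (fun n : ℕ => (T n : ℝ)) =O[atTop] (fun n : ℕ => (n : ℝ) ^ 2 * Real.log n ^ 2) ∧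
      ∀ (m : ℕ) (A B : Fin (m + 1) → EuclideanSpace ℝ (Fin d)),
        DiscreteFrechet.ComputesWithin (fun z : Empty => z.elim) P k (T (m + 1)) A B
          (fun δ => DiscreteFrechet.IsSRatio A B δ)) ∧
    -- any monotone function `g`, available to the machine as an operation
    (∃ (P : DiscreteFrechet.Cmd Unit) (k : ℕ) (T : ℕ → ℕ),
      (fun n : ℕ => (T n : ℝ)) =O[atTop] (fun n : ℕ => (n : ℝ) ^ 2 * Real.log n ^ 2) ∧
      ∀ g : ℝ → ℝ → ℝ, DiscreteFrechet.IsRangeMonotone g →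
      ∀ (m : ℕ) (A B : Fin (m + 1) → EuclideanSpace ℝ (Fin d)),
        DiscreteFrechet.ComputesWithin (fun _ : Unit => g) P k (T (m + 1)) A B
          (fun δ => DiscreteFrechet.IsSRange (fun s t => (g s t : WithTop ℝ)) A B δ)) := by
  classical
  refine ⟨⟨DiscreteFrechet.solve d DiscreteFrechet.BExp.never (.sub (.var 2) (.var 1)), d + 20,
      fun n => _ * DiscreteFrechet.solveSteps n, DiscreteFrechet.isBigO_solveSteps _,
      fun m A B => DiscreteFrechet.solve_computesWithin A B
        (fun W σ => ⟨fun h => absurd h DiscreteFrechet.BExp.not_holds_never, fun _ => rfl⟩) ?_⟩,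
    ⟨DiscreteFrechet.solve d DiscreteFrechet.BExp.isZero (.div (.var 2) (.var 1)), d + 20,
      fun n => _ * DiscreteFrechet.solveSteps n, DiscreteFrechet.isBigO_solveSteps _,
      fun m A B => DiscreteFrechet.solve_computesWithin A B
        (fun W σ => ⟨fun h => if_pos (DiscreteFrechet.BExp.holds_isZero.1 h),
          fun h => if_neg (mt DiscreteFrechet.BExp.holds_isZero.2 h)⟩) ?_⟩,
    ⟨DiscreteFrechet.solve d DiscreteFrechet.BExp.never (.call () (.var 1) (.var 2)), d + 20,
      fun n => _ * DiscreteFrechet.solveSteps n, DiscreteFrechet.isBigO_solveSteps _,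
      fun g hg m A B => DiscreteFrechet.solve_computesWithin A B
        (fun W σ => ⟨fun h => absurd h DiscreteFrechet.BExp.not_holds_never, fun _ => rfl⟩) ?_⟩⟩
  · intro c a b e _ h1 _ h2
    exact WithTop.coe_le_coe.2 (by linarith)
  · intro c a b e h0 h1 h2 h3
    -- A larger range that starts at 0 has ratio `⊤`, so there is nothing to compare; otherwise both
    -- denominators are positive.
    rcases h0.eq_or_lt with rfl | h0
    · simp
    · rw [if_neg (h0.trans_le h1).ne', if_neg h0.ne']
      refine WithTop.coe_le_coe.2 ?_
      have := div_le_div₀ (by linarith : (0 : ℝ) ≤ e) h3 h0 h1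
      exact this
  · intro c a b e h0 h1 h2 h3
    exact WithTop.coe_le_coe.2 (hg c a b e h0 h1 h2 h3)
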